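/- For $d\ge 1$ let $L_d$ be the Ehrhart polynomial of the $d$-dimensional cross-polytope $P_d=\operatorname{conv}\{\pm e_1,\dots,\pm e_d\}\subset\mathbb{R}^d$, i.e. the polynomial with $L_d(m)=\#(\mathbb{Z}^d\cap mP_d)$ for all integers $m\ge 0$, and let $$E_d(t)=\sum_{m\ge 0}L_d(m)t^m=\frac{(1+t)^d}{(1-t)^{d+1}}.$$ Fix $\epsilon\in(0,1/2)$ and put $S_d=\{z\in\mathbb{C}:\ \operatorname{Re}z\in[\epsilon,1-\epsilon],\ |z|\le d-d^{1/6}\}$. For $x\in S_d$ with $\tau=\operatorname{Im}x>0$ let $$\alpha=\alpha(x)=-i\left(\frac{d}{\tau}-\sqrt{\frac{d^2}{\tau^2}-1}\right),$$ let $C_m/m$ be the coefficient of degree $m$ in the Taylor expansion at $\alpha$ of $\log\{E_d(t)(1-t)t^{i\tau}\}=d\log\frac{1+t}{1-t}+i\tau\log t$ (for $m\ge1$ it does not depend on the branch), and let $$I_d(x)=\int_{-1/3}^{\infty}\exp\left\{-i\,\frac98\,\frac{C_2^3}{C_3^2}\,F(T)\right\}U'(T)\,dT,\qquad F(T)=2T^2\frac{(2T+1)^2\sqrt{T+1}}{(3T+1)^{3/2}},\qquad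 U(T)=T\left(\sqrt{\frac{T+1}{3T+1}}+i\right).$$ Powers of complex numbers are principal. Then there is a complex-valued function $\mathcal{F}(d,x)$ such that the following hold. 1. For all sufficiently large $d$ and all $x\in S_d$, $$L_d(-x)=\mathcal{F}(d,x)+(-1)^{d}\,\overline{\mathcal{F}(d,1-\overline{x})}\qquad\text{and}\qquad \mathcal{F}(d,\overline{x})=\overline{\mathcal{F}(d,x)}.$$ 2. For every $A>0$, as $d\to\infty$, uniformly for $x\in S_d$ with $|x|\le A\sqrt{\log d}$, $$\mathcal{F}(d,x)=\frac{\sin\pi x}{\pi}\left[(2d+1)^{-x}\,\Gamma(x)+O\left(\left|(2d+1)^{-x-1}\right|\right)\right].$$ 3. For every $c>0$, as $d\to\infty$, uniformly for $x\in S_d$ with $\operatorname{Im}x>0$ and $|x|\ge c\sqrt{\log d}$, the integral $I_d(x)$ converges absolutely and $$\mathcal{F}(d,x)=-\frac{1}{2\pi\alpha}\cdot\frac{3C_2}{2C_3}\,E_d(\alpha)\,\alpha^{x}\,I_d(x)\left\{1+O\left((\operatorname{Im}x)^{-1/28}\right)\right\}.$$ The implied constants, and the meaning of "sufficiently large $d$",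 depend only on $\epsilon$ and, in 2 and 3, on $A$ and $c$ respectively. By the second identity in 1, the case $\operatorname{Im}x<0$ of 3 is obtained by complex conjugation. -/

import Mathlib

open scoped Pointwise

/-! ### The Ehrhart polynomial of the cross-polytope -/

/-- The cross-polytope in `ℝ^d`: the convex hull of the points `e_j` and `-e_j`. -/
def crossPolytope (d : ℕ) : Set (Fin d → ℝ) :=
  convexHull ℝ {v | ∃ j : Fin d, v = Pi.single j 1 ∨ v = -Pi.single j 1}

/-- The number of integer points in the dilate `m • crossPolytope d`. -/
noncomputable def latticePointCount (d m : ℕ) : ℕ :=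
  Nat.card {v : Fin d → ℤ // (fun i => (v i : ℝ)) ∈ (m : ℝ) • crossPolytope d}

theorem crossPolytope_succ (d : ℕ) :
    crossPolytope (d + 1) = {v | ∑ i, |v i| ≤ 1} := by
  apply Set.Subset.antisymm
  · apply convexHull_min
    · rintro v ⟨j, rfl | rfl⟩
      · simp [Pi.single_apply, apply_ite abs]
      · simp [Pi.single_apply, apply_ite abs]
    · intro v hv w hw a b ha hb hab
      simp only [Set.mem_ofPred_eq] at *
      calc ∑ i, |(a • v + b • w) i| ≤ ∑ i, (a * |v i| + b * |w i|) := by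
            apply Finset.sum_le_sum
            intro i _
            calc |(a • v + b • w) i| ≤ |a * v i| + |b * w i| := abs_add_le _ _
              _ = _ := by rw [abs_mul, abs_mul, abs_of_nonneg ha, abs_of_nonneg hb]
        _ = a * ∑ i, |v i| + b * ∑ i, |w i| := by
            rw [Finset.sum_add_distrib, Finset.mul_sum, Finset.mul_sum]
        _ ≤ a * 1 + b * 1 := by gcongr
        _ = 1 := by linarith
  · intro v hv
    simp only [Set.mem_ofPred_eq] at hv
    have hconv : Convex ℝ (crossPolytope (d + 1)) := convex_convexHull ℝ _
    have hpos : ∀ j : Fin (d + 1), (Pi.single j 1 : Fin (d + 1) → ℝ) ∈ crossPolytope (d + 1) :=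
      fun j => subset_convexHull ℝ _ ⟨j, Or.inl rfl⟩
    have hneg : ∀ j : Fin (d + 1), (-Pi.single j 1 : Fin (d + 1) → ℝ) ∈ crossPolytope (d + 1) :=
      fun j => subset_convexHull ℝ _ ⟨j, Or.inr rfl⟩
    have h0 : (0 : Fin (d + 1) → ℝ) ∈ crossPolytope (d + 1) := by
      have := hconv (hpos 0) (hneg 0) (by norm_num : (0 : ℝ) ≤ 1 / 2)
        (by norm_num : (0 : ℝ) ≤ 1 / 2) (by norm_num)
      simpa using this
    set s := ∑ i, |v i| with hs
    have hs0 : 0 ≤ s := Finset.sum_nonneg fun i _ => abs_nonneg _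
    rcases hs0.eq_or_lt with h | h
    · have : v = 0 := by
        ext i
        have := (Finset.sum_eq_zero_iff_of_nonneg
          (fun i _ => abs_nonneg (v i))).1 h.symm i (Finset.mem_univ i)
        simpa using this
      rwa [this]
    · have h1 : ∑ i, (|v i| / s) • (if 0 ≤ v i then (Pi.single i 1 : Fin (d + 1) → ℝ)
          else -Pi.single i 1) ∈ crossPolytope (d + 1) := by
        apply hconv.sum_mem
        · intro i _
          positivity
        · rw [← Finset.sum_div, ← hs, div_self h.ne']
        · intro i _
          split_ifs
          · exact hpos i
          · exact hneg i
      have h2 := hconv h1 h0 hs0 (by linarith : (0 : ℝ) ≤ 1 - s) (by ring)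
      convert h2 using 1
      ext k
      simp only [smul_zero, add_zero, Pi.smul_apply, Finset.sum_apply, smul_eq_mul]
      rw [Finset.sum_eq_single k]
      · split_ifs with hk
        · simp [abs_of_nonneg hk]
          field_simp
        · simp [abs_of_neg (not_le.1 hk)]
          field_simp
      · intro b _ hb
        split_ifs <;> simp [hb.symm]
      · simp

theorem mem_smul_crossPolytope (d m : ℕ) (v : Fin (d + 1) → ℤ) :
    (fun i => (v i : ℝ)) ∈ (m : ℝ) • crossPolytope (d + 1) ↔ ∑ i, (v i).natAbs ≤ m := by
  have hcast : ((∑ i, (v i).natAbs : ℕ) : ℝ) = ∑ i, |(v i : ℝ)| := by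
    push_cast
    exact Finset.sum_congr rfl fun i _ => by rw [Nat.cast_natAbs, Int.cast_abs]
  rw [crossPolytope_succ, ← Nat.cast_le (α := ℝ), hcast]
  constructor
  · rintro ⟨y, hy, h⟩
    have h' : ∀ i, (v i : ℝ) = m * y i := fun i => (congrFun h i).symm
    simp only [h', abs_mul, ← Finset.mul_sum, Nat.abs_cast]
    exact mul_le_of_le_one_right (Nat.cast_nonneg m) hy
  · intro h
    rcases Nat.eq_zero_or_pos m with rfl | hm
    · refine ⟨0, by simp, ?_⟩
      ext i
      have h0 : ∑ i, |(v i : ℝ)| = 0 :=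
        le_antisymm (by simpa using h) (Finset.sum_nonneg fun i _ => abs_nonneg _)
      have := (Finset.sum_eq_zero_iff_of_nonneg
        (fun i _ => abs_nonneg (v i : ℝ))).1 h0 i (Finset.mem_univ i)
      have hv : (v i : ℝ) = 0 := abs_eq_zero.1 this
      simp [hv]
    · have hm' : (0 : ℝ) < m := by exact_mod_cast hm
      refine ⟨fun i => (v i : ℝ) / m, ?_, ?_⟩
      · simp only [Set.mem_ofPred_eq, abs_div, Nat.abs_cast, ← Finset.sum_div]
        exact (div_le_one hm').2 h
      · ext i
        simp only [Pi.smul_apply, smul_eq_mul]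
        field_simp

/-- Splitting off one integer coordinate from an `ℓ¹`-ball. -/
def ballStepEquiv {W : Type} (f : W → ℕ) (m : ℕ) :
    {p : ℤ × W // p.1.natAbs + f p.2 ≤ m + 1} ≃
      {p : ℤ × W // p.1.natAbs + f p.2 ≤ m} ⊕ {w : W // f w ≤ m + 1} ⊕ {w : W // f w ≤ m} where
  toFun p :=
    if h0 : p.1.1 = 0 then Sum.inr (Sum.inl ⟨p.1.2, by have := p.2; omega⟩)
    else if h1 : p.1.1 = -1 then Sum.inr (Sum.inr ⟨p.1.2, by have := p.2; omega⟩)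
    else if h2 : 0 < p.1.1 then Sum.inl ⟨(p.1.1 - 1, p.1.2), by have := p.2; dsimp only; omega⟩
    else Sum.inl ⟨(p.1.1 + 1, p.1.2), by have := p.2; dsimp only; omega⟩
  invFun q := match q with
    | Sum.inl p => if 0 ≤ p.1.1 then ⟨(p.1.1 + 1, p.1.2), by have := p.2; dsimp only; omega⟩
        else ⟨(p.1.1 - 1, p.1.2), by have := p.2; dsimp only; omega⟩
    | Sum.inr (Sum.inl w) => ⟨(0, w.1), by have := w.2; dsimp only; omega⟩
    | Sum.inr (Sum.inr w) => ⟨(-1, w.1), by have := w.2; dsimp only; omega⟩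
  left_inv := by
    rintro ⟨⟨k, w⟩, h⟩
    dsimp only
    split_ifs with h0 h1 h2
    · simp [h0]
    · simp [h1]
    · simp
      omega
    · have : ¬ 0 ≤ k + 1 := by omega
      simp [this]
  right_inv := by
    rintro (⟨⟨k, w⟩, h⟩ | ⟨w, h⟩ | ⟨w, h⟩)
    · dsimp only
      by_cases hk : 0 ≤ k
      · have h1 : k + 1 ≠ 0 := by omega
        have h2 : k + 1 ≠ -1 := by omega
        have h3 : 0 < k + 1 := by omega
        simp [hk, h1, h2, h3]
      · have h1 : k - 1 ≠ 0 := by omega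
        have h2 : k - 1 ≠ -1 := by omega
        have h3 : ¬ 0 < k - 1 := by omega
        simp only [hk, if_false, dif_neg h1, dif_neg h2, dif_neg h3]
        simp
    · simp
    · simp

instance finite_l1Ball (d m : ℕ) : Finite {v : Fin d → ℤ // ∑ i, (v i).natAbs ≤ m} := by
  apply Set.Finite.to_subtype
  apply (Set.Finite.pi' (fun _ : Fin d => Set.finite_Icc (-(m : ℤ)) m)).subset
  intro v hv i
  have h1 : (v i).natAbs ≤ ∑ i, (v i).natAbs :=
    Finset.single_le_sum (f := fun i => (v i).natAbs) (fun _ _ => Nat.zero_le _)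
      (Finset.mem_univ i)
  have h2 : ∑ i, (v i).natAbs ≤ m := hv
  simp only [Set.mem_Icc]
  omega

/-- The coordinate form of the `ℓ¹`-ball in dimension `d + 1`. -/
def ballConsEquiv (d m : ℕ) :
    {v : Fin (d + 1) → ℤ // ∑ i, (v i).natAbs ≤ m} ≃
      {p : ℤ × (Fin d → ℤ) // p.1.natAbs + ∑ i, (p.2 i).natAbs ≤ m} :=
  (Fin.consEquiv fun _ => ℤ).symm.subtypeEquiv fun v => by
    rw [Fin.sum_univ_succ]
    rfl

theorem l1Ball_card (d : ℕ) : ∀ m : ℕ,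
    Nat.card {v : Fin d → ℤ // ∑ i, (v i).natAbs ≤ m} =
      ∑ i ∈ Finset.range (d + 1), d.choose i * (m + i).choose d := by
  induction d with
  | zero =>
    intro m
    simp
  | succ d ihd =>
    intro m
    induction m with
    | zero =>
      rw [Finset.sum_range_succ, Finset.sum_eq_zero]
      · simp only [Nat.le_zero, Finset.sum_eq_zero_iff, Finset.mem_univ, true_imp_iff,
          Int.natAbs_eq_zero, zero_add, Nat.choose_self, mul_one]
        rw [Nat.card_eq_one_iff_unique]
        refine ⟨⟨fun a b => Subtype.ext (funext fun i => by rw [a.2 i, b.2 i])⟩,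
          ⟨⟨fun _ => 0, fun _ => rfl⟩⟩⟩
      · intro i hi
        rw [Nat.choose_eq_zero_of_lt (n := 0 + i) (by simpa using hi), mul_zero]
    | succ m ihm =>
      have h1 : Finite {p : ℤ × (Fin d → ℤ) // p.1.natAbs + ∑ i, (p.2 i).natAbs ≤ m} :=
        Finite.of_equiv _ (ballConsEquiv d m)
      rw [Nat.card_congr (ballConsEquiv d (m + 1)),
        Nat.card_congr (ballStepEquiv (fun w : Fin d → ℤ => ∑ i, (w i).natAbs) m),
        Nat.card_sum, Nat.card_sum, ← Nat.card_congr (ballConsEquiv d m), ihm, ihd, ihd]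
      have e1 : ∀ i, (m + 1 + i).choose (d + 1) = (m + i).choose d + (m + i).choose (d + 1) := by
        intro i
        rw [show m + 1 + i = (m + i) + 1 by ring, Nat.choose_succ_succ]
      have e2 : ∑ i ∈ Finset.range (d + 1 + 1), (d + 1).choose i * (m + i).choose d =
          ∑ i ∈ Finset.range (d + 1), d.choose i * (m + 1 + i).choose d +
          ∑ i ∈ Finset.range (d + 1), d.choose i * (m + i).choose d := by
        rw [Finset.sum_range_succ']
        simp only [Nat.choose_succ_succ, add_mul, Finset.sum_add_distrib]
        rw [add_assoc]
        congr 1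
        · exact Finset.sum_congr rfl fun i _ => by rw [show m + (i + 1) = m + 1 + i by ring]
        · rw [Finset.sum_range_succ, Finset.sum_range_succ' _ d]
          simp
      simp only [e1, mul_add, Finset.sum_add_distrib]
      rw [e2]
      ring

theorem exists_ehrhartPolynomial (d : ℕ) :
    ∃ p : Polynomial ℂ, ∀ m : ℕ, p.eval (m : ℂ) = (latticePointCount d m : ℂ) := by
  cases d with
  | zero =>
    refine ⟨0, fun m => ?_⟩
    have : crossPolytope 0 = ∅ := by
      simp [crossPolytope]
    simp [latticePointCount, this]
  | succ d =>
    refine ⟨∑ i ∈ Finset.range (d + 1 + 1), Polynomial.C (((d + 1).choose i : ℂ) /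
      ((d + 1).factorial : ℂ)) *
        (descPochhammer ℂ (d + 1)).comp (Polynomial.X + Polynomial.C (i : ℂ)), fun m => ?_⟩
    have h : latticePointCount (d + 1) m =
        Nat.card {v : Fin (d + 1) → ℤ // ∑ i, (v i).natAbs ≤ m} :=
      Nat.card_congr (Equiv.subtypeEquivRight (mem_smul_crossPolytope d m))
    rw [h, l1Ball_card, Polynomial.eval_finsetSum]
    push_cast
    refine Finset.sum_congr rfl fun i _ => ?_
    have hf : ((d + 1).factorial : ℂ) ≠ 0 := by exact_mod_cast (d + 1).factorial_ne_zero
    simp only [Polynomial.eval_mul, Polynomial.eval_C, Polynomial.eval_comp, Polynomial.eval_add,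
      Polynomial.eval_X]
    rw [show (m : ℂ) + i = ((m + i : ℕ) : ℂ) by push_cast; rfl,
      descPochhammer_eval_eq_descFactorial, Nat.descFactorial_eq_factorial_mul_choose]
    push_cast
    field_simp

/-- The Ehrhart polynomial `L_d` of the `d`-dimensional cross-polytope: the polynomial whose value
at every `m : ℕ` is the number of integer points of the `m`-th dilate. -/
noncomputable def ehrhartPolynomial (d : ℕ) : Polynomial ℂ :=
  Classical.choose (exists_ehrhartPolynomial d)

theorem ehrhartPolynomial_eval_natCast (d m : ℕ) :
    (ehrhartPolynomial d).eval (m : ℂ) = (latticePointCount d m : ℂ) :=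
  Classical.choose_spec (exists_ehrhartPolynomial d) m

/-! ### The asymptotic formula -/

/-- The rational function `E_d(t) = ∑_m L_d(m) t^m = (1 + t)^d / (1 - t)^(d + 1)`. -/
noncomputable def ehrhartSeries (d : ℕ) (t : ℂ) : ℂ :=
  (1 + t) ^ d / (1 - t) ^ (d + 1)

/-- The region `S_d`. -/
def truncatedStrip (ε : ℝ) (d : ℕ) : Set ℂ :=
  {z | z.re ∈ Set.Icc ε (1 - ε) ∧ ‖z‖ ≤ (d : ℝ) - (d : ℝ) ^ (1 / 6 : ℝ)}

/-- The saddle point `α(x)`, used for `0 < Im x < d`. -/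
noncomputable def saddlePoint (d : ℕ) (x : ℂ) : ℂ :=
  -Complex.I * ((d / x.im - Real.sqrt ((d : ℝ) ^ 2 / x.im ^ 2 - 1) : ℝ) : ℂ)

/-- A branch of `log (E_d(t) (1 - t) t^(iτ)) = log (((1 + t) / (1 - t))^d t^(iτ))`.
It is analytic at every `t` in the open unit disk outside `(-1, 0]`, hence near the saddle point. -/
noncomputable def phase (d : ℕ) (τ : ℝ) (t : ℂ) : ℂ :=
  d * (Complex.log (1 + t) - Complex.log (1 - t)) + Complex.I * τ * Complex.log t

/-- `C_m`, where `C_m / m` is the coefficient of degree `m` of the Taylor series of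
`phase d (Im x)` around the saddle point. -/
noncomputable def phaseCoeff (d : ℕ) (x : ℂ) (m : ℕ) : ℂ :=
  m * (iteratedDeriv m (phase d x.im) (saddlePoint d x) / (m.factorial : ℂ))

/-- `F(T) = 2 T² (2T + 1)² √(T + 1) / (3T + 1)^(3/2)`. -/
noncomputable def pathExponent (T : ℝ) : ℝ :=
  2 * T ^ 2 * ((2 * T + 1) ^ 2 * Real.sqrt (T + 1) / (3 * T + 1) ^ (3 / 2 : ℝ))

/-- `U(T) = T (√((T + 1) / (3T + 1)) + i)`. -/
noncomputable def pathCurve (T : ℝ) : ℂ :=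
  T * (Real.sqrt ((T + 1) / (3 * T + 1)) + Complex.I)

/-- The integrand `exp (-i (9/8) (C₂³ / C₃²) F(T)) U'(T)`. -/
noncomputable def saddleIntegrand (d : ℕ) (x : ℂ) (T : ℝ) : ℂ :=
  Complex.exp (-Complex.I * (9 / 8) * (phaseCoeff d x 2 ^ 3 / phaseCoeff d x 3 ^ 2) *
    pathExponent T) * deriv pathCurve T

/-- `I_d(x)`, the integral of `saddleIntegrand d x` over `(-1/3, ∞)`. -/
noncomputable def saddleIntegral (d : ℕ) (x : ℂ) : ℂ :=
  ∫ T in Set.Ioi (-1 / 3 : ℝ), saddleIntegrand d x T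

/-! The function F is sin(πx)/π times the Mellin integral of E_d(-s) over (0,1) (`ehrhartHalf`). The
substitution s = u/(1-u) makes this integral the part u ≤ 1/2 of the integral over [0,1] of u^(x-1)
(1-u)^(-x) (1-2u)^d. Expanding 1-2u = (1-u)-u turns the full integral into Beta integrals with sum
π/sin(πx) · L_d(-x) (`integral_betaTerm`), and u ↦ 1-u exchanges the two parts and x with 1-x, at
the price of a sign (-1)^d. Hence the decomposition `ehrhartPolynomial_eval_neg_eq`.

In the Gamma regime E_d(-s) is close to exp(-(2d+1)s) (`abs_ehrhartSeries_sub_exp_le`), whose Mellin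
transform is (2d+1)^(-x) Γ(x); `norm_halfMellin_sub_Gamma_le` integrates the error.

In the saddle regime put α = -ia and t = -iaz, so that the saddle is z = 1. Up to explicit factors F
is the value at t = -1 of the primitive of z^(x-1) E_d(-iaz) based at the origin (`rayPrimitive`).
Its increment along a steepest-descent path through z = 1 is the main term. At the right end of the
path the primitive is negligible (`norm_rayPrimitive_le`); at the left end it nearly equals its
value at t = -1 (`norm_rayPrimitive_sub_endpoint_le`).

As Im x approaches d the quadratic coefficient of the phase tends to 0 and two saddle points merge,
so a Gaussian approximation is not uniform. The phase is kept to third order instead; rescaled by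
`saddleScale` it becomes μ(iU² + U³), which equals -μF(T) on the curve U(T) (`pathCurve_cubic`).
Uniformity in μ rests on three facts: F(T) dominates both X² and |X|³ with X = Re U
(`sq_mul_le_pathExponent`); the model integral is bounded below by a mass of the same shape as the
error majorant (`cubicMass_le_norm_integral`, `integral_cubicWeight_le`); the quartic remainder of
the phase costs a factor τ^(-1/3), τ = Im x (`add_pow_four_le_exp`). For τ ≥ 1 this is stronger than
τ^(-1/28). -/

/-! ### Beta integrals and the decomposition of L_d(-x). -/

/-- The Mellin-type integral `∫₀¹ s^(x-1) (1-s)^d / (1+s)^(d+1) ds`. -/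
noncomputable def halfMellin (d : ℕ) (x : ℂ) : ℂ :=
  ∫ s in (0 : ℝ)..1, (s : ℂ) ^ (x - 1) * ehrhartSeries d (-s)

/-- One of the two conjugate-symmetric halves of `L_d(-x)`. -/
noncomputable def ehrhartHalf (d : ℕ) (x : ℂ) : ℂ :=
  Complex.sin (Real.pi * x) / Real.pi * halfMellin d x

theorem ehrhartHalf_conj (d : ℕ) (x : ℂ) :
    ehrhartHalf d ((starRingEnd ℂ) x) = (starRingEnd ℂ) (ehrhartHalf d x) := by
  unfold ehrhartHalf halfMellin
  rw [map_mul, map_div₀, Complex.conj_ofReal, ← Complex.sin_conj, map_mul, Complex.conj_ofReal]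
  congr 1
  rw [intervalIntegral.integral_of_le zero_le_one, intervalIntegral.integral_of_le zero_le_one,
    ← integral_conj]
  refine MeasureTheory.setIntegral_congr_fun measurableSet_Ioc fun s hs => ?_
  have harg : (s : ℂ).arg ≠ Real.pi := by
    rw [Complex.arg_ofReal_of_nonneg hs.1.le]
    exact Real.pi_pos.ne
  have h1 : (starRingEnd ℂ) x - 1 = (starRingEnd ℂ) (x - 1) := by simp
  simp only [map_mul, h1]
  rw [Complex.cpow_conj _ _ harg, Complex.conj_ofReal]
  simp [ehrhartSeries]

/-- The substitution s = u/(1-u) maps (0,1/2) onto (0,1). The new integrand keeps its form, up to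
the sign (-1)^d, under u ↦ 1-u, x ↦ 1-x; this symmetry is invisible in the variable s. -/
theorem halfMellin_eq_integral_half (d : ℕ) (x : ℂ) :
    halfMellin d x =
      ∫ u in (0 : ℝ)..(1 / 2), (u : ℂ) ^ (x - 1) * (1 - u : ℂ) ^ (-x) * (1 - 2 * u : ℂ) ^ d := by
  have himg : (fun u : ℝ => u / (1 - u)) '' Set.Ioo 0 (1 / 2) = Set.Ioo 0 1 := by
    ext s
    constructor
    · rintro ⟨u, ⟨h0, h1⟩, rfl⟩
      have : 0 < 1 - u := by linarith
      exact ⟨by positivity, by rw [div_lt_one this]; linarith⟩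
    · rintro ⟨h0, h1⟩
      refine ⟨s / (1 + s), ⟨by positivity, ?_⟩, ?_⟩
      · rw [div_lt_div_iff₀ (by linarith) (by norm_num)]
        linarith
      · have : 1 + s ≠ 0 := by linarith
        field_simp
        ring
  have hd : ∀ u ∈ Set.Ioo (0 : ℝ) (1 / 2),
      HasDerivWithinAt (fun u : ℝ => u / (1 - u)) (1 / (1 - u) ^ 2) (Set.Ioo 0 (1 / 2)) u := by
    intro u hu
    have h : 1 - u ≠ 0 := by linarith [hu.2]
    have := (hasDerivAt_id u).div ((hasDerivAt_const u (1 : ℝ)).sub (hasDerivAt_id u)) h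
    refine (this.congr_deriv ?_).hasDerivWithinAt
    simp
  have hinj : Set.InjOn (fun u : ℝ => u / (1 - u)) (Set.Ioo 0 (1 / 2)) := by
    intro u hu v hv h
    have h1 : 1 - u ≠ 0 := by linarith [hu.2]
    have h2 : 1 - v ≠ 0 := by linarith [hv.2]
    simp only [div_eq_div_iff h1 h2] at h
    linarith
  unfold halfMellin
  rw [intervalIntegral.integral_of_le zero_le_one, intervalIntegral.integral_of_le (by norm_num),
    MeasureTheory.integral_Ioc_eq_integral_Ioo, MeasureTheory.integral_Ioc_eq_integral_Ioo, ← himg,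
    MeasureTheory.integral_image_eq_integral_abs_deriv_smul measurableSet_Ioo hd hinj]
  refine MeasureTheory.setIntegral_congr_fun measurableSet_Ioo fun u hu => ?_
  have hv : 0 < 1 - u := by linarith [hu.2]
  have hvc : (1 - u : ℂ) ≠ 0 := by exact_mod_cast hv.ne'
  have huc : (u : ℂ) ≠ 0 := by exact_mod_cast hu.1.ne'
  have e1 : ((u / (1 - u) : ℝ) : ℂ) ^ (x - 1) = (u : ℂ) ^ (x - 1) * (1 - u : ℂ) ^ (1 - x) := by
    rw [Complex.ofReal_div, Complex.div_cpow_ofReal_nonneg hu.1.le hv.le, div_eq_mul_inv,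
      ← Complex.cpow_neg, neg_sub]
    push_cast
    rfl
  have e2 : (1 - u : ℂ) ^ (1 - x) = (1 - u : ℂ) ^ (-x) * (1 - u) := by
    rw [show 1 - x = -x + 1 by ring, Complex.cpow_add _ _ hvc, Complex.cpow_one]
  have e3 : ehrhartSeries d (-((u / (1 - u) : ℝ) : ℂ)) = (1 - 2 * u : ℂ) ^ d * (1 - u) := by
    unfold ehrhartSeries
    have f1 : (1 + -((u / (1 - u) : ℝ) : ℂ)) = (1 - 2 * u) / (1 - u) := by
      push_cast
      field_simp
      ring
    have f2 : (1 - -((u / (1 - u) : ℝ) : ℂ)) = 1 / (1 - u) := by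
      push_cast
      field_simp
      ring
    rw [f1, f2, div_pow, div_pow, one_pow, pow_succ]
    field_simp
  simp only [e1, e2, e3]
  rw [abs_of_pos (by positivity), Complex.real_smul]
  push_cast
  field_simp

theorem integrable_betaTerm {x : ℂ} (h0 : 0 < x.re) (h1 : x.re < 1) (d : ℕ) :
    IntervalIntegrable
      (fun u : ℝ => (u : ℂ) ^ (x - 1) * (1 - u : ℂ) ^ (-x) * (1 - 2 * u : ℂ) ^ d)
      MeasureTheory.volume 0 1 := by
  have h := Complex.betaIntegral_convergent (u := x) (v := 1 - x) h0 (by simpa using h1)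
  simp only [sub_sub_cancel_left] at h
  exact h.mul_continuousOn (by fun_prop)

theorem Gamma_add_natCast {z : ℂ} (hz : 0 < z.re) (n : ℕ) :
    Complex.Gamma (z + n) = (ascPochhammer ℂ n).eval z * Complex.Gamma z := by
  have hk : ∀ k : ℕ, z ≠ -k := by
    rintro k rfl
    simp at hz
    have : (0 : ℝ) ≤ k := Nat.cast_nonneg k
    linarith
  rw [← Complex.Gamma_add_nat_div_Gamma_eq z hk,
    div_mul_cancel₀ _ (Complex.Gamma_ne_zero_of_re_pos hz)]

/-- The integer shifts of the Gamma arguments produce the rising factorials, the reflection formula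
produces π/sin(πx), and the two arguments add up to the integer i + j + 1. -/
theorem betaIntegral_add_natCast {x : ℂ} (h0 : 0 < x.re) (h1 : x.re < 1) (i j : ℕ) :
    Complex.betaIntegral (x + i) (1 - x + j) =
      Real.pi / Complex.sin (Real.pi * x) *
        ((ascPochhammer ℂ i).eval x * (ascPochhammer ℂ j).eval (1 - x) / ((i + j).factorial : ℂ)) := by
  have h1' : 0 < (1 - x).re := by simpa using h1
  rw [Complex.betaIntegral_eq_Gamma_mul_div, Gamma_add_natCast h0, Gamma_add_natCast h1',
    ← Complex.Gamma_mul_Gamma_one_sub, show x + i + (1 - x + j) = ((i + j : ℕ) : ℂ) + 1 by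
      push_cast; ring, Complex.Gamma_nat_eq_factorial]
  · ring
  · simp only [Complex.add_re, Complex.natCast_re]; positivity
  · simp only [Complex.add_re, Complex.natCast_re]; positivity

/-- The lattice-point formula Σ C(d,i) C(m+i,d) is polynomial in m, hence also valid at -x. In the
falling factorial of length d at -x+i the first i factors form the rising factorial of 1-x, and the
other d-i form, up to sign, that of x. The case d = 0 is different: `crossPolytope 0` is empty, so
its polynomial is 0 and not 1. -/
theorem ehrhartPolynomial_eval_neg {d : ℕ} (hd : 0 < d) (x : ℂ) :
    (ehrhartPolynomial d).eval (-x) = ∑ i ∈ Finset.range (d + 1), (d.choose i : ℂ) *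
      ((-1) ^ (d - i) * ((ascPochhammer ℂ (d - i)).eval x * (ascPochhammer ℂ i).eval (1 - x))
        / (d.factorial : ℂ)) := by
  obtain ⟨n, rfl⟩ : ∃ n, d = n + 1 := ⟨d - 1, by omega⟩
  set q : Polynomial ℂ := ∑ i ∈ Finset.range (n + 1 + 1),
    Polynomial.C (((n + 1).choose i : ℂ) / ((n + 1).factorial : ℂ)) *
      (descPochhammer ℂ (n + 1)).comp (Polynomial.X + Polynomial.C (i : ℂ)) with hq
  have hev : ∀ y : ℂ, q.eval y = ∑ i ∈ Finset.range (n + 1 + 1),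
      ((n + 1).choose i : ℂ) / ((n + 1).factorial : ℂ) *
        (descPochhammer ℂ (n + 1)).eval (y + i) := by
    intro y
    rw [hq, Polynomial.eval_finsetSum]
    simp
  have hpq : ehrhartPolynomial (n + 1) = q := by
    apply Polynomial.eq_of_infinite_eval_eq
    refine (Set.infinite_range_of_injective (Nat.cast_injective (R := ℂ))).mono ?_
    rintro _ ⟨m, rfl⟩
    rw [Set.mem_ofPred_eq, ehrhartPolynomial_eval_natCast, hev]
    have h : latticePointCount (n + 1) m =
        Nat.card {v : Fin (n + 1) → ℤ // ∑ i, (v i).natAbs ≤ m} :=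
      Nat.card_congr (Equiv.subtypeEquivRight (mem_smul_crossPolytope n m))
    rw [h, l1Ball_card]
    push_cast
    refine Finset.sum_congr rfl fun i _ => ?_
    have hf : ((n + 1).factorial : ℂ) ≠ 0 := by exact_mod_cast (n + 1).factorial_ne_zero
    rw [show (m : ℂ) + i = ((m + i : ℕ) : ℂ) by push_cast; rfl,
      descPochhammer_eval_eq_descFactorial, Nat.descFactorial_eq_factorial_mul_choose]
    push_cast
    field_simp
  rw [hpq, hev]
  refine Finset.sum_congr rfl fun i hi => ?_
  have hi' : i ≤ n + 1 := by simpa [Nat.lt_succ_iff] using hi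
  have e : (descPochhammer ℂ (n + 1)).eval (-x + i) =
      (-1) ^ (n + 1 - i) * ((ascPochhammer ℂ (n + 1 - i)).eval x *
        (ascPochhammer ℂ i).eval (1 - x)) := by
    conv_lhs => rw [show n + 1 = i + (n + 1 - i) by omega]
    have hx := ascPochhammer_eval_neg_eq_descPochhammer ℂ (-x) (n + 1 - i)
    rw [neg_neg] at hx
    rw [← descPochhammer_mul, Polynomial.eval_mul, Polynomial.eval_comp,
      descPochhammer_eval_eq_ascPochhammer, hx]
    have hs : ((-1 : ℂ) ^ (n + 1 - i)) * (-1) ^ (n + 1 - i) = 1 := by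
      rw [← mul_pow]; simp
    simp only [Polynomial.eval_sub, Polynomial.eval_X, Polynomial.eval_natCast]
    rw [show -x + (i : ℂ) - i + 1 = 1 - x by ring, show -x + (i : ℂ) - i = -x by ring]
    linear_combination (-(Polynomial.eval (1 - x) (ascPochhammer ℂ i) *
      Polynomial.eval (-x) (descPochhammer ℂ (n + 1 - i)))) * hs
  rw [e]
  ring

/-- Writing 1-2u = (1-u) + (-u) and expanding gives Beta integrals with shifted parameters, which
match the terms of `ehrhartPolynomial_eval_neg` one by one. The point u = 1 is discarded because
powers of 1-u cannot be split there. -/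
theorem integral_betaTerm {x : ℂ} (h0 : 0 < x.re) (h1 : x.re < 1) {d : ℕ} (hd : 0 < d) :
    ∫ u in (0 : ℝ)..1, (u : ℂ) ^ (x - 1) * (1 - u : ℂ) ^ (-x) * (1 - 2 * u : ℂ) ^ d =
      Real.pi / Complex.sin (Real.pi * x) * (ehrhartPolynomial d).eval (-x) := by
  have h1' : 0 < (1 - x).re := by simpa using h1
  have key : ∀ u ∈ Set.Ioc (0 : ℝ) 1, u ≠ 1 →
      (u : ℂ) ^ (x - 1) * (1 - u : ℂ) ^ (-x) * (1 - 2 * u : ℂ) ^ d =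
      ∑ i ∈ Finset.range (d + 1), (d.choose i : ℂ) * (-1) ^ (d - i) *
        ((u : ℂ) ^ (x + (d - i : ℕ) - 1) * (1 - u : ℂ) ^ (1 - x + i - 1)) := by
    intro u hu hne
    have huc : (u : ℂ) ≠ 0 := by exact_mod_cast hu.1.ne'
    have hvc : (1 - u : ℂ) ≠ 0 := by
      rw [sub_ne_zero]; exact_mod_cast hne.symm
    rw [show (1 - 2 * u : ℂ) = (1 - u) + (-u) by ring, add_pow, Finset.mul_sum]
    refine Finset.sum_congr rfl fun i _ => ?_
    rw [show x + ((d - i : ℕ) : ℂ) - 1 = (x - 1) + ((d - i : ℕ) : ℂ) by ring,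
      show 1 - x + (i : ℂ) - 1 = -x + i by ring, Complex.cpow_add _ _ huc,
      Complex.cpow_add _ _ hvc, Complex.cpow_natCast, Complex.cpow_natCast, neg_pow]
    ring
  have hint : ∀ i : ℕ, IntervalIntegrable (fun u : ℝ => (u : ℂ) ^ (x + (d - i : ℕ) - 1) *
      (1 - u : ℂ) ^ (1 - x + i - 1)) MeasureTheory.volume 0 1 := by
    intro i
    apply Complex.betaIntegral_convergent
    · simp only [Complex.add_re, Complex.natCast_re]; positivity
    · simp only [Complex.add_re, Complex.natCast_re]; positivity
  rw [intervalIntegral.integral_congr_ae (g := fun u : ℝ =>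
    ∑ i ∈ Finset.range (d + 1), (d.choose i : ℂ) * (-1) ^ (d - i) *
        ((u : ℂ) ^ (x + (d - i : ℕ) - 1) * (1 - u : ℂ) ^ (1 - x + i - 1)))]
  · rw [intervalIntegral.integral_finsetSum fun i _ => (hint i).const_mul _,
      ehrhartPolynomial_eval_neg hd, Finset.mul_sum]
    refine Finset.sum_congr rfl fun i hi => ?_
    have hi' : i ≤ d := by simpa [Nat.lt_succ_iff] using hi
    rw [intervalIntegral.integral_const_mul]
    have := betaIntegral_add_natCast h0 h1 (d - i) i
    rw [Complex.betaIntegral] at this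
    rw [this, Nat.sub_add_cancel hi']
    ring
  · filter_upwards [MeasureTheory.Measure.ae_ne MeasureTheory.volume (1 : ℝ)] with u hu hmem
    rw [Set.uIoc_of_le zero_le_one] at hmem
    exact key u hmem hu

/-- Cut the Beta-type integral at u = 1/2 and reflect the upper part. Since sin(π(1-x)) = sin(πx),
both parts carry the same prefactor, and conjugation symmetry rewrites the second one in the
required form. -/
theorem ehrhartPolynomial_eval_neg_eq {x : ℂ} (h0 : 0 < x.re) (h1 : x.re < 1) {d : ℕ}
    (hd : 0 < d) :
    (ehrhartPolynomial d).eval (-x) = ehrhartHalf d x +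
      (-1) ^ d * (starRingEnd ℂ) (ehrhartHalf d (1 - (starRingEnd ℂ) x)) := by
  -- If the sine vanished, the reflection formula would read Γ(x)Γ(1-x) = π/0 = 0, but Γ has no
  -- zeros.
  have hsin : Complex.sin (Real.pi * x) ≠ 0 := by
    intro h
    have h2 := Complex.Gamma_mul_Gamma_one_sub x
    rw [h, div_zero] at h2
    exact mul_ne_zero (Complex.Gamma_ne_zero_of_re_pos h0)
      (Complex.Gamma_ne_zero_of_re_pos (by simpa using h1)) h2
  have hpi : (Real.pi : ℂ) ≠ 0 := by exact_mod_cast Real.pi_ne_zero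
  have hi := integrable_betaTerm h0 h1 d
  have hsplit := intervalIntegral.integral_add_adjacent_intervals
    (hi.mono_set (c := 0) (d := 1 / 2) (by
      rw [Set.uIcc_of_le (by norm_num), Set.uIcc_of_le (by norm_num)]
      exact Set.Icc_subset_Icc le_rfl (by norm_num)))
    (hi.mono_set (c := 1 / 2) (d := 1) (by
      rw [Set.uIcc_of_le (by norm_num), Set.uIcc_of_le (by norm_num)]
      exact Set.Icc_subset_Icc (by norm_num) le_rfl))
  have hrefl : ∫ u in (1 / 2 : ℝ)..1,
      (u : ℂ) ^ (x - 1) * (1 - u : ℂ) ^ (-x) * (1 - 2 * u : ℂ) ^ d =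
      (-1) ^ d * halfMellin d (1 - x) := by
    rw [halfMellin_eq_integral_half]
    have := intervalIntegral.integral_comp_sub_left (a := 0) (b := 1 / 2)
      (fun u : ℝ => (u : ℂ) ^ (x - 1) * (1 - u : ℂ) ^ (-x) * (1 - 2 * u : ℂ) ^ d) 1
    norm_num at this
    norm_num
    rw [← this, ← intervalIntegral.integral_const_mul]
    refine intervalIntegral.integral_congr fun u _ => ?_
    rw [show (1 - 2 * (1 - u) : ℂ) = (-1) * (1 - 2 * u) by ring, mul_pow]
    ring
  rw [← halfMellin_eq_integral_half, hrefl, integral_betaTerm h0 h1 hd] at hsplit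
  have hc : 1 - (starRingEnd ℂ) x = (starRingEnd ℂ) (1 - x) := by simp
  rw [hc, ehrhartHalf_conj, Complex.conj_conj]
  unfold ehrhartHalf
  have hs : Complex.sin (Real.pi * (1 - x)) = Complex.sin (Real.pi * x) := by
    rw [mul_sub, mul_one, Complex.sin_pi_sub]
  rw [hs]
  have hsplit' : (ehrhartPolynomial d).eval (-x) = Complex.sin (Real.pi * x) / Real.pi *
      (halfMellin d x + (-1) ^ d * halfMellin d (1 - x)) := by
    rw [hsplit, ← mul_assoc, div_mul_div_cancel₀ hpi, div_self hsin, one_mul]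
  rw [hsplit']
  ring

/-! ### The Gamma regime. -/

/-- Since log((1-s)/(1+s)) = -2s + O(s³), the d-th power has relative error d s³ against exp(-2ds),
and 1/(1+s) has relative error s² against exp(-s). With the rate 2d+1 no first-order error is left.
-/
theorem abs_ehrhartSeries_sub_exp_le (d : ℕ) {s : ℝ} (h0 : 0 ≤ s) (h1 : s ≤ 1) :
    |(1 - s) ^ d / (1 + s) ^ (d + 1) - Real.exp (-((2 * d + 1) * s))| ≤
      (s ^ 2 + d * s ^ 3) * Real.exp (-((2 * d + 1) * s)) := by
  have hs1 : 0 < 1 + s := by linarith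
  have hN : Real.exp (-((2 * d + 1) * s)) = Real.exp (-(2 * s)) ^ d * Real.exp (-s) := by
    rw [← Real.exp_nat_mul, ← Real.exp_add]
    congr 1
    ring
  have hsplit : (1 - s) ^ d / (1 + s) ^ (d + 1) = ((1 - s) / (1 + s)) ^ d * (1 / (1 + s)) := by
    rw [div_pow, pow_succ]
    field_simp
  have hu1 : (1 - s) / (1 + s) ≤ Real.exp (-(2 * s)) := by
    rcases h1.eq_or_lt with rfl | h1
    · norm_num
      positivity
    · have h1' : 0 < 1 - s := by linarith
      have h := le_hasSum (Real.hasSum_log_sub_log_of_abs_lt_one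
        (by rwa [abs_of_nonneg h0] : |s| < 1)) 0 (fun k _ => by positivity)
      have h2 : Real.log ((1 - s) / (1 + s)) ≤ -(2 * s) := by
        rw [Real.log_div h1'.ne' hs1.ne']
        norm_num at h
        linarith
      exact (Real.log_le_iff_le_exp (by positivity)).1 h2
  have hl1 : Real.exp (-(2 * s)) * (1 - s ^ 3) ≤ (1 - s) / (1 + s) := by
    -- This cubic minorant is chosen because (1-s)(1 + 2s + 2s² + s³) = (1+s)(1-s³) exactly.
    have hq : 1 + 2 * s + 2 * s ^ 2 + s ^ 3 ≤ Real.exp (2 * s) := by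
      have := Real.sum_le_exp_of_nonneg (x := 2 * s) (by linarith) 4
      simp [Finset.sum_range_succ, Nat.factorial] at this
      have : 0 ≤ s ^ 3 := by positivity
      nlinarith
    rw [Real.exp_neg, le_div_iff₀ hs1, inv_mul_eq_div, div_mul_eq_mul_div,
      div_le_iff₀ (Real.exp_pos _)]
    nlinarith [mul_le_mul_of_nonneg_left hq (by linarith : 0 ≤ 1 - s)]
  have hu2 : 1 / (1 + s) ≤ Real.exp (-s) * (1 + s ^ 2) := by
    have hq : Real.exp s ≤ 1 + s + s ^ 2 := by
      have := Real.abs_exp_sub_one_sub_id_le (x := s) (by rw [abs_of_nonneg h0]; exact h1)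
      linarith [(abs_le.1 this).2]
    rw [Real.exp_neg, inv_mul_eq_div, div_le_div_iff₀ hs1 (Real.exp_pos _)]
    nlinarith [pow_nonneg h0 3]
  have hl2 : Real.exp (-s) ≤ 1 / (1 + s) := by
    rw [Real.exp_neg, ← one_div]
    exact one_div_le_one_div_of_le hs1 (by linarith [Real.add_one_le_exp s])
  have hr0 : 0 ≤ (1 - s) / (1 + s) := div_nonneg (by linarith) hs1.le
  have hE := Real.exp_pos (-(2 * s))
  have hE1 := Real.exp_pos (-s)
  have hs3 : s ^ 3 ≤ 1 := pow_le_one₀ h0 h1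
  rw [hsplit, hN, abs_le]
  have hup : ((1 - s) / (1 + s)) ^ d * (1 / (1 + s)) ≤
      Real.exp (-(2 * s)) ^ d * (Real.exp (-s) * (1 + s ^ 2)) := by
    gcongr
  have hlow : Real.exp (-(2 * s)) ^ d * (1 - d * s ^ 3) * Real.exp (-s) ≤
      ((1 - s) / (1 + s)) ^ d * (1 / (1 + s)) := by
    have hb : 1 - d * s ^ 3 ≤ (1 - s ^ 3) ^ d := by
      have := one_add_mul_le_pow (a := -s ^ 3) (by linarith) d
      simpa [sub_eq_add_neg] using this
    calc _ ≤ Real.exp (-(2 * s)) ^ d * (1 - s ^ 3) ^ d * Real.exp (-s) := by gcongr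
      _ = (Real.exp (-(2 * s)) * (1 - s ^ 3)) ^ d * Real.exp (-s) := by rw [mul_pow]
      _ ≤ _ := by
        gcongr
  have hP : 0 < Real.exp (-(2 * s)) ^ d * Real.exp (-s) := by positivity
  constructor
  · have : 0 ≤ s ^ 2 * (Real.exp (-(2 * s)) ^ d * Real.exp (-s)) := by positivity
    linarith
  · have : 0 ≤ (d * s ^ 3) * (Real.exp (-(2 * s)) ^ d * Real.exp (-s)) := by positivity
    linarith

/-- With N = 2d+1, N^(-x) Γ(x) is the Mellin transform of exp(-Ns) over the whole half-line. Every
extra power of s in the error gains a factor 1/N, which also pays for the d in front of s³. The part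
s > 1, absent from `halfMellin`, obeys the same majorant because s² ≥ 1 there. -/
theorem norm_halfMellin_sub_Gamma_le {x : ℂ} (h0 : 0 < x.re) (d : ℕ) :
    ‖halfMellin d x - (2 * d + 1 : ℂ) ^ (-x) * Complex.Gamma x‖ ≤
      (Real.Gamma (x.re + 2) + Real.Gamma (x.re + 3)) * (2 * d + 1 : ℝ) ^ (-x.re - 1) := by
  set N : ℝ := 2 * d + 1 with hN
  have hN0 : 1 ≤ N := by have : (0 : ℝ) ≤ d := Nat.cast_nonneg d; linarith
  have hNp : 0 < N := by linarith
  have hGint : MeasureTheory.IntegrableOn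
      (fun s : ℝ => (s : ℂ) ^ (x - 1) * Complex.exp (-(N * s))) (Set.Ioi 0) := by
    -- Integrability is read off from the known value: a non-integrable function would have integral
    -- 0, while the value is nonzero.
    by_contra h
    have h1 := Complex.integral_cpow_mul_exp_neg_mul_Ioi h0 hNp
    rw [MeasureTheory.integral_undef h] at h1
    refine mul_ne_zero ?_ (Complex.Gamma_ne_zero_of_re_pos h0) h1.symm
    rw [Complex.cpow_ne_zero_iff]
    left
    exact one_div_ne_zero (by exact_mod_cast hNp.ne')
  have hpow : ∀ p : ℝ, 0 < p → MeasureTheory.IntegrableOn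
      (fun s : ℝ => s ^ (p - 1) * Real.exp (-(N * s))) (Set.Ioi 0) := by
    intro p hp
    by_contra h
    have h1 := Real.integral_rpow_mul_exp_neg_mul_Ioi hp hNp
    rw [MeasureTheory.integral_undef h] at h1
    have : 0 < (1 / N) ^ p * Real.Gamma p := by
      have := Real.Gamma_pos_of_pos hp
      positivity
    linarith
  set f : ℝ → ℂ := fun s => (s : ℂ) ^ (x - 1) * ehrhartSeries d (-s) with hf
  set g : ℝ → ℂ := fun s => (s : ℂ) ^ (x - 1) * Complex.exp (-(N * s)) with hg
  have hfint : MeasureTheory.IntegrableOn f (Set.Ioc 0 1) := by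
    have h1 : IntervalIntegrable (fun s : ℝ => (s : ℂ) ^ (x - 1)) MeasureTheory.volume 0 1 :=
      intervalIntegral.intervalIntegrable_cpow' (by simpa using h0)
    refine ((h1.mul_continuousOn ?_).1).congr_fun (fun s _ => rfl) measurableSet_Ioc
    · unfold ehrhartSeries
      refine ContinuousOn.div (by fun_prop) (by fun_prop) ?_
      intro s hs
      rw [Set.uIcc_of_le zero_le_one] at hs
      apply pow_ne_zero
      rw [sub_neg_eq_add]
      have : (1 + s : ℝ) ≠ 0 := by linarith [hs.1]
      exact_mod_cast this
  have hGval : ∫ s in Set.Ioi (0 : ℝ), g s = (2 * d + 1 : ℂ) ^ (-x) * Complex.Gamma x := by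
    rw [hg, Complex.integral_cpow_mul_exp_neg_mul_Ioi h0 hNp, one_div,
      Complex.inv_cpow_ofReal_nonneg hNp.le, ← Complex.cpow_neg]
    congr 2
    push_cast [hN]
    rfl
  have hdiff : halfMellin d x - (2 * d + 1 : ℂ) ^ (-x) * Complex.Gamma x =
      ∫ s in Set.Ioi (0 : ℝ), ((Set.Ioc (0 : ℝ) 1).indicator f s - g s) := by
    rw [MeasureTheory.integral_sub _ hGint, hGval]
    · congr 1
      rw [halfMellin, intervalIntegral.integral_of_le zero_le_one,
        MeasureTheory.setIntegral_indicator measurableSet_Ioc,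
        Set.inter_eq_right.2 Set.Ioc_subset_Ioi_self]
    · exact (hfint.integrable_indicator measurableSet_Ioc).integrableOn
  have hbound : ∀ s ∈ Set.Ioi (0 : ℝ), ‖(Set.Ioc (0 : ℝ) 1).indicator f s - g s‖ ≤
      s ^ (x.re + 2 - 1) * Real.exp (-(N * s)) +
        d * (s ^ (x.re + 3 - 1) * Real.exp (-(N * s))) := by
    intro s hs
    have hs' : 0 < s := hs
    have e2 : s ^ (x.re + 2 - 1) = s ^ (x.re - 1) * s ^ 2 := by
      rw [← Real.rpow_natCast, ← Real.rpow_add hs']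
      congr 1
      push_cast
      ring
    have e3 : s ^ (x.re + 3 - 1) = s ^ (x.re - 1) * s ^ 3 := by
      rw [← Real.rpow_natCast, ← Real.rpow_add hs']
      congr 1
      push_cast
      ring
    have hn : ‖(s : ℂ) ^ (x - 1)‖ = s ^ (x.re - 1) := by
      rw [Complex.norm_cpow_eq_rpow_re_of_pos hs']
      simp
    have hp : 0 < s ^ (x.re - 1) := Real.rpow_pos_of_pos hs' _
    rw [e2, e3]
    by_cases h1 : s ≤ 1
    · rw [Set.indicator_of_mem (show s ∈ Set.Ioc (0 : ℝ) 1 from ⟨hs', h1⟩), hf, hg]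
      simp only
      rw [← mul_sub, norm_mul, hn]
      have : ehrhartSeries d (-s) - Complex.exp (-(N * s)) =
          (((1 - s) ^ d / (1 + s) ^ (d + 1) - Real.exp (-((2 * d + 1) * s)) : ℝ) : ℂ) := by
        unfold ehrhartSeries
        push_cast [hN]
        ring_nf
      rw [this, Complex.norm_real, Real.norm_eq_abs]
      calc _ ≤ s ^ (x.re - 1) * ((s ^ 2 + d * s ^ 3) * Real.exp (-((2 * d + 1) * s))) := by
            gcongr
            exact abs_ehrhartSeries_sub_exp_le d hs'.le h1
        _ = _ := by ring
    · rw [Set.indicator_of_notMem (fun h : s ∈ Set.Ioc (0 : ℝ) 1 => h1 h.2), hg, zero_sub, norm_neg]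
      simp only
      rw [norm_mul, hn, Complex.norm_exp]
      have : (-((N : ℂ) * s)).re = -(N * s) := by simp
      rw [this]
      have h1s : 1 ≤ s ^ 2 := one_le_pow₀ (not_le.1 h1).le
      have h4 : 0 ≤ (d : ℝ) * (s ^ (x.re - 1) * s ^ 3 * Real.exp (-(N * s))) := by positivity
      have h5 : s ^ (x.re - 1) * 1 * Real.exp (-(N * s)) ≤
        s ^ (x.re - 1) * s ^ 2 * Real.exp (-(N * s)) := by gcongr
      linarith
  have i2 := hpow (x.re + 2) (by linarith)
  have i3 := hpow (x.re + 3) (by linarith)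
  rw [hdiff]
  have hle := MeasureTheory.norm_integral_le_of_norm_le (i2.add (i3.const_mul (d : ℝ)))
    ((MeasureTheory.ae_restrict_iff' measurableSet_Ioi).2 (Filter.Eventually.of_forall hbound))
  refine hle.trans ?_
  have hsum : (∫ s in Set.Ioi (0 : ℝ), ((fun s : ℝ => s ^ (x.re + 2 - 1) * Real.exp (-(N * s))) +
      fun s : ℝ => d * (s ^ (x.re + 3 - 1) * Real.exp (-(N * s)))) s) =
      (1 / N) ^ (x.re + 2) * Real.Gamma (x.re + 2) +
        d * ((1 / N) ^ (x.re + 3) * Real.Gamma (x.re + 3)) := by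
    rw [← Real.integral_rpow_mul_exp_neg_mul_Ioi (by linarith) hNp,
      ← Real.integral_rpow_mul_exp_neg_mul_Ioi (by linarith) hNp,
      ← MeasureTheory.integral_const_mul, ← MeasureTheory.integral_add i2 (i3.const_mul _)]
    rfl
  rw [hsum]
  have r2 : (1 / N) ^ (x.re + 2) = N ^ (-x.re - 1) * N⁻¹ := by
    rw [one_div, Real.inv_rpow hNp.le, ← Real.rpow_neg hNp.le, ← Real.rpow_neg_one,
      ← Real.rpow_add hNp]
    congr 1
    ring
  have r3 : (1 / N) ^ (x.re + 3) = N ^ (-x.re - 1) * (N⁻¹ * N⁻¹) := by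
    rw [one_div, Real.inv_rpow hNp.le, ← Real.rpow_neg hNp.le, ← Real.rpow_neg_one,
      ← Real.rpow_add hNp, ← Real.rpow_add hNp]
    congr 1
    ring
  have g2 := Real.Gamma_pos_of_pos (by linarith : 0 < x.re + 2)
  have g3 := Real.Gamma_pos_of_pos (by linarith : 0 < x.re + 3)
  have hNi : N⁻¹ ≤ 1 := inv_le_one_of_one_le₀ hN0
  have hNi0 : 0 < N⁻¹ := inv_pos.2 hNp
  have hdN : (d : ℝ) * N⁻¹ ≤ 1 := by
    rw [mul_inv_le_iff₀ hNp]
    linarith [(Nat.cast_nonneg d : (0 : ℝ) ≤ d)]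
  have hd2 : (d : ℝ) * (N⁻¹ * N⁻¹) ≤ 1 := by
    rw [← mul_assoc]
    exact mul_le_one₀ hdN hNi0.le hNi
  have hPp : 0 < N ^ (-x.re - 1) := Real.rpow_pos_of_pos hNp _
  rw [r2, r3]
  calc _ = N ^ (-x.re - 1) * Real.Gamma (x.re + 2) * N⁻¹ +
        N ^ (-x.re - 1) * Real.Gamma (x.re + 3) * (d * (N⁻¹ * N⁻¹)) := by ring
    _ ≤ N ^ (-x.re - 1) * Real.Gamma (x.re + 2) * 1 +
        N ^ (-x.re - 1) * Real.Gamma (x.re + 3) * 1 := by gcongr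
    _ = _ := by ring

theorem ehrhartHalf_eq_Gamma_add {ε : ℝ} (hε : 0 < ε) :
    ∃ K : ℝ, ∀ (d : ℕ) (x : ℂ), x.re ∈ Set.Icc ε (1 - ε) →
      ∃ δ : ℂ, ‖δ‖ ≤ K * ‖(2 * d + 1 : ℂ) ^ (-x - 1)‖ ∧
        ehrhartHalf d x = Complex.sin (Real.pi * x) / Real.pi *
          ((2 * d + 1 : ℂ) ^ (-x) * Complex.Gamma x + δ) := by
  have hc : ContinuousOn (fun σ : ℝ => Real.Gamma (σ + 2) + Real.Gamma (σ + 3))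
      (Set.Icc ε (1 - ε)) := by
    intro σ hσ
    have hG : ∀ k : ℝ, 0 < k → ContinuousAt (fun σ : ℝ => Real.Gamma (σ + k)) σ := by
      intro k hk
      have h : DifferentiableAt ℝ Real.Gamma (σ + k) := by
        apply Real.differentiableAt_Gamma
        intro m hm
        have : (0 : ℝ) ≤ m := Nat.cast_nonneg m
        linarith [hσ.1]
      exact ContinuousAt.comp (f := fun σ : ℝ => σ + k) h.continuousAt (by fun_prop)
    exact ((hG 2 (by norm_num)).add (hG 3 (by norm_num))).continuousWithinAt
  obtain ⟨K, hK⟩ := isCompact_Icc.bddAbove_image hc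
  refine ⟨K, fun d x hx => ⟨halfMellin d x - (2 * d + 1 : ℂ) ^ (-x) * Complex.Gamma x, ?_, ?_⟩⟩
  · refine (norm_halfMellin_sub_Gamma_le (hε.trans_le hx.1) d).trans ?_
    have hn : ‖(2 * d + 1 : ℂ) ^ (-x - 1)‖ = (2 * d + 1 : ℝ) ^ (-x.re - 1) := by
      have := Complex.norm_cpow_eq_rpow_re_of_pos (x := 2 * d + 1) (by positivity) (-x - 1)
      push_cast at this
      simpa using this
    rw [hn]
    have : Real.Gamma (x.re + 2) + Real.Gamma (x.re + 3) ≤ K :=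
      hK (Set.mem_image_of_mem _ hx)
    gcongr
  · rw [ehrhartHalf]
    ring

/-! ### A primitive of the Mellin integrand. -/

/-- A primitive of `z^(x-1) f z`, obtained by integrating along the ray from the origin. -/
noncomputable def rayPrimitive (f : ℂ → ℂ) (x z : ℂ) : ℂ :=
  z ^ x * ∫ u in (0 : ℝ)..1, (u : ℂ) ^ (x - 1) * f (u * z)

/-- Integrating the u-derivative of u^x f(uz) over [0,1] gives f(z) = x ∫ u^(x-1) f(uz) du + z ∫ u^x
f'(uz) du, which is what the product rule for z^x ∫ u^(x-1) f(uz) du leaves behind. Having a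
primitive replaces contour deformation: different routes are compared through their end values only.
-/
theorem hasDerivAt_rayPrimitive {f : ℂ → ℂ} {Ω : Set ℂ} (hΩ : IsOpen Ω) (hstar : StarConvex ℝ 0 Ω)
    (hf : DifferentiableOn ℂ f Ω) {x z : ℂ} (hx : 0 < x.re) (hz : z ∈ Ω)
    (hz' : z ∈ Complex.slitPlane) :
    HasDerivAt (rayPrimitive f x) (z ^ (x - 1) * f z) z := by
  obtain ⟨r, hr, hball⟩ := Metric.nhds_basis_closedBall.mem_iff.1 (hΩ.mem_nhds hz)
  have hmem : ∀ u ∈ Set.Icc (0 : ℝ) 1, ∀ w ∈ Ω, (u : ℂ) * w ∈ Ω := by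
    intro u hu w hw
    have := hstar.smul_mem hw hu.1 hu.2
    rwa [Complex.real_smul] at this
  have hdf : ContinuousOn (deriv f) Ω := (hf.deriv hΩ).continuousOn
  have hK : IsCompact ((fun p : ℝ × ℂ => (p.1 : ℂ) * p.2) ''
      (Set.Icc (0 : ℝ) 1 ×ˢ Metric.closedBall z r)) :=
    (isCompact_Icc.prod (isCompact_closedBall z r)).image (by fun_prop)
  have hKsub : (fun p : ℝ × ℂ => (p.1 : ℂ) * p.2) ''
      (Set.Icc (0 : ℝ) 1 ×ˢ Metric.closedBall z r) ⊆ Ω := by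
    rintro _ ⟨⟨u, w⟩, ⟨hu, hw⟩, rfl⟩
    exact hmem u hu w (hball hw)
  obtain ⟨B, hB⟩ := hK.exists_bound_of_continuousOn (hdf.mono hKsub)
  have hcont : ∀ w ∈ Ω, ContinuousOn (fun u : ℝ => f (u * w)) (Set.Icc 0 1) := fun w hw =>
    hf.continuousOn.comp (by fun_prop) fun u hu => hmem u hu w hw
  have hpow : IntervalIntegrable (fun u : ℝ => (u : ℂ) ^ (x - 1)) MeasureTheory.volume 0 1 :=
    intervalIntegral.intervalIntegrable_cpow' (by simpa using hx)
  have hint : ∀ w ∈ Ω, IntervalIntegrable (fun u : ℝ => (u : ℂ) ^ (x - 1) * f (u * w))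
      MeasureTheory.volume 0 1 := fun w hw =>
    hpow.mul_continuousOn (by rw [Set.uIcc_of_le zero_le_one]; exact hcont w hw)
  have hcont' : ContinuousOn (fun u : ℝ => deriv f (u * z)) (Set.Icc 0 1) :=
    hdf.comp (by fun_prop) fun u hu => hmem u hu z hz
  have hint' : IntervalIntegrable (fun u : ℝ => (u : ℂ) ^ (x - 1) * (u * deriv f (u * z)))
      MeasureTheory.volume 0 1 := by
    refine hpow.mul_continuousOn ?_
    rw [Set.uIcc_of_le zero_le_one]
    exact (by fun_prop : Continuous fun u : ℝ => (u : ℂ)).continuousOn.mul hcont'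
  have hM : HasDerivAt (fun w => ∫ u in (0 : ℝ)..1, (u : ℂ) ^ (x - 1) * f (u * w))
      (∫ u in (0 : ℝ)..1, (u : ℂ) ^ (x - 1) * (u * deriv f (u * z))) z := by
    refine (intervalIntegral.hasDerivAt_integral_of_dominated_loc_of_deriv_le
      (F := fun (w : ℂ) (u : ℝ) => (u : ℂ) ^ (x - 1) * f (u * w))
      (F' := fun (w : ℂ) (u : ℝ) => (u : ℂ) ^ (x - 1) * (u * deriv f (u * w)))
      (bound := fun u => u ^ (x.re - 1) * B)
      (Metric.closedBall_mem_nhds z hr) ?_ (hint z hz) ?_ ?_ ?_ ?_).2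
    · filter_upwards [hΩ.mem_nhds hz] with w hw
      have := (hint w hw).1
      rw [Set.uIoc_of_le zero_le_one]
      exact this.aestronglyMeasurable
    · rw [Set.uIoc_of_le zero_le_one]
      exact hint'.1.aestronglyMeasurable
    · refine Filter.Eventually.of_forall fun u hu w hw => ?_
      rw [Set.uIoc_of_le zero_le_one] at hu
      rw [norm_mul, norm_mul, Complex.norm_cpow_eq_rpow_re_of_pos hu.1, Complex.norm_real,
        Real.norm_of_nonneg hu.1.le]
      have h1 := hB _ ⟨(u, w), ⟨⟨hu.1.le, hu.2⟩, hw⟩, rfl⟩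
      have h2 : u * ‖deriv f (u * w)‖ ≤ B :=
        (mul_le_of_le_one_left (norm_nonneg _) hu.2).trans h1
      have := Real.rpow_nonneg hu.1.le (x.re - 1)
      simp only [Complex.sub_re, Complex.one_re]
      gcongr
    · exact (intervalIntegral.intervalIntegrable_rpow' (by linarith)).mul_const B
    · refine Filter.Eventually.of_forall fun u hu w hw => ?_
      rw [Set.uIoc_of_le zero_le_one] at hu
      have h1 : HasDerivAt f (deriv f (u * w)) (u * w) :=
        (hf.differentiableAt (hΩ.mem_nhds (hmem u ⟨hu.1.le, hu.2⟩ w (hball hw)))).hasDerivAt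
      have h2 : HasDerivAt (fun w : ℂ => (u : ℂ) * w) u w := by
        simpa using (hasDerivAt_id w).const_mul (u : ℂ)
      have := (h1.comp w h2).const_mul ((u : ℂ) ^ (x - 1))
      rwa [mul_comm (deriv f _)] at this
  have hparts : (∫ u in (0 : ℝ)..1, (x * ((u : ℂ) ^ (x - 1) * f (u * z)) +
      z * ((u : ℂ) ^ (x - 1) * (u * deriv f (u * z))))) = f z := by
    have hx0 : x ≠ 0 := by rintro rfl; simp at hx
    have := intervalIntegral.integral_eq_sub_of_hasDerivAt_of_le zero_le_one
      (f := fun u : ℝ => (u : ℂ) ^ x * f (u * z))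
      (f' := fun u : ℝ => x * ((u : ℂ) ^ (x - 1) * f (u * z)) +
        z * ((u : ℂ) ^ (x - 1) * (u * deriv f (u * z))))
      ((Complex.continuous_ofReal_cpow_const hx).continuousOn.mul (hcont z hz)) ?_
      (((hint z hz).const_mul x).add (hint'.const_mul z))
    · rw [this]
      simp [hx0]
    · intro u hu
      have huc : (u : ℂ) ≠ 0 := by exact_mod_cast hu.1.ne'
      have h1 : HasDerivAt f (deriv f (u * z)) (u * z) :=
        (hf.differentiableAt (hΩ.mem_nhds (hmem u ⟨hu.1.le, hu.2.le⟩ z hz))).hasDerivAt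
      have h2 : HasDerivAt (fun u : ℝ => (u : ℂ) * z) z u := by
        simpa using (Complex.ofRealCLM.hasDerivAt (x := u)).mul_const z
      have h3 : HasDerivAt (fun u : ℝ => (u : ℂ) ^ x) (x * (u : ℂ) ^ (x - 1)) u :=
        hasDerivAt_ofReal_cpow_const hu.1.ne' hx0
      have h4 := h3.mul (h1.comp_of_eq u h2 rfl)
      refine h4.congr_deriv ?_
      have e : (u : ℂ) ^ x = (u : ℂ) ^ (x - 1) * u := by
        rw [Complex.cpow_sub _ _ huc, Complex.cpow_one, div_mul_cancel₀ _ huc]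
      simp only [Function.comp_apply]
      rw [e]
      ring
  rw [intervalIntegral.integral_add ((hint z hz).const_mul x) (hint'.const_mul z),
    intervalIntegral.integral_const_mul, intervalIntegral.integral_const_mul] at hparts
  have hz0 : z ≠ 0 := Complex.slitPlane_ne_zero hz'
  have hpz : HasDerivAt (fun w : ℂ => w ^ x) (x * z ^ (x - 1)) z := by
    simpa using (hasDerivAt_id z).cpow_const (c := x) hz'
  refine (hpz.mul hM).congr_deriv ?_
  have e : z ^ x = z ^ (x - 1) * z := by
    rw [Complex.cpow_sub _ _ hz0, Complex.cpow_one, div_mul_cancel₀ _ hz0]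
  rw [e, ← hparts]
  ring

/-! ### The steepest-descent curve of the cubic model. -/

/-- The square root `√((T + 1) / (3T + 1))` in the definition of `pathCurve`. -/
noncomputable def pathRatio (T : ℝ) : ℝ := Real.sqrt ((T + 1) / (3 * T + 1))

/-- The real part of `pathCurve`. -/
noncomputable def pathAbscissa (T : ℝ) : ℝ := T * pathRatio T

theorem pathCurve_eq (T : ℝ) : pathCurve T = pathAbscissa T + T * Complex.I := by
  simp only [pathCurve, pathAbscissa, pathRatio]
  push_cast
  ring

section
variable {T : ℝ}

theorem pathRatio_pos (hT : -1 / 3 < T) : 0 < pathRatio T :=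
  Real.sqrt_pos.2 (div_pos (by linarith) (by linarith))

theorem pathRatio_sq (hT : -1 / 3 < T) : pathRatio T ^ 2 * (3 * T + 1) = T + 1 := by
  have h : 0 < 3 * T + 1 := by linarith
  rw [pathRatio, Real.sq_sqrt (div_pos (by linarith) h).le, div_mul_cancel₀ _ h.ne']

theorem pathRatio_mul_le (hT : -1 / 3 < T) : pathRatio T * (3 * T + 1) ≤ 2 * T + 1 := by
  have h : 0 < 3 * T + 1 := by linarith
  apply le_of_sq_le_sq _ (by linarith)
  have := pathRatio_sq hT
  nlinarith [sq_nonneg T]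

theorem pathRatio_le_one (hT : 0 ≤ T) : pathRatio T ≤ 1 := by
  have h := pathRatio_sq (T := T) (by linarith)
  have h0 := pathRatio_pos (T := T) (by linarith)
  by_contra hlt
  push Not at hlt
  have : 1 < pathRatio T ^ 2 := by nlinarith
  nlinarith

theorem one_le_pathRatio (hT : -1 / 3 < T) (hT0 : T ≤ 0) : 1 ≤ pathRatio T := by
  have h := pathRatio_sq hT
  have h0 := pathRatio_pos hT
  by_contra hlt
  push Not at hlt
  have : pathRatio T ^ 2 < 1 := by nlinarith
  nlinarith

theorem one_le_three_mul_pathRatio_sq (hT : -1 / 3 < T) : 1 ≤ 3 * pathRatio T ^ 2 := by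
  have h := pathRatio_sq hT
  have h1 : 0 < 3 * T + 1 := by linarith
  by_contra hlt
  push Not at hlt
  nlinarith

theorem hasDerivAt_pathAbscissa (hT : -1 / 3 < T) :
    HasDerivAt pathAbscissa ((3 * T ^ 2 + 3 * T + 1) / (pathRatio T * (3 * T + 1) ^ 2)) T := by
  have h : 0 < 3 * T + 1 := by linarith
  have hr := pathRatio_pos hT
  have h1 : HasDerivAt (fun T : ℝ => (T + 1) / (3 * T + 1)) (-2 / (3 * T + 1) ^ 2) T := by
    have ha : HasDerivAt (fun T : ℝ => T + 1) 1 T := (hasDerivAt_id T).add_const 1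
    have hb : HasDerivAt (fun T : ℝ => 3 * T + 1) 3 T := by
      simpa using ((hasDerivAt_id T).const_mul 3).add_const 1
    refine (ha.div hb h.ne').congr_deriv ?_
    congr 1
    ring
  have h2 := (hasDerivAt_id T).mul (h1.sqrt (div_pos (by linarith) h).ne')
  refine h2.congr_deriv ?_
  have hs := pathRatio_sq hT
  have hne := h.ne'
  have hrne := hr.ne'
  change 1 * pathRatio T + T * (-2 / (3 * T + 1) ^ 2 / (2 * pathRatio T)) = _
  generalize hD : 3 * T + 1 = D at *
  field_simp
  linear_combination D * hs - (T + 1) * hD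

/-- Together with Im U' = 1 this gives |U'| ≤ 3 X', so integrals against |U'| dT can be estimated as
integrals in the abscissa X, which runs to -∞ as T tends to -1/3. -/
theorem half_le_deriv_pathAbscissa (hT : -1 / 3 < T) :
    1 / 2 ≤ (3 * T ^ 2 + 3 * T + 1) / (pathRatio T * (3 * T + 1) ^ 2) := by
  have h : 0 < 3 * T + 1 := by linarith
  have hr := pathRatio_pos hT
  have h2 := mul_le_mul_of_nonneg_right (pathRatio_mul_le hT) h.le
  rw [le_div_iff₀ (by positivity)]
  nlinarith

theorem hasDerivAt_pathCurve (hT : -1 / 3 < T) :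
    HasDerivAt pathCurve
      (((3 * T ^ 2 + 3 * T + 1) / (pathRatio T * (3 * T + 1) ^ 2) : ℝ) + Complex.I) T := by
  have h := (hasDerivAt_pathAbscissa hT).ofReal_comp.add
    ((Complex.ofRealCLM.hasDerivAt (x := T)).mul_const Complex.I)
  refine (h.congr_deriv (by simp)).congr_of_eventuallyEq ?_
  filter_upwards with t
  rw [pathCurve_eq]
  rfl

theorem pathExponent_eq (hT : -1 / 3 < T) :
    pathExponent T = 2 * T ^ 2 * (2 * T + 1) ^ 2 * pathRatio T / (3 * T + 1) := by
  have h : 0 < 3 * T + 1 := by linarith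
  have h1 : (3 * T + 1) ^ (3 / 2 : ℝ) = (3 * T + 1) * Real.sqrt (3 * T + 1) := by
    rw [Real.sqrt_eq_rpow, show (3 / 2 : ℝ) = 1 + 1 / 2 by norm_num, Real.rpow_add h,
      Real.rpow_one]
  have hs : 0 < Real.sqrt (3 * T + 1) := Real.sqrt_pos.2 h
  rw [pathExponent, h1, pathRatio, Real.sqrt_div (by linarith)]
  field_simp

/-- For U = X + iT the imaginary part of iU² + U³ is X²(3T+1) - T²(T+1), and `pathRatio` is the
value of X/T that makes it vanish. The curve is thus the level line of the phase through the saddle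
U = 0, and the remaining real part is -F. -/
theorem pathCurve_cubic (hT : -1 / 3 < T) :
    Complex.I * pathCurve T ^ 2 + pathCurve T ^ 3 = -(pathExponent T : ℂ) := by
  have h : 0 < 3 * T + 1 := by linarith
  have hc : (3 * T + 1 : ℂ) ≠ 0 := by exact_mod_cast h.ne'
  have hs : (pathRatio T : ℂ) ^ 2 * (3 * T + 1) = T + 1 := by exact_mod_cast pathRatio_sq hT
  have hI : Complex.I ^ 2 = -1 := Complex.I_sq
  have hI3 : Complex.I ^ 3 = -Complex.I := by rw [pow_succ, hI]; ring
  rw [pathExponent_eq hT, pathCurve_eq, pathAbscissa]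
  push_cast
  rw [eq_neg_iff_add_eq_zero]
  generalize (pathRatio T : ℂ) = r at *
  generalize hD : (3 * T + 1 : ℂ) = D at *
  field_simp
  have hD' : D = 3 * T + 1 := hD.symm
  have hs' : r ^ 2 * (3 * T + 1) - (T + 1) = 0 := by rw [hD]; linear_combination hs
  subst hD'
  ring_nf
  simp only [hI, hI3]
  linear_combination (T : ℂ) ^ 2 * ((T : ℂ) * r + Complex.I * (1 + 3 * T)) * hs'

/-- F equals X² times 2(2T+1)²/(r(3T+1)), with r = `pathRatio T`. That factor is at least 2(2T+1),
which suffices for T ≥ 0; for T < 0, where r may blow up, it is also at least 2r/9, while |X| ≤ r/3.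
The quadratic part serves separated saddles and the cubic part merging ones. -/
theorem sq_mul_le_pathExponent (hT : -1 / 3 < T) :
    pathAbscissa T ^ 2 * (1 + |pathAbscissa T|) ≤ 3 * pathExponent T := by
  have h : 0 < 3 * T + 1 := by linarith
  have hr := pathRatio_pos hT
  have hs := pathRatio_sq hT
  have hle := pathRatio_mul_le hT
  have hF : pathExponent T =
      pathAbscissa T ^ 2 * (2 * (2 * T + 1) ^ 2 / (pathRatio T * (3 * T + 1))) := by
    rw [pathExponent_eq hT, pathAbscissa]
    field_simp
  have hq : 2 * (2 * T + 1) ≤ 2 * (2 * T + 1) ^ 2 / (pathRatio T * (3 * T + 1)) := by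
    rw [le_div_iff₀ (by positivity)]
    nlinarith
  have key : 1 + |pathAbscissa T| ≤
      3 * (2 * (2 * T + 1) ^ 2 / (pathRatio T * (3 * T + 1))) := by
    rcases le_total 0 T with h0 | h0
    · have : |pathAbscissa T| ≤ T := by
        rw [pathAbscissa, abs_of_nonneg (by positivity)]
        exact mul_le_of_le_one_right h0 (pathRatio_le_one h0)
      linarith
    · have : |pathAbscissa T| ≤ pathRatio T / 3 := by
        rw [pathAbscissa, abs_mul, abs_of_nonpos h0, abs_of_pos hr]
        nlinarith
      have hq2 : 2 / 9 * pathRatio T ≤ 2 * (2 * T + 1) ^ 2 / (pathRatio T * (3 * T + 1)) := by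
        rw [le_div_iff₀ (by positivity)]
        nlinarith
      have h1 := one_le_pathRatio hT h0
      linarith
  rw [hF]
  nlinarith [mul_le_mul_of_nonneg_left key (sq_nonneg (pathAbscissa T))]

theorem pathExponent_nonneg (hT : -1 / 3 < T) : 0 ≤ pathExponent T := by
  have h : 0 < 3 * T + 1 := by linarith
  have hr := pathRatio_pos hT
  rw [pathExponent_eq hT]
  positivity

theorem pathExponent_le (hT : 0 ≤ T) : pathExponent T ≤ 8 * (T ^ 2 * (1 + T)) := by
  have hT' : -1 / 3 < T := by linarith
  have h : 0 < 3 * T + 1 := by linarith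
  have h1 := pathRatio_le_one hT
  have h0 := pathRatio_pos hT'
  rw [pathExponent_eq hT', div_le_iff₀ h]
  have h2 : (2 * T + 1) ^ 2 * pathRatio T ≤ (2 * T + 1) ^ 2 :=
    mul_le_of_le_one_right (by positivity) h1
  have h3 : (2 * T + 1) ^ 2 ≤ 4 * ((1 + T) * (3 * T + 1)) := by nlinarith
  have := mul_le_mul_of_nonneg_left (h2.trans h3) (by positivity : 0 ≤ 2 * T ^ 2)
  linarith

/-- As 3r² ≥ 1, T² ≤ 3X² on the curve, so |X| measures the distance to the saddle. -/
theorem norm_pathCurve_le (hT : -1 / 3 < T) : ‖pathCurve T‖ ≤ 2 * |pathAbscissa T| := by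
  have h3 := one_le_three_mul_pathRatio_sq hT
  apply le_of_sq_le_sq _ (by positivity)
  rw [pathCurve_eq, ← Complex.normSq_eq_norm_sq, Complex.normSq_add_mul_I, mul_pow, sq_abs,
    pathAbscissa, mul_pow]
  nlinarith [sq_nonneg T]

theorem norm_deriv_pathCurve_le (hT : -1 / 3 < T) :
    ‖deriv pathCurve T‖ ≤ 3 * ((3 * T ^ 2 + 3 * T + 1) / (pathRatio T * (3 * T + 1) ^ 2)) := by
  rw [(hasDerivAt_pathCurve hT).deriv]
  have h := half_le_deriv_pathAbscissa hT
  refine (norm_add_le _ _).trans ?_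
  rw [Complex.norm_real, Complex.norm_I, Real.norm_of_nonneg (by linarith)]
  linarith

theorem deriv_pathCurve_im (hT : -1 / 3 < T) : (deriv pathCurve T).im = 1 := by
  rw [(hasDerivAt_pathCurve hT).deriv, Complex.add_im, Complex.ofReal_im, Complex.I_im, zero_add]

end

theorem strictMonoOn_pathAbscissa : StrictMonoOn pathAbscissa (Set.Ioi (-1 / 3)) := by
  refine strictMonoOn_of_deriv_pos (convex_Ioi _)
    (fun T hT => (hasDerivAt_pathAbscissa hT).continuousAt.continuousWithinAt) fun T hT => ?_
  rw [interior_Ioi] at hT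
  rw [(hasDerivAt_pathAbscissa hT).deriv]
  linarith [half_le_deriv_pathAbscissa hT]

theorem exists_pathAbscissa_eq_neg {q : ℝ} (hq : 0 < q) :
    ∃ T ∈ Set.Ioo (-1 / 3 : ℝ) 0, pathAbscissa T = -q := by
  -- T₀ is the solution of (T+1)/(3T+1) = r², so `pathRatio T₀ = r`; this r is large enough for T₀ r
  -- ≤ -q, and the intermediate value theorem does the rest.
  set r : ℝ := 4 * q + 2 with hr
  have hr2 : 2 ≤ r := by linarith
  set T₀ : ℝ := (1 - r ^ 2) / (3 * r ^ 2 - 1) with hT₀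
  have hden : 0 < 3 * r ^ 2 - 1 := by nlinarith
  have h3 : -1 / 3 < T₀ := by
    rw [hT₀, div_lt_div_iff₀ (by norm_num) hden]
    linarith
  have hT0 : T₀ < 0 := div_neg_of_neg_of_pos (by nlinarith) hden
  have hratio : pathRatio T₀ = r := by
    have e : (T₀ + 1) / (3 * T₀ + 1) = r ^ 2 := by
      have e1 : T₀ + 1 = 2 * r ^ 2 / (3 * r ^ 2 - 1) := by
        rw [hT₀, eq_div_iff hden.ne']
        have := div_mul_cancel₀ (1 - r ^ 2) hden.ne'
        linear_combination 1 * this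
      have e2 : 3 * T₀ + 1 = 2 / (3 * r ^ 2 - 1) := by
        rw [hT₀, eq_div_iff hden.ne']
        have := div_mul_cancel₀ (1 - r ^ 2) hden.ne'
        linear_combination 3 * this
      rw [e1, e2, div_div_div_cancel_right₀ hden.ne']
      ring
    rw [pathRatio, e, Real.sqrt_sq (by linarith)]
  have hX : pathAbscissa T₀ ≤ -q := by
    rw [pathAbscissa, hratio, hT₀, div_mul_eq_mul_div, div_le_iff₀ hden]
    nlinarith [mul_nonneg hq.le hq.le, mul_nonneg (mul_nonneg hq.le hq.le) hq.le]
  have hX0 : pathAbscissa 0 = 0 := by simp [pathAbscissa]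
  obtain ⟨T, hT, hTq⟩ := intermediate_value_Icc hT0.le
    (fun T hT => (hasDerivAt_pathAbscissa (h3.trans_le hT.1)).continuousAt.continuousWithinAt)
    (⟨hX, by rw [hX0]; linarith⟩ : -q ∈ Set.Icc (pathAbscissa T₀) (pathAbscissa 0))
  refine ⟨T, ⟨h3.trans_le hT.1, lt_of_le_of_ne hT.2 ?_⟩, hTq⟩
  rintro rfl
  rw [hX0] at hTq
  linarith

/-! ### Third-order expansion of the phase at the saddle. -/

/-- Twice the quadratic coefficient of the phase at the saddle point, rescaled. -/
noncomputable def quadCoeff (a : ℝ) : ℝ := (1 - a ^ 2) / (1 + a ^ 2)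

/-- Three times the cubic coefficient of the phase at the saddle point, rescaled. -/
noncomputable def cubicCoeff (a : ℝ) : ℝ := (1 + 3 * a ^ 2 - 2 * a ^ 4) / (1 + a ^ 2) ^ 2

theorem quadCoeff_pos {a : ℝ} (h0 : 0 < a) (h1 : a < 1) : 0 < quadCoeff a :=
  div_pos (by nlinarith) (by positivity)

theorem quadCoeff_le_one (a : ℝ) : quadCoeff a ≤ 1 := by
  rw [quadCoeff, div_le_one (by positivity)]
  nlinarith [sq_nonneg a]

/-- Only the quadratic coefficient degenerates as a tends to 1. The cubic one stays away from 0, so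
no more than two saddle points merge and a cubic model is enough. -/
theorem half_le_cubicCoeff {a : ℝ} (h0 : 0 < a) (h1 : a < 1) : 1 / 2 ≤ cubicCoeff a := by
  have h2 : a ^ 2 < 1 := by nlinarith
  rw [cubicCoeff, div_le_div_iff₀ (by norm_num) (by positivity)]
  nlinarith [mul_nonneg (sub_nonneg.2 h2.le) (sq_nonneg a)]

theorem cubicCoeff_le_two (a : ℝ) : cubicCoeff a ≤ 2 := by
  rw [cubicCoeff, div_le_iff₀ (by positivity)]
  nlinarith [sq_nonneg a, sq_nonneg (a ^ 2)]

theorem norm_log_one_add_sub_cubic_le {z : ℂ} (hz : ‖z‖ ≤ 1 / 2) :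
    ‖Complex.log (1 + z) - (z - z ^ 2 / 2 + z ^ 3 / 3)‖ ≤ ‖z‖ ^ 4 / 2 := by
  have h := Complex.norm_log_sub_logTaylor_le 3 (z := z) (by linarith)
  have ht : Complex.logTaylor (3 + 1) z = z - z ^ 2 / 2 + z ^ 3 / 3 := by
    simp [Complex.logTaylor, Finset.sum_range_succ]
    ring
  rw [ht] at h
  refine h.trans ?_
  have h2 : (1 - ‖z‖)⁻¹ ≤ 2 := by
    rw [inv_le_comm₀ (by linarith) (by norm_num)]
    linarith
  have h4 : 0 ≤ ‖z‖ ^ 4 := by positivity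
  norm_num
  nlinarith [mul_le_mul_of_nonneg_left h2 h4]

theorem one_add_ne_zero_of_norm_le_half {z : ℂ} (hz : ‖z‖ ≤ 1 / 2) : 1 + z ≠ 0 := by
  intro h
  have : z = -1 := by linear_combination h
  rw [this] at hz
  norm_num at hz

/-- At t = -ia(1+iy) one has 1+t = (1-ia)(1+P) and 1-t = (1+ia)(1+Q) with P and Q linear in y, so W
is a combination of three logarithms. The relation `hd` is the saddle equation and cancels the
linear terms. The error τ|y|⁴ collects the quartic remainders; the error |y| comes from z^(Re x - 1)
and the extra factor 1/(1-t), which are not part of the phase. -/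
theorem exists_local_exponent {a τ : ℝ} {d : ℕ} {x y : ℂ} (h0 : 0 < a) (h1 : a < 1) (hτ : 0 < τ)
    (hd : d * (2 * a) = τ * (1 + a ^ 2)) (hxi : x.im = τ) (hx0 : 0 ≤ x.re) (hx1 : x.re ≤ 1)
    (hy : ‖y‖ ≤ 1 / 2) :
    ∃ W : ℂ, (1 + Complex.I * y) ^ (x - 1) * ehrhartSeries d (-Complex.I * a * (1 + Complex.I * y)) =
        ehrhartSeries d (-Complex.I * a) * Complex.exp W ∧
      ‖W - τ * (Complex.I * (quadCoeff a / 2) * y ^ 2 + cubicCoeff a / 3 * y ^ 3)‖ ≤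
        2 * τ * ‖y‖ ^ 4 + 4 * ‖y‖ := by
  have hI : Complex.I ^ 2 = -1 := Complex.I_sq
  have hS : (1 + a ^ 2 : ℂ) ≠ 0 := by
    have : (1 + a ^ 2 : ℝ) ≠ 0 := by positivity
    exact_mod_cast this
  have hac : (a : ℂ) ≠ 0 := by exact_mod_cast h0.ne'
  set p : ℂ := (1 + Complex.I * a) / (1 + a ^ 2) with hp
  set q : ℂ := (1 - Complex.I * a) / (1 + a ^ 2) with hq
  have hp1 : p * (1 - Complex.I * a) = 1 := by
    rw [hp, div_mul_eq_mul_div, div_eq_one_iff_eq hS]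
    linear_combination (-(a : ℂ) ^ 2) * hI
  have hq1 : q * (1 + Complex.I * a) = 1 := by
    rw [hq, div_mul_eq_mul_div, div_eq_one_iff_eq hS]
    linear_combination (-(a : ℂ) ^ 2) * hI
  have hnum : ‖(1 + Complex.I * a : ℂ)‖ ≤ 1 + a ^ 2 ∧ ‖(1 - Complex.I * a : ℂ)‖ ≤ 1 + a ^ 2 := by
    constructor <;>
    · apply le_of_sq_le_sq _ (by positivity)
      rw [← Complex.normSq_eq_norm_sq, Complex.normSq_apply]
      simp
      nlinarith [sq_nonneg a, sq_nonneg (a ^ 2)]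
  have hSn : ‖(1 + a ^ 2 : ℂ)‖ = 1 + a ^ 2 := by
    have : (1 + a ^ 2 : ℂ) = ((1 + a ^ 2 : ℝ) : ℂ) := by push_cast; rfl
    rw [this, Complex.norm_real, Real.norm_of_nonneg (by positivity)]
  have hpn : ‖p‖ ≤ 1 := by
    rw [hp, norm_div, hSn, div_le_one (by positivity)]; exact hnum.1
  have hqn : ‖q‖ ≤ 1 := by
    rw [hq, norm_div, hSn, div_le_one (by positivity)]; exact hnum.2
  set P : ℂ := a * p * y with hP
  set Q : ℂ := -(a * q * y) with hQ
  have han : ‖(a : ℂ)‖ = a := by rw [Complex.norm_real, Real.norm_of_nonneg h0.le]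
  have hPn : ‖P‖ ≤ a * ‖y‖ := by
    rw [hP, norm_mul, norm_mul, han]
    gcongr
    exact mul_le_of_le_one_right h0.le hpn
  have hQn : ‖Q‖ ≤ a * ‖y‖ := by
    rw [hQ, norm_neg, norm_mul, norm_mul, han]
    gcongr
    exact mul_le_of_le_one_right h0.le hqn
  have hay : a * ‖y‖ ≤ ‖y‖ := mul_le_of_le_one_left (norm_nonneg _) h1.le
  have hP2 : ‖P‖ ≤ 1 / 2 := by linarith
  have hQ2 : ‖Q‖ ≤ 1 / 2 := by linarith
  have hIy : ‖Complex.I * y‖ = ‖y‖ := by rw [norm_mul, Complex.norm_I, one_mul]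
  have hIy2 : ‖Complex.I * y‖ ≤ 1 / 2 := by rw [hIy]; exact hy
  have nP := one_add_ne_zero_of_norm_le_half hP2
  have nQ := one_add_ne_zero_of_norm_le_half hQ2
  have nz := one_add_ne_zero_of_norm_le_half hIy2
  have f1 : 1 + -Complex.I * a * (1 + Complex.I * y) = (1 - Complex.I * a) * (1 + P) := by
    rw [hP]
    linear_combination (-(a : ℂ) * y) * hI - a * y * hp1
  have f2 : 1 - -Complex.I * a * (1 + Complex.I * y) = (1 + Complex.I * a) * (1 + Q) := by
    rw [hQ]
    linear_combination ((a : ℂ) * y) * hI + a * y * hq1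
  refine ⟨Complex.log (1 + Complex.I * y) * (x - 1) +
    (d * (Complex.log (1 + P) - Complex.log (1 + Q)) - Complex.log (1 + Q)), ?_, ?_⟩
  · rw [Complex.exp_add, Complex.exp_sub, Complex.exp_log nQ, Complex.exp_nat_mul, Complex.exp_sub,
      Complex.exp_log nP, Complex.exp_log nQ, Complex.cpow_def_of_ne_zero nz]
    simp only [ehrhartSeries, f1, f2]
    have e1 : 1 + -Complex.I * a = 1 - Complex.I * a := by ring
    have e2 : 1 - -Complex.I * a = 1 + Complex.I * a := by ring
    rw [e1, e2, mul_pow, mul_pow, div_pow, pow_succ (1 + Q), pow_succ (1 + Complex.I * a)]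
    have hb : (1 + Complex.I * a : ℂ) ≠ 0 := right_ne_zero_of_mul (hq1 ▸ one_ne_zero)
    field_simp
  · have hdc : (d : ℂ) = τ * (1 + a ^ 2) / (2 * a) := by
      rw [eq_div_iff (by simpa using hac)]
      exact_mod_cast hd
    have hpoly : Complex.I * τ * (Complex.I * y - (Complex.I * y) ^ 2 / 2 + (Complex.I * y) ^ 3 / 3) +
        d * ((P - P ^ 2 / 2 + P ^ 3 / 3) - (Q - Q ^ 2 / 2 + Q ^ 3 / 3)) =
        τ * (Complex.I * (quadCoeff a / 2) * y ^ 2 + cubicCoeff a / 3 * y ^ 3) := by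
      rw [hdc, hP, hQ, hp, hq, quadCoeff, cubicCoeff]
      push_cast
      have hI3 : Complex.I ^ 3 = -Complex.I := by rw [pow_succ, hI]; ring
      have hI4 : Complex.I ^ 4 = 1 := Complex.I_pow_four
      generalize hs : (1 + a ^ 2 : ℂ) = s at *
      field_simp
      ring_nf
      simp only [hI, hI3, hI4]
      ring_nf
      have hs' : s = 1 + (a : ℂ) ^ 2 := hs.symm
      rw [hs']
      ring
    have hx : x = x.re + Complex.I * τ := by
      rw [← hxi, mul_comm]; exact (Complex.re_add_im x).symm
    have hdecomp : Complex.log (1 + Complex.I * y) * (x - 1) +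
        (d * (Complex.log (1 + P) - Complex.log (1 + Q)) - Complex.log (1 + Q)) -
        τ * (Complex.I * (quadCoeff a / 2) * y ^ 2 + cubicCoeff a / 3 * y ^ 3) =
        Complex.I * τ * (Complex.log (1 + Complex.I * y) -
          (Complex.I * y - (Complex.I * y) ^ 2 / 2 + (Complex.I * y) ^ 3 / 3)) +
        d * (Complex.log (1 + P) - (P - P ^ 2 / 2 + P ^ 3 / 3)) -
        d * (Complex.log (1 + Q) - (Q - Q ^ 2 / 2 + Q ^ 3 / 3)) +
        (((x.re - 1 : ℝ) : ℂ) * Complex.log (1 + Complex.I * y) - Complex.log (1 + Q)) := by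
      rw [← hpoly]
      conv_lhs => rw [hx]
      push_cast
      ring
    rw [hdecomp]
    have b1 := norm_log_one_add_sub_cubic_le hIy2
    have b2 := norm_log_one_add_sub_cubic_le hP2
    have b3 := norm_log_one_add_sub_cubic_le hQ2
    have c1 := Complex.norm_log_one_add_half_le_self hIy2
    have c2 := Complex.norm_log_one_add_half_le_self hQ2
    rw [hIy] at b1 c1
    -- The saddle equation gives d a⁴ = τ a³ (1+a²)/2 ≤ τ, so the remainders multiplied by d are
    -- bounded in terms of τ alone.
    have hda : (d : ℝ) * (a * ‖y‖) ^ 4 ≤ τ * ‖y‖ ^ 4 := by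
      have e : (d : ℝ) * (a * ‖y‖) ^ 4 = (τ * ((1 + a ^ 2) / 2 * a ^ 3)) * ‖y‖ ^ 4 := by
        linear_combination (a ^ 3 * ‖y‖ ^ 4 / 2) * hd
      rw [e]
      have ha2 : a ^ 2 ≤ 1 := by nlinarith
      have ha3 : a ^ 3 ≤ 1 := pow_le_one₀ h0.le h1.le
      have : (1 + a ^ 2) / 2 * a ^ 3 ≤ 1 := mul_le_one₀ (by linarith) (by positivity) ha3
      gcongr
      exact mul_le_of_le_one_right hτ.le this
    have hd0 : (0 : ℝ) ≤ d := Nat.cast_nonneg d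
    have hdP : (d : ℝ) * (‖P‖ ^ 4 / 2) ≤ τ * ‖y‖ ^ 4 / 2 := by
      have : ‖P‖ ^ 4 ≤ (a * ‖y‖) ^ 4 := by gcongr
      nlinarith
    have hdQ : (d : ℝ) * (‖Q‖ ^ 4 / 2) ≤ τ * ‖y‖ ^ 4 / 2 := by
      have : ‖Q‖ ^ 4 ≤ (a * ‖y‖) ^ 4 := by gcongr
      nlinarith
    have g1 : ‖Complex.I * τ * (Complex.log (1 + Complex.I * y) -
          (Complex.I * y - (Complex.I * y) ^ 2 / 2 + (Complex.I * y) ^ 3 / 3))‖ ≤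
        τ * (‖y‖ ^ 4 / 2) := by
      rw [norm_mul, norm_mul, Complex.norm_I, one_mul, Complex.norm_real, Real.norm_of_nonneg hτ.le]
      gcongr
    have g2 : ‖d * (Complex.log (1 + P) - (P - P ^ 2 / 2 + P ^ 3 / 3))‖ ≤ d * (‖P‖ ^ 4 / 2) := by
      rw [norm_mul, Complex.norm_natCast]
      gcongr
    have g3 : ‖d * (Complex.log (1 + Q) - (Q - Q ^ 2 / 2 + Q ^ 3 / 3))‖ ≤ d * (‖Q‖ ^ 4 / 2) := by
      rw [norm_mul, Complex.norm_natCast]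
      gcongr
    have g4 : ‖((x.re - 1 : ℝ) : ℂ) * Complex.log (1 + Complex.I * y)‖ ≤ 3 / 2 * ‖y‖ := by
      rw [norm_mul, Complex.norm_real]
      have : ‖x.re - 1‖ ≤ 1 := by
        rw [Real.norm_eq_abs, abs_le]; constructor <;> linarith
      calc _ ≤ 1 * (3 / 2 * ‖y‖) := by gcongr
        _ = _ := one_mul _
    refine (norm_add_le _ _).trans ?_
    have t1 := norm_sub_le (Complex.I * τ * (Complex.log (1 + Complex.I * y) -
          (Complex.I * y - (Complex.I * y) ^ 2 / 2 + (Complex.I * y) ^ 3 / 3)) +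
        d * (Complex.log (1 + P) - (P - P ^ 2 / 2 + P ^ 3 / 3)))
        (d * (Complex.log (1 + Q) - (Q - Q ^ 2 / 2 + Q ^ 3 / 3)))
    have t2 := norm_add_le (Complex.I * τ * (Complex.log (1 + Complex.I * y) -
          (Complex.I * y - (Complex.I * y) ^ 2 / 2 + (Complex.I * y) ^ 3 / 3)))
        (d * (Complex.log (1 + P) - (P - P ^ 2 / 2 + P ^ 3 / 3)))
    have t3 := norm_sub_le (((x.re - 1 : ℝ) : ℂ) * Complex.log (1 + Complex.I * y))
      (Complex.log (1 + Q))
    have : 0 ≤ τ * ‖y‖ ^ 4 := by positivity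
    have hy0 := norm_nonneg y
    linarith

/-! ### Routes from the ends of the local path to t = 0 and t = -1. -/

/-- The modulus of `(1 + t) / (1 - t)`. -/
noncomputable def mobiusNorm (t : ℂ) : ℝ := ‖1 + t‖ / ‖1 - t‖

theorem mobiusNorm_nonneg (t : ℂ) : 0 ≤ mobiusNorm t := by
  unfold mobiusNorm
  positivity

theorem norm_ehrhartSeries (d : ℕ) (t : ℂ) :
    ‖ehrhartSeries d t‖ = mobiusNorm t ^ d / ‖1 - t‖ := by
  rw [ehrhartSeries, mobiusNorm, norm_div, norm_pow, norm_pow, pow_succ, div_pow, div_div]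

theorem sq_norm_one_add (t : ℂ) : ‖1 + t‖ ^ 2 = 1 + ‖t‖ ^ 2 + 2 * t.re := by
  rw [← Complex.normSq_eq_norm_sq, ← Complex.normSq_eq_norm_sq, Complex.normSq_apply,
    Complex.normSq_apply]
  simp
  ring

theorem sq_norm_one_sub (t : ℂ) : ‖1 - t‖ ^ 2 = 1 + ‖t‖ ^ 2 - 2 * t.re := by
  have := sq_norm_one_add (-t)
  rw [norm_neg, ← sub_eq_add_neg] at this
  rw [this]
  simp
  ring

theorem sq_mobiusNorm_smul (t : ℂ) (u : ℝ) : mobiusNorm (u * t) ^ 2 =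
    (1 + u ^ 2 * ‖t‖ ^ 2 + 2 * (u * t.re)) / (1 + u ^ 2 * ‖t‖ ^ 2 - 2 * (u * t.re)) := by
  rw [mobiusNorm, div_pow, sq_norm_one_add, sq_norm_one_sub, norm_mul, mul_pow, Complex.norm_real,
    Real.norm_eq_abs, sq_abs]
  simp

theorem sq_mobiusNorm (t : ℂ) : mobiusNorm t ^ 2 =
    (1 + ‖t‖ ^ 2 + 2 * t.re) / (1 + ‖t‖ ^ 2 - 2 * t.re) := by
  have := sq_mobiusNorm_smul t 1
  simpa using this

/-- Along a ray the modulus is an increasing function of u Re t/(1 + u²|t|²), which turns round at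
u|t| = 1. The product in `h` is, up to a factor 4, the difference of the cross-multiplied squares.
-/
theorem mobiusNorm_smul_le {t : ℂ} {u : ℝ} (h : 0 ≤ t.re * ((1 - u) * (1 - u * ‖t‖ ^ 2)))
    (h1 : 1 - t ≠ 0) (hu : 1 - u * t ≠ 0) : mobiusNorm (u * t) ≤ mobiusNorm t := by
  apply le_of_sq_le_sq _ (mobiusNorm_nonneg t)
  have p1 : 0 < 1 + ‖t‖ ^ 2 - 2 * t.re := by
    rw [← sq_norm_one_sub]
    have := norm_pos_iff.2 h1
    positivity
  have pu : 0 < 1 + u ^ 2 * ‖t‖ ^ 2 - 2 * (u * t.re) := by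
    have := sq_norm_one_sub (u * t)
    rw [norm_mul, mul_pow, Complex.norm_real, Real.norm_eq_abs, sq_abs] at this
    simp only [Complex.re_ofReal_mul] at this
    rw [← this]
    have := norm_pos_iff.2 hu
    positivity
  rw [sq_mobiusNorm_smul, sq_mobiusNorm, div_le_div_iff₀ pu p1]
  linarith

/-- A quantitative form of the decay in the left half-plane. It is needed for small saddles, where
the ray up to the unit circle is long and monotonicity alone would lose a power of 1/a. The
cross-multiplied difference is at least 2c(u-1) with c = -Re t, while the product it is compared
with is at most 8, whence the relative drop c(u-1)/4 of the squares. -/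
theorem mobiusNorm_smul_le_exp {t : ℂ} {u : ℝ} (hre : t.re < 0) (ht : ‖t‖ ≤ 1 / 2)
    (hu : 1 ≤ u) (hut : u * ‖t‖ ≤ 1) :
    mobiusNorm (u * t) ≤ mobiusNorm t * Real.exp (t.re / 8 * (u - 1)) := by
  have hm := mobiusNorm_nonneg t
  apply le_of_sq_le_sq _ (by positivity)
  rw [mul_pow, ← Real.exp_nat_mul, sq_mobiusNorm_smul, sq_mobiusNorm]
  set c : ℝ := -t.re with hc
  have htre : t.re = -c := by ring
  have hc0 : 0 < c := by linarith
  have hcle : c ≤ ‖t‖ := by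
    have := Complex.abs_re_le_norm t
    rw [abs_of_neg hre] at this
    exact this
  have ht0 : 0 ≤ ‖t‖ := norm_nonneg t
  rw [htre]
  generalize ‖t‖ = ρ at *
  have hu0 : 0 < u := by linarith
  have s1 : 0 < 1 + ρ ^ 2 + 2 * c := by positivity
  have su : 0 < 1 + u ^ 2 * ρ ^ 2 + 2 * (u * c) := by positivity
  have hρ2 : 0 < 1 + ρ ^ 2 - 2 * c := by nlinarith
  set e : ℝ := c / 4 * (u - 1) with he
  have hexp : 1 - e ≤ Real.exp (2 * (-c / 8 * (u - 1))) := by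
    have := Real.add_one_le_exp (2 * (-c / 8 * (u - 1)))
    have e1 : 2 * (-c / 8 * (u - 1)) = -e := by rw [he]; ring
    rw [e1] at this ⊢
    linarith
  have hup : u * ρ ^ 2 ≤ 1 / 2 := by nlinarith
  have hup2 : u ^ 2 * ρ ^ 2 ≤ 1 := by
    rw [← mul_pow]
    exact pow_le_one₀ (by positivity) hut
  have hρ4 : ρ ^ 2 ≤ 1 / 4 := by nlinarith
  have main : (1 + u ^ 2 * ρ ^ 2 - 2 * (u * c)) / (1 + u ^ 2 * ρ ^ 2 + 2 * (u * c)) ≤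
      (1 + ρ ^ 2 - 2 * c) / (1 + ρ ^ 2 + 2 * c) * (1 - e) := by
    rw [div_mul_eq_mul_div, div_le_div_iff₀ su s1]
    have hdiff : (1 + ρ ^ 2 - 2 * c) * (1 + u ^ 2 * ρ ^ 2 + 2 * (u * c)) -
      (1 + u ^ 2 * ρ ^ 2 - 2 * (u * c)) * (1 + ρ ^ 2 + 2 * c) =
      4 * c * (u - 1) * (1 - u * ρ ^ 2) := by ring
    have hcu : 0 ≤ c * (u - 1) := mul_nonneg hc0.le (by linarith)
    have b1 : 2 * (c * (u - 1)) ≤ 4 * c * (u - 1) * (1 - u * ρ ^ 2) := by nlinarith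
    have b2 : (1 + ρ ^ 2 - 2 * c) * (1 + u ^ 2 * ρ ^ 2 + 2 * (u * c)) ≤ 8 := by
      have x1 : 1 + ρ ^ 2 - 2 * c ≤ 2 := by linarith
      have x2 : 1 + u ^ 2 * ρ ^ 2 + 2 * (u * c) ≤ 4 := by nlinarith
      nlinarith
    have b3 : e * ((1 + ρ ^ 2 - 2 * c) * (1 + u ^ 2 * ρ ^ 2 + 2 * (u * c))) ≤
        e * 8 := mul_le_mul_of_nonneg_left b2 (by rw [he]; linarith)
    have b4 : e * 8 = 2 * (c * (u - 1)) := by rw [he]; ring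
    nlinarith
  simp only [sub_neg_eq_add, mul_neg, ← sub_eq_add_neg]
  refine main.trans ?_
  have : 0 ≤ (1 + ρ ^ 2 - 2 * c) / (1 + ρ ^ 2 + 2 * c) := by positivity
  push_cast
  gcongr

theorem norm_cpow_smul {z : ℂ} (hz : z ≠ 0) {u : ℝ} (hu : 0 < u) (s : ℂ) :
    ‖(u * z : ℂ) ^ s‖ = u ^ s.re * ‖z ^ s‖ := by
  have hu' : (u : ℂ) ≠ 0 := by exact_mod_cast hu.ne'
  rw [Complex.norm_cpow_of_ne_zero (mul_ne_zero hu' hz), Complex.norm_cpow_of_ne_zero hz,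
    Complex.arg_real_mul _ hu, norm_mul, Complex.norm_real, Real.norm_of_nonneg hu.le,
    Real.mul_rpow hu.le (norm_nonneg z), mul_div_assoc]

/-- The generating series in the coordinate in which the saddle point is `1`. -/
noncomputable def rotatedSeries (d : ℕ) (a : ℝ) (z : ℂ) : ℂ := ehrhartSeries d (-Complex.I * a * z)

/-- In the right half of the unit disc the modulus of (1+t)/(1-t) grows outwards, so the end of the
ray dominates and ∫ u^(Re x - 1) du = 1/Re x. The condition Re t ≤ 1/2 keeps the ray away from the
pole t = 1. -/
theorem norm_rayPrimitive_le {d : ℕ} {a : ℝ} {x z : ℂ} (hx : 0 < x.re) (hz : z ≠ 0)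
    (h0 : 0 ≤ (-Complex.I * a * z).re) (h2 : (-Complex.I * a * z).re ≤ 1 / 2)
    (h1 : ‖-Complex.I * a * z‖ ≤ 1) :
    ‖rayPrimitive (rotatedSeries d a) x z‖ ≤
      4 * ‖z‖ / x.re * ‖z ^ (x - 1) * rotatedSeries d a z‖ := by
  set t : ℂ := -Complex.I * a * z with ht
  have hne : ∀ u ∈ Set.Ioc (0 : ℝ) 1, 1 / 2 ≤ ‖1 - u * t‖ := by
    intro u hu
    have := Complex.re_le_norm (1 - u * t)
    simp only [Complex.sub_re, Complex.one_re, Complex.re_ofReal_mul] at this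
    nlinarith [hu.1, hu.2]
  have hnt : 1 / 2 ≤ ‖1 - t‖ := by simpa using hne 1 ⟨one_pos, le_rfl⟩
  have hnt2 : ‖1 - t‖ ≤ 2 := (norm_sub_le _ _).trans (by rw [norm_one]; linarith)
  have hbound : ∀ u ∈ Set.Ioc (0 : ℝ) 1, ‖rotatedSeries d a (u * z)‖ ≤
      4 * ‖rotatedSeries d a z‖ := by
    intro u hu
    have e : rotatedSeries d a (u * z) = ehrhartSeries d (u * t) := by
      rw [rotatedSeries, ht]
      congr 1
      ring
    rw [e, rotatedSeries, ← ht, norm_ehrhartSeries, norm_ehrhartSeries]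
    have hu2 := hne u hu
    have hle : mobiusNorm (u * t) ≤ mobiusNorm t := by
      apply mobiusNorm_smul_le
      · have : ‖t‖ ^ 2 ≤ 1 := pow_le_one₀ (norm_nonneg t) h1
        have : u * ‖t‖ ^ 2 ≤ 1 := mul_le_one₀ hu.2 (by positivity) this
        exact mul_nonneg h0 (mul_nonneg (by linarith [hu.2]) (by linarith))
      · exact norm_pos_iff.1 (by linarith)
      · exact norm_pos_iff.1 (by linarith)
    have hp : mobiusNorm (u * t) ^ d ≤ mobiusNorm t ^ d :=
      pow_le_pow_left₀ (mobiusNorm_nonneg _) hle d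
    have hp0 := pow_nonneg (mobiusNorm_nonneg t) d
    calc mobiusNorm (u * t) ^ d / ‖1 - u * t‖ ≤ mobiusNorm t ^ d / (1 / 2) := by gcongr
      _ = 4 * (mobiusNorm t ^ d / 2) := by ring
      _ ≤ _ := by gcongr
  have hint : ‖∫ u in (0 : ℝ)..1, (u : ℂ) ^ (x - 1) * rotatedSeries d a (u * z)‖ ≤
      ∫ u in (0 : ℝ)..1, u ^ (x.re - 1) * (4 * ‖rotatedSeries d a z‖) := by
    refine intervalIntegral.norm_integral_le_of_norm_le zero_le_one
      (Filter.Eventually.of_forall fun u hu => ?_)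
      ((intervalIntegral.intervalIntegrable_rpow' (by linarith)).mul_const _)
    rw [norm_mul, Complex.norm_cpow_eq_rpow_re_of_pos hu.1]
    have := hbound u hu
    have := Real.rpow_nonneg hu.1.le (x.re - 1)
    simp only [Complex.sub_re, Complex.one_re]
    gcongr
  rw [intervalIntegral.integral_mul_const, integral_rpow (Or.inl (by linarith)), sub_add_cancel,
    Real.one_rpow, Real.zero_rpow hx.ne', sub_zero] at hint
  have hzx : ‖z ^ x‖ = ‖z‖ * ‖z ^ (x - 1)‖ := by
    rw [Complex.cpow_sub _ _ hz, Complex.cpow_one, norm_div,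
      mul_div_cancel₀ _ (norm_ne_zero_iff.2 hz)]
  rw [rayPrimitive, norm_mul, norm_mul, hzx]
  calc _ ≤ ‖z‖ * ‖z ^ (x - 1)‖ * (1 / x.re * (4 * ‖rotatedSeries d a z‖)) := by gcongr
    _ = _ := by ring

/-- The series is taken on the t-plane cut along [1,∞), which is star-shaped about 0 and contains
the whole left half-plane, in particular t = -1. -/
theorem hasDerivAt_rayPrimitive_rotatedSeries {d : ℕ} {a : ℝ} {x z : ℂ} (hx : 0 < x.re)
    (hz : z ∈ Complex.slitPlane) (hz' : 1 - -Complex.I * a * z ∈ Complex.slitPlane) :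
    HasDerivAt (rayPrimitive (rotatedSeries d a) x) (z ^ (x - 1) * rotatedSeries d a z) z := by
  refine hasDerivAt_rayPrimitive (Ω := {w : ℂ | 1 - -Complex.I * a * w ∈ Complex.slitPlane})
    (Complex.isOpen_slitPlane.preimage (by fun_prop)) ?_ ?_ hx hz' hz
  · intro w hw b c hb hc hbc
    have := Complex.starConvex_one_slitPlane hw hb hc hbc
    simp only [smul_zero, zero_add, Set.mem_ofPred_eq, Complex.real_smul] at this ⊢
    convert this using 1
    have : (b : ℂ) + c = 1 := by exact_mod_cast hbc
    linear_combination -this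
  · intro w hw
    have h : 1 - -Complex.I * a * w ≠ 0 := Complex.slitPlane_ne_zero hw
    unfold rotatedSeries ehrhartSeries
    refine DifferentiableAt.differentiableWithinAt ?_
    exact DifferentiableAt.fun_div (by fun_prop) (by fun_prop) (pow_ne_zero _ h)

/-- The function is the square of e^(-φ)|1+t|/|1-t| at t = -i e^(iφ). Its derivative is a positive
multiple of cos φ (1 - cos φ). This is the critical case Im x = d of the estimate along the arc. -/
theorem exp_neg_mul_mobiusNorm_monotoneOn :
    MonotoneOn (fun φ : ℝ => Real.exp (-(2 * φ)) * ((1 + Real.sin φ) / (1 - Real.sin φ)))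
      (Set.Icc (-(Real.pi / 2)) 0) := by
  have hs : ∀ φ ∈ Set.Icc (-(Real.pi / 2)) 0, 0 < 1 - Real.sin φ := by
    intro φ hφ
    have := Real.sin_nonpos_of_nonpos_of_neg_pi_le hφ.2 (by linarith [hφ.1, Real.pi_pos])
    linarith
  have hd : ∀ φ ∈ Set.Icc (-(Real.pi / 2)) 0,
      HasDerivAt (fun φ : ℝ => Real.exp (-(2 * φ)) * ((1 + Real.sin φ) / (1 - Real.sin φ)))
        (Real.exp (-(2 * φ)) * (2 * Real.cos φ * (1 - Real.cos φ) / (1 - Real.sin φ) ^ 2)) φ := by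
    intro φ hφ
    have h := hs φ hφ
    have h1 : HasDerivAt (fun φ : ℝ => Real.exp (-(2 * φ))) (Real.exp (-(2 * φ)) * -(2 * 1)) φ :=
      ((hasDerivAt_id φ).const_mul 2).neg.exp
    have h2 : HasDerivAt (fun φ : ℝ => 1 + Real.sin φ) (Real.cos φ) φ :=
      (Real.hasDerivAt_sin φ).const_add 1
    have h3 : HasDerivAt (fun φ : ℝ => 1 - Real.sin φ) (-Real.cos φ) φ :=
      (Real.hasDerivAt_sin φ).const_sub 1
    refine (h1.mul (h2.div h3 h.ne')).congr_deriv ?_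
    have hsc := Real.sin_sq_add_cos_sq φ
    simp only [Pi.div_apply]
    field_simp
    linear_combination 2 * hsc
  refine monotoneOn_of_deriv_nonneg (convex_Icc _ _)
    (fun φ hφ => (hd φ hφ).continuousAt.continuousWithinAt) ?_ ?_
  · intro φ hφ
    exact (hd φ (interior_subset hφ)).differentiableAt.differentiableWithinAt
  · intro φ hφ
    have hφ' := interior_subset hφ
    rw [(hd φ hφ').deriv]
    have hc : 0 ≤ Real.cos φ :=
      Real.cos_nonneg_of_mem_Icc ⟨hφ'.1, by linarith [hφ'.2, Real.pi_pos]⟩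
    have hc1 := Real.cos_le_one φ
    have h := hs φ hφ'
    have : 0 ≤ 1 - Real.cos φ := by linarith
    positivity

/-- The difference of the primitive along the arc of the unit circle (in the original coordinate)
ending at `-1`. -/
theorem norm_rayPrimitive_arc_le {d : ℕ} {a : ℝ} {x : ℂ} (ha : 0 < a) (hx : 0 < x.re)
    (hd : x.im ≤ d) {φ₁ : ℝ} (hφ₁ : φ₁ ∈ Set.Icc (-(Real.pi / 2)) 0) :
    ‖rayPrimitive (rotatedSeries d a) x ((a⁻¹ : ℝ) * Complex.exp (φ₁ * Complex.I)) -
      rayPrimitive (rotatedSeries d a) x (-Complex.I / a)‖ ≤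
      2 * (a⁻¹ ^ x.re * (Real.exp (-(x.im * φ₁)) *
        mobiusNorm (-Complex.I * Complex.exp (φ₁ * Complex.I)) ^ d)) := by
  set γ : ℝ → ℂ := fun φ => (a⁻¹ : ℝ) * Complex.exp (φ * Complex.I) with hγ
  have hac : (a : ℂ) ≠ 0 := by exact_mod_cast ha.ne'
  have hai : 0 < a⁻¹ := inv_pos.2 ha
  have hγ0 : -Complex.I / a = γ (-(Real.pi / 2)) := by
    simp only [hγ]
    push_cast
    rw [neg_mul, Complex.exp_neg, Complex.exp_pi_div_two_mul_I, Complex.inv_I]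
    field_simp
  have ht : ∀ φ : ℝ, -Complex.I * a * γ φ = -Complex.I * Complex.exp (φ * Complex.I) := by
    intro φ
    simp only [hγ]
    push_cast
    field_simp
  have hre : ∀ φ : ℝ, (-Complex.I * Complex.exp (φ * Complex.I)).re = Real.sin φ := by
    intro φ
    simp [Complex.exp_ofReal_mul_I_re, Complex.exp_ofReal_mul_I_im]
  have hnt : ∀ φ : ℝ, ‖-Complex.I * Complex.exp (φ * Complex.I)‖ = 1 := by
    intro φ
    simp [Complex.norm_exp_ofReal_mul_I]
  have hmob : ∀ φ : ℝ, mobiusNorm (-Complex.I * Complex.exp (φ * Complex.I)) ^ 2 =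
      (1 + Real.sin φ) / (1 - Real.sin φ) := by
    intro φ
    rw [sq_mobiusNorm, hre, hnt, show (1 + 1 ^ 2 + 2 * Real.sin φ : ℝ) = 2 * (1 + Real.sin φ) by
      ring, show (1 + 1 ^ 2 - 2 * Real.sin φ : ℝ) = 2 * (1 - Real.sin φ) by ring,
      mul_div_mul_left _ _ two_ne_zero]
  have hsin : ∀ φ ∈ Set.Icc (-(Real.pi / 2)) 0, Real.sin φ ≤ 0 := fun φ hφ =>
    Real.sin_nonpos_of_nonpos_of_neg_pi_le hφ.2 (by linarith [hφ.1, Real.pi_pos])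
  have harg : ∀ φ ∈ Set.Icc (-(Real.pi / 2)) 0, (γ φ).arg = φ := by
    intro φ hφ
    simp only [hγ]
    rw [Complex.arg_real_mul _ hai, Complex.arg_exp_mul_I, toIocMod_eq_self]
    constructor <;> linarith [hφ.1, hφ.2, Real.pi_pos]
  have hγne : ∀ φ, γ φ ≠ 0 := fun φ =>
    mul_ne_zero (by exact_mod_cast hai.ne') (Complex.exp_ne_zero _)
  have hγn : ∀ φ, ‖γ φ‖ = a⁻¹ := by
    intro φ
    simp only [hγ, norm_mul, Complex.norm_exp_ofReal_mul_I, Complex.norm_real, mul_one]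
    exact Real.norm_of_nonneg hai.le
  have hder : ∀ φ ∈ Set.Icc (-(Real.pi / 2)) 0,
      HasDerivAt (fun φ => rayPrimitive (rotatedSeries d a) x (γ φ))
        ((γ φ) ^ (x - 1) * rotatedSeries d a (γ φ) * (γ φ * Complex.I)) φ := by
    intro φ hφ
    have hg : HasDerivAt γ (γ φ * Complex.I) φ := by
      have h1 : HasDerivAt (fun φ : ℝ => (φ : ℂ) * Complex.I) Complex.I φ := by
        simpa using (Complex.ofRealCLM.hasDerivAt (x := φ)).mul_const Complex.I
      refine (h1.cexp.const_mul ((a⁻¹ : ℝ) : ℂ)).congr_deriv ?_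
      simp only [hγ]
      ring
    refine HasDerivAt.comp_of_eq φ (hasDerivAt_rayPrimitive_rotatedSeries hx ?_ ?_) hg rfl
    · rw [Complex.mem_slitPlane_iff_arg, harg φ hφ]
      exact ⟨by linarith [hφ.2, Real.pi_pos], hγne φ⟩
    · left
      rw [ht, Complex.sub_re, hre, Complex.one_re]
      linarith [hsin φ hφ]
  set M : ℝ := a⁻¹ ^ x.re * (Real.exp (-(x.im * φ₁)) *
        mobiusNorm (-Complex.I * Complex.exp (φ₁ * Complex.I)) ^ d) with hM
  have hM0 : 0 ≤ M := by
    have := mobiusNorm_nonneg (-Complex.I * Complex.exp (φ₁ * Complex.I))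
    positivity
  have hbd : ∀ φ ∈ Set.Icc (-(Real.pi / 2)) φ₁,
      ‖(γ φ) ^ (x - 1) * rotatedSeries d a (γ φ) * (γ φ * Complex.I)‖ ≤ M := by
    intro φ hφ
    have hφ0 : φ ∈ Set.Icc (-(Real.pi / 2)) 0 := ⟨hφ.1, hφ.2.trans hφ₁.2⟩
    have e1 : (γ φ) ^ (x - 1) * rotatedSeries d a (γ φ) * (γ φ * Complex.I) =
        (γ φ) ^ x * rotatedSeries d a (γ φ) * Complex.I := by
      rw [Complex.cpow_sub _ _ (hγne φ), Complex.cpow_one]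
      field_simp [hγne φ]
    rw [e1, norm_mul, norm_mul, Complex.norm_I, mul_one, Complex.norm_cpow_of_ne_zero (hγne φ),
      harg φ hφ0, hγn, rotatedSeries, ht, norm_ehrhartSeries]
    have hone : 1 ≤ ‖1 - -Complex.I * Complex.exp (φ * Complex.I)‖ := by
      have := Complex.re_le_norm (1 - -Complex.I * Complex.exp (φ * Complex.I))
      rw [Complex.sub_re, hre, Complex.one_re] at this
      linarith [hsin φ hφ0]
    have hm0 := mobiusNorm_nonneg (-Complex.I * Complex.exp (φ * Complex.I))
    have hm1 := mobiusNorm_nonneg (-Complex.I * Complex.exp (φ₁ * Complex.I))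
    have hmono : Real.exp (-φ) * mobiusNorm (-Complex.I * Complex.exp (φ * Complex.I)) ≤
        Real.exp (-φ₁) * mobiusNorm (-Complex.I * Complex.exp (φ₁ * Complex.I)) := by
      apply le_of_sq_le_sq _ (by positivity)
      rw [mul_pow, mul_pow, hmob, hmob, ← Real.exp_nat_mul, ← Real.exp_nat_mul]
      have := exp_neg_mul_mobiusNorm_monotoneOn hφ0 hφ₁ hφ.2
      simpa using this
    have hmono' : Real.exp (-(x.im * φ)) *
        mobiusNorm (-Complex.I * Complex.exp (φ * Complex.I)) ^ d ≤
        Real.exp (-(x.im * φ₁)) *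
          mobiusNorm (-Complex.I * Complex.exp (φ₁ * Complex.I)) ^ d := by
      -- The factor exp((d - Im x)ψ) is nondecreasing because Im x ≤ d; what remains is a d-th power
      -- of the monotone function of the critical case.
      have s : ∀ ψ : ℝ, Real.exp (-(x.im * ψ)) *
          mobiusNorm (-Complex.I * Complex.exp (ψ * Complex.I)) ^ d =
          Real.exp ((d - x.im) * ψ) *
            (Real.exp (-ψ) * mobiusNorm (-Complex.I * Complex.exp (ψ * Complex.I))) ^ d := by
        intro ψ
        rw [mul_pow, ← Real.exp_nat_mul, ← mul_assoc, ← Real.exp_add]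
        congr 2
        ring
      rw [s, s]
      have : (d - x.im) * φ ≤ (d - x.im) * φ₁ :=
        mul_le_mul_of_nonneg_left hφ.2 (by linarith)
      gcongr
    have hb0 : 0 ≤ a⁻¹ ^ x.re := Real.rpow_nonneg hai.le _
    calc a⁻¹ ^ x.re / Real.exp (φ * x.im) *
          (mobiusNorm (-Complex.I * Complex.exp (φ * Complex.I)) ^ d /
            ‖1 - -Complex.I * Complex.exp (φ * Complex.I)‖)
        ≤ a⁻¹ ^ x.re / Real.exp (φ * x.im) *
          mobiusNorm (-Complex.I * Complex.exp (φ * Complex.I)) ^ d := by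
          gcongr
          exact div_le_self (by positivity) hone
      _ = a⁻¹ ^ x.re * (Real.exp (-(x.im * φ)) *
          mobiusNorm (-Complex.I * Complex.exp (φ * Complex.I)) ^ d) := by
          rw [Real.exp_neg, mul_comm φ]
          ring
      _ ≤ M := by
          rw [hM]
          gcongr
  have := Convex.norm_image_sub_le_of_norm_hasDerivWithin_le (𝕜 := ℝ)
    (f := fun φ => rayPrimitive (rotatedSeries d a) x (γ φ))
    (fun φ hφ => (hder φ ⟨hφ.1, hφ.2.trans hφ₁.2⟩).hasDerivWithinAt) hbd
    (convex_Icc (-(Real.pi / 2)) φ₁) (Set.left_mem_Icc.2 hφ₁.1) (Set.right_mem_Icc.2 hφ₁.1)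
  rw [hγ0]
  refine this.trans ?_
  rw [mul_comm]
  gcongr
  rw [Real.norm_of_nonneg (by linarith [hφ₁.1])]
  linarith [hφ₁.2, Real.pi_lt_four]

section
variable {d : ℕ} {a : ℝ} {x z : ℂ}

theorem rotatedSeries_smul (d : ℕ) (a u : ℝ) (z : ℂ) :
    rotatedSeries d a (u * z) = ehrhartSeries d (u * (-Complex.I * a * z)) := by
  rw [rotatedSeries]
  congr 1
  ring

theorem re_rotate (a : ℝ) (z : ℂ) : (-Complex.I * a * z).re = a * z.im := by
  simp

theorem hasDerivAt_rayPrimitive_radial (ha : 0 < a) (hx : 0 < x.re) (hzr : 0 < z.re)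
    (hzi : z.im < 0) {u : ℝ} (hu : 0 < u) :
    HasDerivAt (fun u : ℝ => rayPrimitive (rotatedSeries d a) x (u * z))
      ((u * z : ℂ) ^ (x - 1) * rotatedSeries d a (u * z) * z) u := by
  have hg : HasDerivAt (fun u : ℝ => (u : ℂ) * z) z u := by
    simpa using (Complex.ofRealCLM.hasDerivAt (x := u)).mul_const z
  refine HasDerivAt.comp_of_eq u (hasDerivAt_rayPrimitive_rotatedSeries hx ?_ ?_) hg rfl
  · left
    rw [Complex.re_ofReal_mul]
    positivity
  · left
    rw [Complex.sub_re, re_rotate, Complex.im_ofReal_mul, Complex.one_re]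
    have : a * (u * z.im) ≤ 0 :=
      mul_nonpos_of_nonneg_of_nonpos ha.le (mul_nonpos_of_nonneg_of_nonpos hu.le hzi.le)
    linarith

theorem norm_radial_deriv_le (ha : 0 < a) (hzr : 0 < z.re) (hzi : z.im < 0)
    {u E : ℝ} (hu : 0 < u)
    (hE : mobiusNorm (u * (-Complex.I * a * z)) ^ d ≤ mobiusNorm (-Complex.I * a * z) ^ d * E) :
    ‖(u * z : ℂ) ^ (x - 1) * rotatedSeries d a (u * z) * z‖ ≤
      u ^ (x.re - 1) * E * (‖z‖ * (1 + ‖-Complex.I * a * z‖) *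
        ‖z ^ (x - 1) * rotatedSeries d a z‖) := by
  have hz : z ≠ 0 := by rintro rfl; simp at hzr
  have hre := re_rotate a z
  set t : ℂ := -Complex.I * a * z with ht
  have htre : t.re < 0 := by rw [hre]; exact mul_neg_of_pos_of_neg ha hzi
  have hone : 1 ≤ ‖1 - u * t‖ := by
    have := Complex.re_le_norm (1 - u * t)
    rw [Complex.sub_re, Complex.re_ofReal_mul, Complex.one_re] at this
    nlinarith
  have h1t : 0 < ‖1 - t‖ := by
    have := Complex.re_le_norm (1 - t)
    rw [Complex.sub_re, Complex.one_re] at this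
    linarith
  have h1t2 : ‖1 - t‖ ≤ 1 + ‖t‖ := (norm_sub_le _ _).trans (by rw [norm_one])
  rw [norm_mul, norm_mul, norm_cpow_smul hz hu, rotatedSeries_smul, ← ht, norm_ehrhartSeries,
    norm_mul (z ^ (x - 1)), rotatedSeries, ← ht, norm_ehrhartSeries, Complex.sub_re, Complex.one_re]
  have hm := pow_nonneg (mobiusNorm_nonneg t) d
  have hmu := pow_nonneg (mobiusNorm_nonneg (u * t)) d
  have hup := Real.rpow_nonneg hu.le (x.re - 1)
  have hE0 : 0 ≤ mobiusNorm t ^ d * E := hmu.trans hE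
  calc u ^ (x.re - 1) * ‖z ^ (x - 1)‖ * (mobiusNorm (u * t) ^ d / ‖1 - u * t‖) * ‖z‖
      ≤ u ^ (x.re - 1) * ‖z ^ (x - 1)‖ * (mobiusNorm t ^ d * E) * ‖z‖ := by
        gcongr
        exact (div_le_self hmu hone).trans hE
    _ = u ^ (x.re - 1) * ‖z‖ * ‖z ^ (x - 1)‖ * (mobiusNorm t ^ d * E) / ‖1 - t‖ * ‖1 - t‖ := by
        field_simp
    _ ≤ u ^ (x.re - 1) * ‖z‖ * ‖z ^ (x - 1)‖ * (mobiusNorm t ^ d * E) / ‖1 - t‖ * (1 + ‖t‖) := by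
        gcongr
    _ = _ := by ring

theorem mobiusNorm_radial_pow_le (htre : (-Complex.I * a * z).re < 0)
    (ht : ‖-Complex.I * a * z‖ ≤ 1 / 2) {u : ℝ} (hu : 1 ≤ u) (hut : u * ‖-Complex.I * a * z‖ ≤ 1) :
    mobiusNorm (u * (-Complex.I * a * z)) ^ d ≤ mobiusNorm (-Complex.I * a * z) ^ d *
      Real.exp (-(d * (a * -z.im) / 8) * (u - 1)) := by
  have h := pow_le_pow_left₀ (mobiusNorm_nonneg _) (mobiusNorm_smul_le_exp htre ht hu hut) d
  rw [mul_pow, ← Real.exp_nat_mul] at h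
  refine h.trans (le_of_eq ?_)
  rw [re_rotate]
  congr 2
  ring

/-- The derivative along the ray is at most M exp(-k(u-1)), so the increment is compared with the
primitive of this bound, which never exceeds M/k however long the ray is. -/
theorem norm_rayPrimitive_radial_le_of_small (ha : 0 < a) (hx : 0 < x.re) (hx1 : x.re ≤ 1)
    (hzr : 0 < z.re) (hzi : z.im < 0) (ht : ‖-Complex.I * a * z‖ ≤ 1 / 2) (hd : 0 < d) {U : ℝ}
    (hU : 1 ≤ U) (hUt : U * ‖-Complex.I * a * z‖ ≤ 1) :
    ‖rayPrimitive (rotatedSeries d a) x (U * z) - rayPrimitive (rotatedSeries d a) x z‖ ≤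
      2 * ‖z‖ * ‖z ^ (x - 1) * rotatedSeries d a z‖ / (d * (a * -z.im) / 8) := by
  set k : ℝ := d * (a * -z.im) / 8 with hk
  have hk0 : 0 < k := by
    have : (0 : ℝ) < d := by exact_mod_cast hd
    have : 0 < -z.im := by linarith
    positivity
  set M : ℝ := 2 * ‖z‖ * ‖z ^ (x - 1) * rotatedSeries d a z‖ with hM
  have hM0 : 0 ≤ M := by positivity
  have htre : (-Complex.I * a * z).re < 0 := by
    rw [re_rotate]; exact mul_neg_of_pos_of_neg ha hzi
  have key := image_norm_le_of_norm_deriv_right_le_deriv_boundary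
    (f := fun u : ℝ => rayPrimitive (rotatedSeries d a) x (u * z) -
      rayPrimitive (rotatedSeries d a) x z)
    (f' := fun u => (u * z : ℂ) ^ (x - 1) * rotatedSeries d a (u * z) * z) (a := 1) (b := U)
    (B := fun u => M / k * (1 - Real.exp (-k * (u - 1))))
    (B' := fun u => M * Real.exp (-k * (u - 1)))
    (fun u hu => ((hasDerivAt_rayPrimitive_radial ha hx hzr hzi
      (by linarith [hu.1])).sub_const _).continuousAt.continuousWithinAt)
    (fun u hu => ((hasDerivAt_rayPrimitive_radial ha hx hzr hzi
      (by linarith [hu.1])).sub_const _).hasDerivWithinAt)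
    (by simp) (fun u => ?_) (fun u hu => ?_) (Set.right_mem_Icc.2 hU)
  · refine key.trans ?_
    have := (Real.exp_pos (-k * (U - 1))).le
    have h0 : 0 ≤ M / k := by positivity
    nlinarith
  · have h1 : HasDerivAt (fun u : ℝ => -k * (u - 1)) (-k) u := by
      simpa using ((hasDerivAt_id u).sub_const 1).const_mul (-k)
    refine ((h1.exp.const_sub 1).const_mul (M / k)).congr_deriv ?_
    field_simp
  · have hu0 : 0 < u := by linarith [hu.1]
    have hut : u * ‖-Complex.I * a * z‖ ≤ 1 :=
      (mul_le_mul_of_nonneg_right hu.2.le (norm_nonneg _)).trans hUt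
    refine (norm_radial_deriv_le ha hzr hzi hu0
      (mobiusNorm_radial_pow_le htre ht hu.1 hut)).trans ?_
    have hup : u ^ (x.re - 1) ≤ 1 := Real.rpow_le_one_of_one_le_of_nonpos hu.1 (by linarith)
    calc _ ≤ 1 * Real.exp (-k * (u - 1)) * (‖z‖ * (1 + 1) *
        ‖z ^ (x - 1) * rotatedSeries d a z‖) := by
          gcongr
          linarith
      _ = _ := by rw [hM]; ring

/-- Here the way to the unit circle has bounded length, so monotonicity of the modulus is enough.
Since |t| may exceed 1 the ray may also run inwards, hence the unordered intervals. -/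
theorem norm_rayPrimitive_radial_le_of_large (ha : 0 < a) (hx : 0 < x.re) (hx1 : x.re ≤ 1)
    (hzr : 0 < z.re) (hzi : z.im < 0) (ht : 1 / 2 ≤ ‖-Complex.I * a * z‖)
    (ht2 : ‖-Complex.I * a * z‖ ≤ 2) :
    mobiusNorm ((‖-Complex.I * a * z‖⁻¹ : ℝ) * (-Complex.I * a * z)) ≤
        mobiusNorm (-Complex.I * a * z) ∧
    ‖rayPrimitive (rotatedSeries d a) x ((‖-Complex.I * a * z‖⁻¹ : ℝ) * z) -
      rayPrimitive (rotatedSeries d a) x z‖ ≤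
      6 * ‖z‖ * ‖z ^ (x - 1) * rotatedSeries d a z‖ := by
  set ρ : ℝ := ‖-Complex.I * a * z‖ with hρ
  have htre : (-Complex.I * a * z).re < 0 := by
    rw [re_rotate]; exact mul_neg_of_pos_of_neg ha hzi
  have hρ0 : 0 < ρ := by linarith
  have hρi : 0 < ρ⁻¹ := inv_pos.2 hρ0
  have hρ2 : ρ⁻¹ ≤ 2 := by rw [inv_le_comm₀ hρ0 two_pos]; linarith
  have hρ3 : 1 / 2 ≤ ρ⁻¹ := by rw [one_div]; exact inv_anti₀ hρ0 ht2
  have hmem : ∀ u ∈ Set.uIcc 1 ρ⁻¹, 1 / 2 ≤ u ∧ (1 - u) * (1 - u * ρ ^ 2) ≤ 0 := by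
    intro u hu
    rcases le_total 1 ρ⁻¹ with h | h
    · rw [Set.uIcc_of_le h] at hu
      have h1 : ρ ≤ 1 := by rwa [one_le_inv₀ hρ0] at h
      have h2 : u * ρ ≤ 1 := by
        have := mul_le_mul_of_nonneg_right hu.2 hρ0.le
        rwa [inv_mul_cancel₀ hρ0.ne'] at this
      have h3 : u * ρ ^ 2 ≤ 1 := by nlinarith
      exact ⟨by linarith [hu.1], mul_nonpos_of_nonpos_of_nonneg (by linarith [hu.1]) (by linarith)⟩
    · rw [Set.uIcc_of_ge h] at hu
      have h1 : 1 ≤ ρ := by rwa [inv_le_one₀ hρ0] at h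
      have h2 : 1 ≤ u * ρ := by
        have := mul_le_mul_of_nonneg_right hu.1 hρ0.le
        rwa [inv_mul_cancel₀ hρ0.ne'] at this
      have h3 : 1 ≤ u * ρ ^ 2 := by nlinarith
      exact ⟨by linarith [hu.1], mul_nonpos_of_nonneg_of_nonpos (by linarith [hu.2]) (by linarith)⟩
  have hmob : ∀ u ∈ Set.uIcc 1 ρ⁻¹,
      mobiusNorm (u * (-Complex.I * a * z)) ≤ mobiusNorm (-Complex.I * a * z) := by
    intro u hu
    obtain ⟨h1, h2⟩ := hmem u hu
    apply mobiusNorm_smul_le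
    · exact mul_nonneg_of_nonpos_of_nonpos htre.le h2
    · intro h
      have := congrArg Complex.re h
      rw [Complex.sub_re, Complex.one_re, Complex.zero_re] at this
      linarith
    · intro h
      have := congrArg Complex.re h
      rw [Complex.sub_re, Complex.one_re, Complex.zero_re, Complex.re_ofReal_mul] at this
      nlinarith
  refine ⟨hmob _ Set.right_mem_uIcc, ?_⟩
  have hbd : ∀ u ∈ Set.uIcc 1 ρ⁻¹,
      ‖(u * z : ℂ) ^ (x - 1) * rotatedSeries d a (u * z) * z‖ ≤
        6 * ‖z‖ * ‖z ^ (x - 1) * rotatedSeries d a z‖ := by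
    intro u hu
    have hu1 := (hmem u hu).1
    have hu0 : 0 < u := by linarith
    refine (norm_radial_deriv_le (E := 1) ha hzr hzi hu0 ?_).trans ?_
    · rw [mul_one]
      exact pow_le_pow_left₀ (mobiusNorm_nonneg _) (hmob u hu) d
    · have h2 : u ^ (x.re - 1) ≤ 2 := by
        calc u ^ (x.re - 1) ≤ (1 / 2) ^ (x.re - 1) :=
              Real.rpow_le_rpow_of_nonpos (by norm_num) hu1 (by linarith)
          _ = 2 ^ (1 - x.re) := by
              rw [one_div, Real.inv_rpow (by norm_num), ← Real.rpow_neg (by norm_num), neg_sub]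
          _ ≤ 2 ^ (1 : ℝ) := Real.rpow_le_rpow_of_exponent_le (by norm_num) (by linarith)
          _ = 2 := Real.rpow_one 2
      calc _ ≤ 2 * 1 * (‖z‖ * (1 + 2) * ‖z ^ (x - 1) * rotatedSeries d a z‖) := by gcongr
        _ = _ := by ring
  have := Convex.norm_image_sub_le_of_norm_hasDerivWithin_le (𝕜 := ℝ)
    (f := fun u : ℝ => rayPrimitive (rotatedSeries d a) x (u * z))
    (fun u hu => (hasDerivAt_rayPrimitive_radial ha hx hzr hzi
      (by linarith [(hmem u hu).1])).hasDerivWithinAt) hbd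
    (convex_uIcc 1 ρ⁻¹) Set.left_mem_uIcc Set.right_mem_uIcc
  simp only [Complex.ofReal_one, one_mul] at this
  refine this.trans (mul_le_of_le_one_right (by positivity) ?_)
  rw [Real.norm_eq_abs, abs_le]
  constructor <;> linarith

end

/-- The route goes radially from z to the circle |t| = 1 (scaling by U = 1/|t|) and then along that
circle to t = -1. On both pieces the integrand is controlled by its starting value. -/
theorem norm_rayPrimitive_sub_endpoint_le {η : ℝ} (hη : 0 < η) {d : ℕ} {a : ℝ} {x z : ℂ}
    (ha : 0 < a) (ha1 : a < 1) (hτ : 1 ≤ x.im) (hda : d * (2 * a) = x.im * (1 + a ^ 2))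
    (hx : 0 < x.re) (hx1 : x.re ≤ 1) (hzr : 0 < z.re) (hzi : z.im ≤ -η) (hz2 : ‖z‖ ≤ 2) :
    ‖rayPrimitive (rotatedSeries d a) x z - rayPrimitive (rotatedSeries d a) x (-Complex.I / a)‖ ≤
      (60 + 832 / η) * ‖z ^ (x - 1) * rotatedSeries d a z‖ := by
  have hz : z ≠ 0 := by rintro rfl; simp at hzr
  have hzi0 : z.im < 0 := by linarith
  have hzn : 0 < ‖z‖ := norm_pos_iff.2 hz
  have hdx : x.im ≤ d := by nlinarith [sq_nonneg (1 - a)]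
  have hd1 : (1 : ℝ) ≤ d := hτ.trans hdx
  have hd : 0 < d := by exact_mod_cast (by linarith : (0 : ℝ) < d)
  have had : 1 ≤ 2 * (d * a) := by nlinarith [sq_nonneg a]
  have htn : ‖-Complex.I * a * z‖ = a * ‖z‖ := by
    rw [norm_mul, norm_mul, norm_neg, Complex.norm_I, one_mul, Complex.norm_real,
      Real.norm_of_nonneg ha.le]
  have htre : (-Complex.I * a * z).re < 0 := by
    rw [re_rotate]; exact mul_neg_of_pos_of_neg ha hzi0
  set t : ℂ := -Complex.I * a * z with ht
  set U : ℝ := ‖t‖⁻¹ with hU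
  set B : ℝ := ‖z ^ (x - 1) * rotatedSeries d a z‖ with hB
  have hB0 : 0 ≤ B := norm_nonneg _
  have ht0 : 0 < ‖t‖ := by rw [htn]; positivity
  have ht2 : ‖t‖ ≤ 2 := by rw [htn]; nlinarith
  have hpolar : ‖z‖ * Complex.exp (z.arg * Complex.I) = z := Complex.norm_mul_exp_arg_mul_I z
  have hznc : (‖z‖ : ℂ) ≠ 0 := by exact_mod_cast hzn.ne'
  have hac : (a : ℂ) ≠ 0 := by exact_mod_cast ha.ne'
  have hUz : (U : ℂ) * z = (a⁻¹ : ℝ) * Complex.exp (z.arg * Complex.I) := by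
    conv_lhs => rw [← hpolar]
    rw [hU, htn]
    push_cast
    field_simp
  have hUt : (U : ℂ) * t = -Complex.I * Complex.exp (z.arg * Complex.I) := by
    rw [ht, mul_left_comm, hUz]
    push_cast
    field_simp
  have harg : z.arg ∈ Set.Icc (-(Real.pi / 2)) 0 :=
    ⟨(abs_le.1 (Complex.abs_arg_le_pi_div_two_iff.2 hzr.le)).1, (Complex.arg_neg_iff.2 hzi0).le⟩
  have harc := norm_rayPrimitive_arc_le (a := a) ha hx hdx harg
  rw [← hUz, ← hUt] at harc
  have hxp : Real.exp (-(x.im * z.arg)) ≤ 2 * ‖z ^ (x - 1)‖ := by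
    rw [Complex.norm_cpow_of_ne_zero hz, Complex.sub_re, Complex.sub_im, Complex.one_re,
      Complex.one_im, sub_zero, Real.exp_neg, mul_comm x.im, ← one_div, ← mul_div_assoc]
    have h1 : ‖z‖ ^ (1 - x.re) ≤ 2 := by
      calc ‖z‖ ^ (1 - x.re) ≤ 2 ^ (1 - x.re) :=
            Real.rpow_le_rpow hzn.le hz2 (by linarith)
        _ ≤ 2 ^ (1 : ℝ) := Real.rpow_le_rpow_of_exponent_le (by norm_num) (by linarith)
        _ = 2 := Real.rpow_one 2
    have h2 : ‖z‖ ^ (1 - x.re) * ‖z‖ ^ (x.re - 1) = 1 := by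
      rw [← Real.rpow_add hzn]
      simp
    have h3 := Real.rpow_pos_of_pos hzn (x.re - 1)
    gcongr
    nlinarith
  have h1t : 0 < ‖1 - t‖ := by
    have := Complex.re_le_norm (1 - t)
    rw [Complex.sub_re, Complex.one_re] at this
    linarith
  have hmob : mobiusNorm t ^ d ≤ 3 * ‖rotatedSeries d a z‖ := by
    have h1t2 : ‖1 - t‖ ≤ 3 := (norm_sub_le _ _).trans (by rw [norm_one]; linarith)
    have hm := pow_nonneg (mobiusNorm_nonneg t) d
    rw [rotatedSeries, ← ht, norm_ehrhartSeries, mul_div_assoc', le_div_iff₀ h1t]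
    nlinarith
  have hap : a⁻¹ ^ x.re ≤ a⁻¹ := by
    have : 1 ≤ a⁻¹ := (one_le_inv₀ ha).2 ha1.le
    calc a⁻¹ ^ x.re ≤ a⁻¹ ^ (1 : ℝ) := Real.rpow_le_rpow_of_exponent_le this hx1
      _ = a⁻¹ := Real.rpow_one _
  have hai : 0 < a⁻¹ := inv_pos.2 ha
  have harc' : ∀ E : ℝ, 0 ≤ E → mobiusNorm (U * t) ^ d ≤ mobiusNorm t ^ d * E →
      ‖rayPrimitive (rotatedSeries d a) x (U * z) -
        rayPrimitive (rotatedSeries d a) x (-Complex.I / a)‖ ≤ 12 * (a⁻¹ * E) * B := by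
    intro E hE0 hE
    have hmu := pow_nonneg (mobiusNorm_nonneg (U * t)) d
    refine harc.trans ?_
    calc _ ≤ 2 * (a⁻¹ * (2 * ‖z ^ (x - 1)‖ * (3 * ‖rotatedSeries d a z‖ * E))) := by
          gcongr
          exact hE.trans (by gcongr)
      _ = _ := by rw [hB, norm_mul]; ring
  have htri : ∀ R A : ℝ, ‖rayPrimitive (rotatedSeries d a) x (U * z) -
      rayPrimitive (rotatedSeries d a) x z‖ ≤ R →
      ‖rayPrimitive (rotatedSeries d a) x (U * z) -
        rayPrimitive (rotatedSeries d a) x (-Complex.I / a)‖ ≤ A →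
      ‖rayPrimitive (rotatedSeries d a) x z -
        rayPrimitive (rotatedSeries d a) x (-Complex.I / a)‖ ≤ R + A := by
    intro R A h1 h2
    rw [← sub_sub_sub_cancel_left _ _ (rayPrimitive (rotatedSeries d a) x (U * z))]
    exact (norm_sub_le _ _).trans (by linarith)
  have hηi : 0 < 1 / η := by positivity
  rcases le_total ‖t‖ (1 / 2) with hsmall | hlarge
  · have hU2 : 2 ≤ U := by rw [hU, le_inv_comm₀ two_pos ht0]; linarith
    have hUt1 : U * ‖t‖ ≤ 1 := (inv_mul_cancel₀ ht0.ne').le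
    set k : ℝ := d * (a * -z.im) / 8 with hk
    have hk1 : d * a * η ≤ 8 * k := by
      have : d * a * η ≤ d * a * -z.im := by gcongr; linarith
      linarith
    have hk2 : η / 16 ≤ k := by nlinarith
    have hk0 : 0 < k := by linarith
    have hrad := norm_rayPrimitive_radial_le_of_small ha hx hx1 hzr hzi0 hsmall hd
      (by linarith : 1 ≤ U) hUt1
    have hmobU := mobiusNorm_radial_pow_le (d := d) htre hsmall (by linarith : 1 ≤ U) hUt1
    -- The arc costs a factor a⁻¹ ≤ 2d. The radial decay repays it: U - 1 ≥ 1/(4a) gives k(U-1) ≥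
    -- dη/32, so the exponential is at most 32/(dη) and d cancels.
    have hE : a⁻¹ * Real.exp (-k * (U - 1)) ≤ 64 / η := by
      have e1 : a⁻¹ ≤ 2 * d := by
        rw [inv_le_iff_one_le_mul₀ ha]
        linarith
      have e2 : d * η / 32 ≤ k * (U - 1) := by
        have hUa : 1 / (4 * a) ≤ U - 1 := by
          have : 1 / (2 * a) ≤ U := by
            rw [hU, htn, ← one_div]
            apply one_div_le_one_div_of_le (by positivity)
            nlinarith
          have h4 : 1 / (4 * a) = (1 / (2 * a)) / 2 := by field_simp; norm_num
          rw [h4]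
          linarith
        calc d * η / 32 = (d * a * η / 8) * (1 / (4 * a)) := by field_simp; norm_num
          _ ≤ k * (U - 1) := by
            gcongr
            linarith
      have e3 : Real.exp (-k * (U - 1)) ≤ 32 / (d * η) := by
        rw [neg_mul, Real.exp_neg, ← inv_div]
        apply inv_anti₀ (by positivity)
        linarith [Real.add_one_le_exp (k * (U - 1))]
      calc _ ≤ 2 * d * (32 / (d * η)) := by gcongr
        _ = 64 / η := by field_simp; norm_num
    have hA := harc' _ (Real.exp_pos _).le hmobU
    refine (htri (2 * ‖z‖ * B / k) (12 * (a⁻¹ * Real.exp (-k * (U - 1))) * B) hrad hA).trans ?_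
    have hr : 2 * ‖z‖ * B / k ≤ 64 / η * B := by
      rw [div_le_iff₀ hk0]
      calc 2 * ‖z‖ * B ≤ 2 * 2 * B := by gcongr
        _ = 64 / η * B * (η / 16) := by field_simp; ring
        _ ≤ 64 / η * B * k := by gcongr
    have ha' : 12 * (a⁻¹ * Real.exp (-k * (U - 1))) * B ≤ 12 * (64 / η) * B := by gcongr
    have e : (60 + 832 / η) * B = 60 * B + 64 / η * B + 12 * (64 / η) * B := by ring
    rw [e]
    linarith
  · obtain ⟨hm, hrad⟩ := norm_rayPrimitive_radial_le_of_large (d := d) ha hx hx1 hzr hzi0 hlarge ht2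
    have hA := harc' 1 zero_le_one (by
      rw [mul_one]
      exact pow_le_pow_left₀ (mobiusNorm_nonneg _) hm d)
    refine (htri (6 * ‖z‖ * B) (12 * (a⁻¹ * 1) * B) hrad hA).trans ?_
    have ha4 : a⁻¹ ≤ 4 := by
      rw [inv_le_iff_one_le_mul₀ ha]
      have := mul_le_mul_of_nonneg_left hz2 ha.le
      linarith
    have h6 : 6 * ‖z‖ * B ≤ 6 * 2 * B := by gcongr
    have h12 : 12 * (a⁻¹ * 1) * B ≤ 12 * (4 * 1) * B := by gcongr
    have e : (60 + 832 / η) * B = 6 * 2 * B + 12 * (4 * 1) * B + 832 * (1 / η) * B := by ring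
    have : 0 ≤ 832 * (1 / η) * B := by positivity
    rw [e]
    linarith

/-! ### Two-sided control of the model integral. -/

theorem measurable_pathAbscissa : Measurable pathAbscissa := by
  unfold pathAbscissa pathRatio
  fun_prop

theorem measurable_pathExponent : Measurable pathExponent := by
  unfold pathExponent
  fun_prop

/-- Change of variable X = `pathAbscissa T`, which is injective; the 3 is the bound for |U'|/X'. -/
theorem integrableOn_comp_pathAbscissa {w : ℝ → ℝ} (hw : Continuous w)
    (hint : MeasureTheory.Integrable w) (h0 : ∀ X, 0 ≤ w X) :
    MeasureTheory.IntegrableOn (fun T => w (pathAbscissa T) * ‖deriv pathCurve T‖)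
        (Set.Ioi (-1 / 3)) ∧
      ∫ T in Set.Ioi (-1 / 3 : ℝ), w (pathAbscissa T) * ‖deriv pathCurve T‖ ≤ 3 * ∫ X, w X := by
  have hd : ∀ T ∈ Set.Ioi (-1 / 3 : ℝ), HasDerivWithinAt pathAbscissa
      ((3 * T ^ 2 + 3 * T + 1) / (pathRatio T * (3 * T + 1) ^ 2)) (Set.Ioi (-1 / 3)) T :=
    fun T hT => (hasDerivAt_pathAbscissa hT).hasDerivWithinAt
  have hi := (MeasureTheory.integrableOn_image_iff_integrableOn_abs_deriv_smul measurableSet_Ioi hd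
    strictMonoOn_pathAbscissa.injOn w).1 hint.integrableOn
  have hv := MeasureTheory.integral_image_eq_integral_abs_deriv_smul measurableSet_Ioi hd
    strictMonoOn_pathAbscissa.injOn w
  have hle : ∀ T ∈ Set.Ioi (-1 / 3 : ℝ), w (pathAbscissa T) * ‖deriv pathCurve T‖ ≤
      3 * (|(3 * T ^ 2 + 3 * T + 1) / (pathRatio T * (3 * T + 1) ^ 2)| • w (pathAbscissa T)) := by
    intro T hT
    have h1 := half_le_deriv_pathAbscissa hT
    rw [abs_of_pos (by linarith), smul_eq_mul]
    have := mul_le_mul_of_nonneg_left (norm_deriv_pathCurve_le hT) (h0 (pathAbscissa T))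
    linarith
  have hi' : MeasureTheory.IntegrableOn (fun T => w (pathAbscissa T) * ‖deriv pathCurve T‖)
      (Set.Ioi (-1 / 3)) := by
    refine MeasureTheory.Integrable.mono' (hi.const_mul 3) ?_ ?_
    · exact ((hw.measurable.comp measurable_pathAbscissa).mul
        (measurable_deriv pathCurve).norm).aestronglyMeasurable
    · rw [MeasureTheory.ae_restrict_iff' measurableSet_Ioi]
      refine Filter.Eventually.of_forall fun T hT => ?_
      rw [Real.norm_of_nonneg (mul_nonneg (h0 _) (norm_nonneg _))]
      exact hle T hT
  refine ⟨hi', ?_⟩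
  calc _ ≤ ∫ T in Set.Ioi (-1 / 3 : ℝ), 3 *
        (|(3 * T ^ 2 + 3 * T + 1) / (pathRatio T * (3 * T + 1) ^ 2)| • w (pathAbscissa T)) :=
        MeasureTheory.setIntegral_mono_on hi' (hi.const_mul 3) measurableSet_Ioi hle
    _ = 3 * ∫ X in pathAbscissa '' Set.Ioi (-1 / 3), w X := by
        rw [MeasureTheory.integral_const_mul, hv]
    _ ≤ 3 * ∫ X, w X := by
        gcongr
        exacts [Filter.Eventually.of_forall h0, MeasureTheory.Measure.restrict_le_self]

/-- The weight majorising the model integrand. -/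
noncomputable def cubicWeight (μ X : ℝ) : ℝ := Real.exp (-(μ * (X ^ 2 * (1 + |X|))))

theorem continuous_cubicWeight (μ : ℝ) : Continuous (cubicWeight μ) := by
  unfold cubicWeight
  fun_prop

theorem cubicWeight_nonneg (μ X : ℝ) : 0 ≤ cubicWeight μ X := (Real.exp_pos _).le

theorem integrable_cubicWeight {μ : ℝ} (hμ : 0 < μ) : MeasureTheory.Integrable (cubicWeight μ) := by
  refine (integrable_exp_neg_mul_sq hμ).mono' (continuous_cubicWeight μ).aestronglyMeasurable
    (Filter.Eventually.of_forall fun X => ?_)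
  rw [Real.norm_of_nonneg (cubicWeight_nonneg μ X), cubicWeight]
  have : 0 ≤ μ * (X ^ 2 * |X|) := by positivity
  gcongr
  linarith

/-- The half-line integral that bounds the model integral from below. -/
noncomputable def cubicMass (μ : ℝ) : ℝ := ∫ T in Set.Ioi (0 : ℝ), cubicWeight μ T

/-- Evenness gives a factor 2 and the dilation X ↦ 10X a factor 10; the dilated exponent beats the
target since 10²/12 > 8. Thus the error majorant and the lower bound of the model are comparable
uniformly in μ, although the weight is not homogeneous. -/
theorem integral_cubicWeight_le {μ : ℝ} (hμ : 0 < μ) :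
    ∫ X, cubicWeight (μ / 12) X ≤ 20 * cubicMass (8 * μ) := by
  have h1 : ∫ X, cubicWeight (μ / 12) X = 2 * ∫ X in Set.Ioi (0 : ℝ), cubicWeight (μ / 12) X := by
    rw [← integral_comp_abs]
    refine MeasureTheory.integral_congr_ae (Filter.Eventually.of_forall fun X => ?_)
    simp [cubicWeight]
  have h2 := MeasureTheory.integral_comp_mul_left_Ioi (cubicWeight (μ / 12)) 0
    (by norm_num : (0 : ℝ) < 10)
  rw [mul_zero, smul_eq_mul, eq_inv_mul_iff_mul_eq₀ (by norm_num)] at h2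
  rw [h1, ← h2, cubicMass]
  have h3 : ∫ X in Set.Ioi (0 : ℝ), cubicWeight (μ / 12) (10 * X) ≤
      ∫ X in Set.Ioi (0 : ℝ), cubicWeight (8 * μ) X := by
    refine MeasureTheory.setIntegral_mono_on ?_ (integrable_cubicWeight (by positivity)).integrableOn
      measurableSet_Ioi fun X hX => ?_
    · exact ((integrable_cubicWeight (by positivity)).comp_mul_left' (by norm_num)).integrableOn
    · have hX' : 0 < X := hX
      unfold cubicWeight
      rw [abs_of_pos hX', abs_of_pos (by positivity)]
      refine Real.exp_le_exp.2 (neg_le_neg ?_)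
      have : 0 ≤ μ * X ^ 2 := by positivity
      have : 0 ≤ μ * X ^ 2 * X := by positivity
      nlinarith
  linarith

section
variable {μ : ℝ}

theorem exp_neg_mul_pathExponent_le (hμ : 0 < μ) {T : ℝ} (hT : -1 / 3 < T) :
    Real.exp (-(μ * pathExponent T)) ≤ cubicWeight (μ / 3) (pathAbscissa T) := by
  rw [cubicWeight]
  have := mul_le_mul_of_nonneg_left (sq_mul_le_pathExponent hT) hμ.le
  refine Real.exp_le_exp.2 (neg_le_neg ?_)
  linarith

theorem integrableOn_model (hμ : 0 < μ) : MeasureTheory.IntegrableOn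
    (fun T => (Real.exp (-(μ * pathExponent T)) : ℂ) * deriv pathCurve T) (Set.Ioi (-1 / 3)) := by
  have h := integrableOn_comp_pathAbscissa (continuous_cubicWeight (μ / 3))
    (integrable_cubicWeight (by positivity)) (cubicWeight_nonneg _)
  refine h.1.mono' ?_ ?_
  · have h1 : Measurable fun T => Real.exp (-(μ * pathExponent T)) :=
      (measurable_pathExponent.const_mul μ).neg.exp
    exact (Complex.measurable_ofReal.comp h1 |>.mul
      (measurable_deriv pathCurve)).aestronglyMeasurable
  · rw [MeasureTheory.ae_restrict_iff' measurableSet_Ioi]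
    refine Filter.Eventually.of_forall fun T hT => ?_
    rw [norm_mul, Complex.norm_real, Real.norm_of_nonneg (Real.exp_pos _).le]
    gcongr
    exact exp_neg_mul_pathExponent_le hμ hT

/-- Im U' = 1, so the imaginary part of the model integral is the integral of a positive function
and no cancellation can occur; it is then restricted to T > 0, where F ≤ 8T²(1+T). -/
theorem cubicMass_le_norm_integral (hμ : 0 < μ) : cubicMass (8 * μ) ≤
    ‖∫ T in Set.Ioi (-1 / 3 : ℝ), (Real.exp (-(μ * pathExponent T)) : ℂ) * deriv pathCurve T‖ := by
  have hint := integrableOn_model hμ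
  have him : (∫ T in Set.Ioi (-1 / 3 : ℝ),
      (Real.exp (-(μ * pathExponent T)) : ℂ) * deriv pathCurve T).im =
      ∫ T in Set.Ioi (-1 / 3 : ℝ), Real.exp (-(μ * pathExponent T)) := by
    rw [← Complex.imCLM_apply, ← ContinuousLinearMap.integral_comp_comm _ hint]
    refine MeasureTheory.setIntegral_congr_fun measurableSet_Ioi fun T hT => ?_
    simp only [Complex.imCLM_apply, Complex.im_ofReal_mul, deriv_pathCurve_im hT, mul_one]
  have hintr : MeasureTheory.IntegrableOn (fun T => Real.exp (-(μ * pathExponent T)))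
      (Set.Ioi (-1 / 3)) := by
    refine MeasureTheory.Integrable.congr (Complex.imCLM.integrable_comp hint) ?_
    rw [Filter.EventuallyEq, MeasureTheory.ae_restrict_iff' measurableSet_Ioi]
    refine Filter.Eventually.of_forall fun T hT => ?_
    simp only [Complex.imCLM_apply, Complex.im_ofReal_mul, deriv_pathCurve_im hT, mul_one]
  have hsub : Set.Ioi (0 : ℝ) ⊆ Set.Ioi (-1 / 3) := Set.Ioi_subset_Ioi (by norm_num)
  calc cubicMass (8 * μ) ≤ ∫ T in Set.Ioi (0 : ℝ), Real.exp (-(μ * pathExponent T)) := by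
        refine MeasureTheory.setIntegral_mono_on
          (integrable_cubicWeight (by positivity)).integrableOn (hintr.mono_set hsub)
          measurableSet_Ioi fun T hT => ?_
        have hT' : 0 < T := hT
        rw [cubicWeight, abs_of_pos hT']
        have := mul_le_mul_of_nonneg_left (pathExponent_le hT'.le) hμ.le
        refine Real.exp_le_exp.2 (neg_le_neg ?_)
        linarith
    _ ≤ ∫ T in Set.Ioi (-1 / 3 : ℝ), Real.exp (-(μ * pathExponent T)) :=
        MeasureTheory.setIntegral_mono_set hintr
          (Filter.Eventually.of_forall fun T => (Real.exp_pos _).le)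
          (Filter.Eventually.of_forall hsub)
    _ ≤ _ := by
        rw [← him]
        exact Complex.im_le_norm _

end

/-- On 0 < κT ≤ τ^(-1/2) the exponent is at most 4 + 16/3 < 10. The model integral is therefore not
too small for the end contributions to be negligible against it. -/
theorem rpow_le_cubicMass {τ β γ κ μ : ℝ} (hτ : 1 ≤ τ) (hβ : β ≤ 1) (hγ : γ ≤ 2) (hκ : 0 < κ)
    (hμ : 0 < μ) (h2 : 2 * μ = τ * β * κ ^ 2) (h3 : 3 * μ = τ * γ * κ ^ 3) :
    Real.exp (-10) * τ ^ (-(1 / 2) : ℝ) ≤ κ * cubicMass (8 * μ) := by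
  have hτ0 : 0 < τ := by linarith
  set s : ℝ := τ ^ (-(1 / 2) : ℝ) with hs
  have hs0 : 0 < s := Real.rpow_pos_of_pos hτ0 _
  have hs1 : s ≤ 1 := Real.rpow_le_one_of_one_le_of_nonpos hτ (by norm_num)
  have hs2 : s ^ 2 * τ = 1 := by
    rw [hs, ← Real.rpow_natCast, ← Real.rpow_mul hτ0.le]
    norm_num
    rw [Real.rpow_neg_one, inv_mul_cancel₀ hτ0.ne']
  have hsub : Set.Ioc 0 (s / κ) ⊆ Set.Ioi 0 := Set.Ioc_subset_Ioi_self
  have hint : MeasureTheory.IntegrableOn (cubicWeight (8 * μ)) (Set.Ioi 0) :=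
    (integrable_cubicWeight (by positivity)).integrableOn
  have hlow : ∀ T ∈ Set.Ioc 0 (s / κ), Real.exp (-10) ≤ cubicWeight (8 * μ) T := by
    intro T hT
    rw [cubicWeight, abs_of_pos hT.1]
    have hTs : κ * T ≤ s := by
      have := hT.2
      rw [le_div_iff₀ hκ] at this
      linarith
    have hκT : 0 ≤ κ * T := mul_nonneg hκ.le hT.1.le
    have hq : (κ * T) ^ 2 ≤ s ^ 2 := pow_le_pow_left₀ hκT hTs 2
    have hc : (κ * T) ^ 3 ≤ s ^ 2 := by
      calc (κ * T) ^ 3 = (κ * T) ^ 2 * (κ * T) := by ring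
        _ ≤ s ^ 2 * 1 := by
          gcongr
          linarith
        _ = s ^ 2 := mul_one _
    have e : 8 * μ * (T ^ 2 * (1 + T)) =
        4 * (β * (τ * (κ * T) ^ 2)) + 8 / 3 * (γ * (τ * (κ * T) ^ 3)) := by
      linear_combination 4 * T ^ 2 * h2 + 8 / 3 * T ^ 3 * h3
    have b1 : β * (τ * (κ * T) ^ 2) ≤ 1 := by
      have h1 : τ * (κ * T) ^ 2 ≤ 1 := by nlinarith
      have h0 : 0 ≤ τ * (κ * T) ^ 2 := by positivity
      nlinarith
    have b2 : γ * (τ * (κ * T) ^ 3) ≤ 2 := by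
      have h1 : τ * (κ * T) ^ 3 ≤ 1 := by nlinarith
      have h0 : 0 ≤ τ * (κ * T) ^ 3 := by positivity
      nlinarith
    rw [e]
    gcongr
    linarith
  have hm : Real.exp (-10) * (s / κ) ≤ cubicMass (8 * μ) := by
    calc Real.exp (-10) * (s / κ) = ∫ T in Set.Ioc 0 (s / κ), Real.exp (-10) := by
          rw [MeasureTheory.setIntegral_const, smul_eq_mul, Real.volume_real_Ioc_of_le (by positivity),
            sub_zero, mul_comm]
      _ ≤ ∫ T in Set.Ioc 0 (s / κ), cubicWeight (8 * μ) T :=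
          MeasureTheory.setIntegral_mono_on (by simp) (hint.mono_set hsub) measurableSet_Ioc hlow
      _ ≤ _ := MeasureTheory.setIntegral_mono_set hint
          (Filter.Eventually.of_forall (cubicWeight_nonneg _)) (Filter.Eventually.of_forall hsub)
  calc Real.exp (-10) * s = κ * (Real.exp (-10) * (s / κ)) := by field_simp
    _ ≤ _ := by gcongr

/-- With v = τ^(-1/3) Y both terms are τ^(-1/3) times a polynomial in Y, which exp(Y³/72) absorbs.
The size of the constant is dictated by 16 · 2 · 72² = 165888. -/
theorem add_pow_four_le_exp {τ v : ℝ} (hτ : 0 < τ) (hv : 0 ≤ v) :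
    2 * v + 16 * (τ * v ^ 4) ≤ 170000 * τ ^ (-(1 / 3) : ℝ) * Real.exp (τ * v ^ 3 / 72) := by
  set r : ℝ := τ ^ (-(1 / 3) : ℝ) with hr
  have hr0 : 0 < r := Real.rpow_pos_of_pos hτ _
  have hr3 : r ^ 3 * τ = 1 := by
    rw [hr, ← Real.rpow_natCast, ← Real.rpow_mul hτ.le]
    norm_num
    rw [Real.rpow_neg_one, inv_mul_cancel₀ hτ.ne']
  obtain ⟨Y, hY⟩ : ∃ Y, v = r * Y := ⟨v / r, by field_simp⟩
  have hY0 : 0 ≤ Y := by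
    rw [hY] at hv
    exact nonneg_of_mul_nonneg_right hv hr0
  have e3 : τ * v ^ 3 = Y ^ 3 := by rw [hY]; linear_combination Y ^ 3 * hr3
  have e4 : τ * v ^ 4 = r * Y ^ 4 := by rw [hY]; linear_combination r * Y ^ 4 * hr3
  rw [e3, e4, hY]
  have hY3 : 0 ≤ Y ^ 3 := by positivity
  have q := Real.quadratic_le_exp_of_nonneg (x := Y ^ 3 / 72) (by positivity)
  have y1 : Y ≤ 1 + Y ^ 3 := by
    rcases le_total Y 1 with h | h
    · linarith
    · linarith [le_self_pow₀ h (by norm_num : (3 : ℕ) ≠ 0)]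
  have y4 : Y ^ 4 ≤ 1 + (Y ^ 3) ^ 2 := by
    rcases le_total Y 1 with h | h
    · have : Y ^ 4 ≤ 1 := pow_le_one₀ hY0 h
      nlinarith
    · have : Y ^ 4 ≤ Y ^ 6 := pow_le_pow_right₀ h (by norm_num)
      linarith [(by ring : (Y ^ 3) ^ 2 = Y ^ 6)]
  have main : 2 * Y + 16 * Y ^ 4 ≤ 170000 * Real.exp (Y ^ 3 / 72) := by nlinarith
  calc 2 * (r * Y) + 16 * (r * Y ^ 4) = r * (2 * Y + 16 * Y ^ 4) := by ring
    _ ≤ r * (170000 * Real.exp (Y ^ 3 / 72)) := by gcongr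
    _ = _ := by ring

/-! ### Local comparison with the model and assembly of the contour. -/

/-- The distance scale `κ` between the two saddle points, in the rotated coordinate. -/
noncomputable def saddleScale (a : ℝ) : ℝ := 3 * quadCoeff a / (2 * cubicCoeff a)

/-- The large parameter `λ` of the cubic model. -/
noncomputable def modelParam (a τ : ℝ) : ℝ := 9 / 8 * (τ * quadCoeff a ^ 3 / cubicCoeff a ^ 2)

section
variable {a τ : ℝ}

theorem saddleScale_pos (h0 : 0 < a) (h1 : a < 1) : 0 < saddleScale a := by
  have := quadCoeff_pos h0 h1
  have := half_le_cubicCoeff h0 h1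
  have : 0 < cubicCoeff a := by linarith
  unfold saddleScale
  positivity

theorem modelParam_pos (h0 : 0 < a) (h1 : a < 1) (hτ : 0 < τ) : 0 < modelParam a τ := by
  have := quadCoeff_pos h0 h1
  have := half_le_cubicCoeff h0 h1
  have : 0 < cubicCoeff a := by linarith
  unfold modelParam
  positivity

theorem two_mul_modelParam (h0 : 0 < a) (h1 : a < 1) :
    2 * modelParam a τ = τ * quadCoeff a * saddleScale a ^ 2 := by
  have := half_le_cubicCoeff h0 h1
  have : 0 < cubicCoeff a := by linarith
  unfold modelParam saddleScale
  field_simp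
  ring

theorem three_mul_modelParam (h0 : 0 < a) (h1 : a < 1) :
    3 * modelParam a τ = τ * cubicCoeff a * saddleScale a ^ 3 := by
  have := half_le_cubicCoeff h0 h1
  have : 0 < cubicCoeff a := by linarith
  unfold modelParam saddleScale
  field_simp
  ring

theorem mul_pow_three_le_modelParam (h0 : 0 < a) (h1 : a < 1) (hτ : 0 < τ) (X : ℝ) :
    τ * (saddleScale a * |X|) ^ 3 ≤ 6 * (modelParam a τ * |X| ^ 3) := by
  have h := three_mul_modelParam (τ := τ) h0 h1
  have hγ := half_le_cubicCoeff h0 h1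
  have hκ := saddleScale_pos h0 h1
  have e : 6 * (modelParam a τ * |X| ^ 3) =
      2 * cubicCoeff a * (τ * (saddleScale a * |X|) ^ 3) := by
    linear_combination 2 * |X| ^ 3 * h
  rw [e]
  have : 0 ≤ τ * (saddleScale a * |X|) ^ 3 := by positivity
  nlinarith

theorem mul_pow_three_le_pathExponent (h0 : 0 < a) (h1 : a < 1) (hτ : 0 < τ) {T : ℝ}
    (hT : -1 / 3 < T) :
    τ * (saddleScale a * |pathAbscissa T|) ^ 3 ≤ 18 * (modelParam a τ * pathExponent T) := by
  have hμ := modelParam_pos h0 h1 hτ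
  have h := mul_pow_three_le_modelParam h0 h1 hτ (pathAbscissa T)
  have h2 := mul_le_mul_of_nonneg_left (sq_mul_le_pathExponent hT) hμ.le
  have e : |pathAbscissa T| ^ 3 = pathAbscissa T ^ 2 * |pathAbscissa T| := by
    rw [pow_succ, sq_abs]
  have : 0 ≤ modelParam a τ * pathAbscissa T ^ 2 := by positivity
  rw [e] at h
  linarith

/-- The elementary bound that turns powers of the distance to the saddle into a power of `τ`. -/
theorem poly_mul_exp_le_weight (h0 : 0 < a) (h1 : a < 1) (hτ : 0 < τ) {T : ℝ} (hT : -1 / 3 < T) :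
    (2 * (saddleScale a * |pathAbscissa T|) + 16 * (τ * (saddleScale a * |pathAbscissa T|) ^ 4)) *
        Real.exp (-(modelParam a τ * pathExponent T / 2)) ≤
      170000 * τ ^ (-(1 / 3) : ℝ) * cubicWeight (modelParam a τ / 12) (pathAbscissa T) := by
  have hμ := modelParam_pos h0 h1 hτ
  have hκ := saddleScale_pos h0 h1
  have hv : 0 ≤ saddleScale a * |pathAbscissa T| := by positivity
  have hp := add_pow_four_le_exp hτ hv
  have h3 := mul_pow_three_le_modelParam h0 h1 hτ (pathAbscissa T)
  have h2 := mul_le_mul_of_nonneg_left (sq_mul_le_pathExponent hT) hμ.le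
  have e : |pathAbscissa T| ^ 3 = pathAbscissa T ^ 2 * |pathAbscissa T| := by
    rw [pow_succ, sq_abs]
  have hr := Real.rpow_pos_of_pos hτ (-(1 / 3) : ℝ)
  calc _ ≤ 170000 * τ ^ (-(1 / 3) : ℝ) *
        Real.exp (τ * (saddleScale a * |pathAbscissa T|) ^ 3 / 72) *
        Real.exp (-(modelParam a τ * pathExponent T / 2)) := by gcongr
    _ = 170000 * τ ^ (-(1 / 3) : ℝ) *
        Real.exp (τ * (saddleScale a * |pathAbscissa T|) ^ 3 / 72 +
          -(modelParam a τ * pathExponent T / 2)) := by rw [mul_assoc, ← Real.exp_add]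
    _ ≤ _ := by
        rw [cubicWeight]
        gcongr
        have : 0 ≤ modelParam a τ * pathAbscissa T ^ 2 := by positivity
        rw [e] at h3
        linarith

end

section
variable {d : ℕ} {a : ℝ} {x : ℂ}

/-- With y = κU the cubic part of the exponent is exactly -μF(T). The first bound feeds the
comparison of integrals; the second gives up half of the exponent and serves at the ends of the
local range. -/
theorem local_estimate (h0 : 0 < a) (h1 : a < 1) (hτ : 0 < x.im)
    (hd : d * (2 * a) = x.im * (1 + a ^ 2)) (hx0 : 0 ≤ x.re) (hx1 : x.re ≤ 1) {T : ℝ}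
    (hT : -1 / 3 < T) (hv : saddleScale a * |pathAbscissa T| ≤ 1 / 2000) :
    ‖(1 + Complex.I * (saddleScale a * pathCurve T)) ^ (x - 1) *
        rotatedSeries d a (1 + Complex.I * (saddleScale a * pathCurve T)) -
        ehrhartSeries d (-Complex.I * a) *
          Real.exp (-(modelParam a x.im * pathExponent T))‖ ≤
      ‖ehrhartSeries d (-Complex.I * a)‖ * (2040000 * x.im ^ (-(1 / 3) : ℝ) *
        cubicWeight (modelParam a x.im / 12) (pathAbscissa T)) ∧
    ‖(1 + Complex.I * (saddleScale a * pathCurve T)) ^ (x - 1) *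
        rotatedSeries d a (1 + Complex.I * (saddleScale a * pathCurve T))‖ ≤
      ‖ehrhartSeries d (-Complex.I * a)‖ *
        (3 * Real.exp (-(modelParam a x.im * pathExponent T / 2))) := by
  have hκ := saddleScale_pos h0 h1
  have hμ := modelParam_pos h0 h1 hτ
  set κ : ℝ := saddleScale a with hκd
  set μ : ℝ := modelParam a x.im with hμd
  set v : ℝ := κ * |pathAbscissa T| with hvd
  set y : ℂ := κ * pathCurve T with hy
  have hv0 : 0 ≤ v := by positivity
  have hyn : ‖y‖ ≤ 2 * v := by
    rw [hy, norm_mul, Complex.norm_real, Real.norm_of_nonneg hκ.le, hvd]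
    nlinarith [norm_pathCurve_le hT]
  obtain ⟨W, hW, hWb⟩ := exists_local_exponent h0 h1 hτ hd rfl hx0 hx1
    (by linarith : ‖y‖ ≤ 1 / 2)
  have hcubic : x.im * (Complex.I * (quadCoeff a / 2) * y ^ 2 + cubicCoeff a / 3 * y ^ 3) =
      -((μ * pathExponent T : ℝ) : ℂ) := by
    have h2 : 2 * (μ : ℂ) = x.im * quadCoeff a * κ ^ 2 := by
      exact_mod_cast two_mul_modelParam h0 h1
    have h3 : 3 * (μ : ℂ) = x.im * cubicCoeff a * κ ^ 3 := by
      exact_mod_cast three_mul_modelParam h0 h1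
    have hp := pathCurve_cubic hT
    rw [hy]
    push_cast
    linear_combination (μ : ℂ) * hp - Complex.I * pathCurve T ^ 2 / 2 * h2 - pathCurve T ^ 3 / 3 * h3
  rw [hcubic, sub_neg_eq_add] at hWb
  have hy4 : ‖y‖ ^ 4 ≤ 16 * v ^ 4 := by
    calc ‖y‖ ^ 4 ≤ (2 * v) ^ 4 := by gcongr
      _ = _ := by ring
  set δ : ℝ := 4 * (2 * v + 16 * (x.im * v ^ 4)) with hδ
  have hWδ : ‖W + ((μ * pathExponent T : ℝ) : ℂ)‖ ≤ δ := by
    refine hWb.trans ?_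
    have := mul_le_mul_of_nonneg_left hy4 hτ.le
    have : 0 ≤ x.im * v ^ 4 := by positivity
    rw [hδ]
    linarith
  -- The radius 1/2000 makes the quartic error at most 32 · 18/2000 < 1/2 of μF.
  have hWh : ‖W + ((μ * pathExponent T : ℝ) : ℂ)‖ ≤ μ * pathExponent T / 2 + 1 := by
    refine hWb.trans ?_
    have b1 := mul_le_mul_of_nonneg_left hy4 hτ.le
    have b2 := mul_pow_three_le_pathExponent h0 h1 hτ hT
    have b3 : x.im * v ^ 4 ≤ 1 / 2000 * (x.im * v ^ 3) := by
      have : 0 ≤ x.im * v ^ 3 := by positivity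
      nlinarith
    have : 0 ≤ x.im * v ^ 3 := by positivity
    linarith
  have hF0 := mul_nonneg hμ.le (pathExponent_nonneg hT)
  have he3 : Real.exp 1 ≤ 3 := Real.exp_one_lt_three.le
  have hexpW : Complex.exp W = Complex.exp (W + ((μ * pathExponent T : ℝ) : ℂ)) *
      Real.exp (-(μ * pathExponent T)) := by
    rw [Complex.ofReal_exp, ← Complex.exp_add]
    congr 1
    push_cast
    ring
  have hprod : Real.exp (μ * pathExponent T / 2 + 1) * Real.exp (-(μ * pathExponent T)) ≤
      3 * Real.exp (-(μ * pathExponent T / 2)) := by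
    rw [add_comm, Real.exp_add, mul_assoc, ← Real.exp_add]
    have e : μ * pathExponent T / 2 + -(μ * pathExponent T) = -(μ * pathExponent T / 2) := by ring
    rw [e]
    gcongr
  have hf : rotatedSeries d a (1 + Complex.I * y) =
      ehrhartSeries d (-Complex.I * a * (1 + Complex.I * y)) := rfl
  rw [hf, hW]
  constructor
  · rw [← mul_sub, norm_mul, hexpW, ← sub_one_mul, norm_mul, Complex.norm_real,
      Real.norm_of_nonneg (Real.exp_pos _).le]
    -- In |e^w - 1| ≤ |w| e^|w| the prefactor uses the sharp bound δ and the exponential only the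
    -- crude bound μF/2 + 1.
    have hsub : ‖Complex.exp (W + ((μ * pathExponent T : ℝ) : ℂ)) - 1‖ ≤
        δ * Real.exp (μ * pathExponent T / 2 + 1) := by
      have h := Complex.norm_exp_sub_sum_le_norm_mul_exp (W + ((μ * pathExponent T : ℝ) : ℂ)) 1
      simp only [Finset.range_one, Finset.sum_singleton, pow_zero, Nat.factorial_zero,
        Nat.cast_one, div_one, pow_one] at h
      refine h.trans ?_
      gcongr
    have hδ0 : 0 ≤ δ := (norm_nonneg _).trans hWδ
    have hw := poly_mul_exp_le_weight h0 h1 hτ hT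
    refine mul_le_mul_of_nonneg_left ?_ (norm_nonneg _)
    calc _ ≤ δ * Real.exp (μ * pathExponent T / 2 + 1) * Real.exp (-(μ * pathExponent T)) := by
          gcongr
      _ ≤ δ * (3 * Real.exp (-(μ * pathExponent T / 2))) := by
          rw [mul_assoc]
          gcongr
      _ = 12 * ((2 * v + 16 * (x.im * v ^ 4)) * Real.exp (-(μ * pathExponent T / 2))) := by
          rw [hδ]
          ring
      _ ≤ 12 * (170000 * x.im ^ (-(1 / 3) : ℝ) * cubicWeight (μ / 12) (pathAbscissa T)) :=
          mul_le_mul_of_nonneg_left hw (by norm_num)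
      _ = _ := by ring
  · rw [norm_mul, hexpW, norm_mul, Complex.norm_real, Real.norm_of_nonneg (Real.exp_pos _).le]
    refine mul_le_mul_of_nonneg_left ?_ (norm_nonneg _)
    have : ‖Complex.exp (W + ((μ * pathExponent T : ℝ) : ℂ))‖ ≤
        Real.exp (μ * pathExponent T / 2 + 1) :=
      (Complex.norm_exp_le_exp_norm _).trans (Real.exp_le_exp.2 hWh)
    calc _ ≤ Real.exp (μ * pathExponent T / 2 + 1) * Real.exp (-(μ * pathExponent T)) := by gcongr
      _ ≤ _ := hprod

end

/-- The steepest-descent curve of the cubic model, in the rotated coordinate. -/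
noncomputable def saddlePath (a T : ℝ) : ℂ := 1 + Complex.I * (saddleScale a * pathCurve T)

/-- The model integral. -/
noncomputable def modelIntegral (μ : ℝ) : ℂ :=
  ∫ T in Set.Ioi (-1 / 3 : ℝ), (Real.exp (-(μ * pathExponent T)) : ℂ) * deriv pathCurve T

theorem continuousOn_deriv_pathCurve : ContinuousOn (deriv pathCurve) (Set.Ioi (-1 / 3)) := by
  have h : ContinuousOn (fun T : ℝ =>
      (((3 * T ^ 2 + 3 * T + 1) / (pathRatio T * (3 * T + 1) ^ 2) : ℝ) + Complex.I : ℂ))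
      (Set.Ioi (-1 / 3)) := by
    have hr : ContinuousOn pathRatio (Set.Ioi (-1 / 3)) := by
      unfold pathRatio
      refine ContinuousOn.sqrt (ContinuousOn.div (by fun_prop) (by fun_prop) fun T hT => ?_)
      have : -1 / 3 < T := hT
      linarith
    refine (Complex.continuous_ofReal.comp_continuousOn (ContinuousOn.div (by fun_prop)
      (hr.mul (by fun_prop)) fun T hT => ?_)).add continuousOn_const
    have hT' : -1 / 3 < T := hT
    have h1 := pathRatio_pos hT'
    have h2 : 0 < 3 * T + 1 := by linarith
    exact (mul_pos h1 (pow_pos h2 2)).ne'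
  exact h.congr fun T hT => (hasDerivAt_pathCurve hT).deriv

section
variable {a : ℝ}

theorem saddlePath_re (a T : ℝ) : (saddlePath a T).re = 1 - saddleScale a * T := by
  simp [saddlePath, pathCurve_eq]
  ring

theorem saddlePath_im (a T : ℝ) : (saddlePath a T).im = saddleScale a * pathAbscissa T := by
  simp [saddlePath, pathCurve_eq]

theorem hasDerivAt_saddlePath {T : ℝ} (hT : -1 / 3 < T) :
    HasDerivAt (saddlePath a) (Complex.I * (saddleScale a * deriv pathCurve T)) T := by
  have h := (hasDerivAt_pathCurve hT).differentiableAt.hasDerivAt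
  exact ((h.const_mul (saddleScale a : ℂ)).const_mul Complex.I).const_add 1

theorem abs_sub_one_saddlePath_le (h0 : 0 < a) (h1 : a < 1) {T : ℝ} (hT : -1 / 3 < T)
    (hv : saddleScale a * |pathAbscissa T| ≤ 1 / 2000) : ‖saddlePath a T - 1‖ ≤ 1 / 1000 := by
  have hκ := saddleScale_pos h0 h1
  rw [saddlePath, add_sub_cancel_left, norm_mul, Complex.norm_I, one_mul, norm_mul,
    Complex.norm_real, Real.norm_of_nonneg hκ.le]
  nlinarith [norm_pathCurve_le hT]

theorem saddlePath_mem (h0 : 0 < a) (h1 : a < 1) {T : ℝ} (hT : -1 / 3 < T)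
    (hv : saddleScale a * |pathAbscissa T| ≤ 1 / 2000) :
    saddlePath a T ∈ Complex.slitPlane ∧
      1 - -Complex.I * a * saddlePath a T ∈ Complex.slitPlane := by
  have h := abs_sub_one_saddlePath_le h0 h1 hT hv
  constructor
  · left
    have := (abs_le.1 ((Complex.abs_re_le_norm (saddlePath a T - 1)).trans h)).1
    rw [Complex.sub_re, Complex.one_re] at this
    linarith
  · left
    have := (abs_le.1 ((Complex.abs_im_le_norm (saddlePath a T - 1)).trans h)).2
    rw [Complex.sub_im, Complex.one_im, sub_zero] at this
    rw [Complex.sub_re, re_rotate, Complex.one_re]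
    nlinarith

theorem continuousOn_saddlePath_integrand (d : ℕ) (h0 : 0 < a) (h1 : a < 1) (x : ℂ) {s : Set ℝ}
    (hs : ∀ T ∈ s, -1 / 3 < T ∧ saddleScale a * |pathAbscissa T| ≤ 1 / 2000) :
    ContinuousOn (fun T => saddlePath a T ^ (x - 1) * rotatedSeries d a (saddlePath a T) *
      (Complex.I * (saddleScale a * deriv pathCurve T))) s := by
  have hp : ContinuousOn (saddlePath a) s := fun T hT =>
    (hasDerivAt_saddlePath (hs T hT).1).continuousAt.continuousWithinAt
  have hU : ContinuousOn (deriv pathCurve) s :=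
    continuousOn_deriv_pathCurve.mono fun T hT => (hs T hT).1
  refine ContinuousOn.mul (ContinuousOn.mul ?_ ?_) (by fun_prop)
  · exact hp.cpow_const fun T hT => (saddlePath_mem h0 h1 (hs T hT).1 (hs T hT).2).1
  · unfold rotatedSeries ehrhartSeries
    refine ContinuousOn.div (by fun_prop) (by fun_prop) fun T hT => pow_ne_zero _ ?_
    exact Complex.slitPlane_ne_zero (saddlePath_mem h0 h1 (hs T hT).1 (hs T hT).2).2

end

theorem inv_le_rpow_mul_cubicMass {a τ : ℝ} (h0 : 0 < a) (h1 : a < 1) (hτ : 1 ≤ τ) :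
    τ⁻¹ ≤ Real.exp 10 * (τ ^ (-(1 / 3) : ℝ) *
      (saddleScale a * cubicMass (8 * modelParam a τ))) := by
  have hτ0 : 0 < τ := by linarith
  have h := rpow_le_cubicMass hτ (quadCoeff_le_one a) (cubicCoeff_le_two a) (saddleScale_pos h0 h1)
    (modelParam_pos h0 h1 hτ0) (two_mul_modelParam h0 h1) (three_mul_modelParam h0 h1)
  have hr := Real.rpow_pos_of_pos hτ0 (-(1 / 3) : ℝ)
  have e : τ⁻¹ ≤ τ ^ (-(1 / 3) : ℝ) * τ ^ (-(1 / 2) : ℝ) := by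
    rw [← Real.rpow_add hτ0, ← Real.rpow_neg_one]
    exact Real.rpow_le_rpow_of_exponent_le hτ (by norm_num)
  have he : Real.exp 10 * Real.exp (-10) = 1 := by rw [← Real.exp_add]; simp
  calc τ⁻¹ ≤ τ ^ (-(1 / 3) : ℝ) * τ ^ (-(1 / 2) : ℝ) := e
    _ = Real.exp 10 * (τ ^ (-(1 / 3) : ℝ) * (Real.exp (-10) * τ ^ (-(1 / 2) : ℝ))) := by
      linear_combination (-(τ ^ (-(1 / 3) : ℝ) * τ ^ (-(1 / 2) : ℝ))) * he
    _ ≤ _ := by gcongr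

/-- Beyond the local range the model integrand is majorised by the same weight. -/
theorem tail_estimate {a τ : ℝ} (h0 : 0 < a) (h1 : a < 1) (hτ : 0 < τ) {T : ℝ} (hT : -1 / 3 < T)
    (hv : 1 / 4000 ≤ saddleScale a * |pathAbscissa T|) :
    Real.exp (-(modelParam a τ * pathExponent T)) ≤ 340000000 * τ ^ (-(1 / 3) : ℝ) *
      cubicWeight (modelParam a τ / 12) (pathAbscissa T) := by
  have hμ := modelParam_pos h0 h1 hτ
  have hF0 := mul_nonneg hμ.le (pathExponent_nonneg hT)
  have h := poly_mul_exp_le_weight h0 h1 hτ hT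
  have hE : Real.exp (-(modelParam a τ * pathExponent T)) ≤
      Real.exp (-(modelParam a τ * pathExponent T / 2)) := by
    gcongr
    linarith
  have hE0 := Real.exp_pos (-(modelParam a τ * pathExponent T / 2))
  have h4 : 0 ≤ 16 * (τ * (saddleScale a * |pathAbscissa T|) ^ 4) := by positivity
  -- Away from the saddle 2v ≥ 1/2000, so 1 is at most 2000 times the polynomial and the same
  -- absorption yields the factor τ^(-1/3).
  have : 1 * Real.exp (-(modelParam a τ * pathExponent T / 2)) ≤
      2000 * ((2 * (saddleScale a * |pathAbscissa T|) +
        16 * (τ * (saddleScale a * |pathAbscissa T|) ^ 4)) *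
        Real.exp (-(modelParam a τ * pathExponent T / 2))) := by
    rw [← mul_assoc]
    gcongr
    linarith
  linarith

/-- The value of the integrand at the ends of the local range is negligible. -/
theorem endpoint_estimate {d : ℕ} {a : ℝ} {x : ℂ} (h0 : 0 < a) (h1 : a < 1) (hτ : 1 ≤ x.im)
    (hd : d * (2 * a) = x.im * (1 + a ^ 2)) (hx0 : 0 ≤ x.re) (hx1 : x.re ≤ 1) {T : ℝ}
    (hT : -1 / 3 < T) (hv : saddleScale a * |pathAbscissa T| ≤ 1 / 2000)
    (hv' : 1 / 4000 ≤ saddleScale a * |pathAbscissa T|) :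
    ‖saddlePath a T ^ (x - 1) * rotatedSeries d a (saddlePath a T)‖ ≤
      108 * 4000 ^ 3 * Real.exp 10 * (x.im ^ (-(1 / 3) : ℝ) * (‖ehrhartSeries d (-Complex.I * a)‖ *
        (saddleScale a * cubicMass (8 * modelParam a x.im)))) := by
  have hτ0 : 0 < x.im := by linarith
  refine ((local_estimate h0 h1 hτ0 hd hx0 hx1 hT hv).2).trans ?_
  have h := mul_pow_three_le_pathExponent h0 h1 hτ0 hT
  have hc : x.im * (1 / 4000) ^ 3 ≤ 18 * (modelParam a x.im * pathExponent T) := by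
    refine le_trans ?_ h
    gcongr
  have hexp : 3 * Real.exp (-(modelParam a x.im * pathExponent T / 2)) ≤
      108 * 4000 ^ 3 * x.im⁻¹ := by
    have h1 : Real.exp (-(modelParam a x.im * pathExponent T / 2)) ≤
        (x.im / (36 * 4000 ^ 3))⁻¹ := by
      rw [Real.exp_neg]
      apply inv_anti₀ (by positivity)
      have := Real.add_one_le_exp (modelParam a x.im * pathExponent T / 2)
      have e : x.im / (36 * 4000 ^ 3) = x.im * (1 / 4000) ^ 3 / 36 := by ring
      rw [e]
      linarith
    rw [inv_div] at h1
    calc _ ≤ 3 * (36 * 4000 ^ 3 / x.im) := by gcongr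
      _ = _ := by ring
  have hm := inv_le_rpow_mul_cubicMass h0 h1 hτ
  calc _ ≤ ‖ehrhartSeries d (-Complex.I * a)‖ * (108 * 4000 ^ 3 * (Real.exp 10 *
        (x.im ^ (-(1 / 3) : ℝ) * (saddleScale a * cubicMass (8 * modelParam a x.im))))) := by
        refine mul_le_mul_of_nonneg_left (hexp.trans ?_) (norm_nonneg _)
        exact mul_le_mul_of_nonneg_left hm (by positivity)
    _ = _ := by ring

/-- Comparison of the exact integral along the local part of the path with the model integral. -/
theorem norm_local_integral_sub_model_le {d : ℕ} {a : ℝ} {x : ℂ} (h0 : 0 < a) (h1 : a < 1)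
    (hτ : 0 < x.im) (hd : d * (2 * a) = x.im * (1 + a ^ 2)) (hx0 : 0 ≤ x.re) (hx1 : x.re ≤ 1)
    {T₁ T₂ : ℝ} (hT₁ : -1 / 3 < T₁)
    (hin : ∀ T ∈ Set.Icc T₁ T₂, saddleScale a * |pathAbscissa T| ≤ 1 / 2000)
    (hout : ∀ T, -1 / 3 < T → T ∉ Set.Ioc T₁ T₂ → 1 / 4000 ≤ saddleScale a * |pathAbscissa T|) :
    ‖(∫ T in Set.Ioc T₁ T₂, saddlePath a T ^ (x - 1) * rotatedSeries d a (saddlePath a T) *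
        (Complex.I * (saddleScale a * deriv pathCurve T))) -
      ehrhartSeries d (-Complex.I * a) * (Complex.I * (saddleScale a *
        modelIntegral (modelParam a x.im)))‖ ≤
      60 * 340000000 * (x.im ^ (-(1 / 3) : ℝ) * (‖ehrhartSeries d (-Complex.I * a)‖ *
        (saddleScale a * cubicMass (8 * modelParam a x.im)))) := by
  have hκ := saddleScale_pos h0 h1
  have hμ := modelParam_pos h0 h1 hτ
  set κ : ℝ := saddleScale a with hκd
  set μ : ℝ := modelParam a x.im with hμd
  set E : ℂ := ehrhartSeries d (-Complex.I * a) with hE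
  set r : ℝ := x.im ^ (-(1 / 3) : ℝ) with hr
  have hr0 : 0 < r := Real.rpow_pos_of_pos hτ _
  set G : ℝ → ℂ := fun T => saddlePath a T ^ (x - 1) * rotatedSeries d a (saddlePath a T) *
        (Complex.I * (κ * deriv pathCurve T)) with hG
  have hsub : Set.Ioc T₁ T₂ ⊆ Set.Ioi (-1 / 3) := fun T hT => hT₁.trans hT.1
  have hGc : ContinuousOn G (Set.Icc T₁ T₂) := continuousOn_saddlePath_integrand d h0 h1 x
    fun T hT => ⟨hT₁.trans_le hT.1, hin T hT⟩
  have hGi : MeasureTheory.IntegrableOn G (Set.Ioc T₁ T₂) :=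
    hGc.integrableOn_Icc.mono_set Set.Ioc_subset_Icc_self
  have hGint : MeasureTheory.IntegrableOn ((Set.Ioc T₁ T₂).indicator G) (Set.Ioi (-1 / 3)) :=
    (hGi.integrable_indicator measurableSet_Ioc).integrableOn
  have hMi := integrableOn_model hμ
  have e1 : (∫ T in Set.Ioc T₁ T₂, G T) - E * (Complex.I * (κ * modelIntegral μ)) =
      ∫ T in Set.Ioi (-1 / 3 : ℝ), ((Set.Ioc T₁ T₂).indicator G T - E * (Complex.I * κ) *
        ((Real.exp (-(μ * pathExponent T)) : ℂ) * deriv pathCurve T)) := by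
    rw [MeasureTheory.integral_sub hGint (hMi.const_mul _), MeasureTheory.integral_const_mul,
      MeasureTheory.setIntegral_indicator measurableSet_Ioc, Set.inter_eq_right.2 hsub,
      modelIntegral]
    ring
  have hw := integrableOn_comp_pathAbscissa (continuous_cubicWeight (μ / 12))
    (integrable_cubicWeight (by positivity)) (cubicWeight_nonneg _)
  have hEκ : ‖E * (Complex.I * (κ : ℂ))‖ = ‖E‖ * κ := by
    rw [norm_mul, norm_mul, Complex.norm_I, one_mul, Complex.norm_real, Real.norm_of_nonneg hκ.le]
  have hbound : ∀ T ∈ Set.Ioi (-1 / 3 : ℝ), ‖(Set.Ioc T₁ T₂).indicator G T - E * (Complex.I * κ) *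
        ((Real.exp (-(μ * pathExponent T)) : ℂ) * deriv pathCurve T)‖ ≤
      340000000 * (r * (‖E‖ * κ)) *
        (cubicWeight (μ / 12) (pathAbscissa T) * ‖deriv pathCurve T‖) := by
    intro T hT
    have hwn := cubicWeight_nonneg (μ / 12) (pathAbscissa T)
    by_cases hmem : T ∈ Set.Ioc T₁ T₂
    · rw [Set.indicator_of_mem hmem]
      have hle := (local_estimate h0 h1 hτ hd hx0 hx1 hT (hin T ⟨hmem.1.le, hmem.2⟩)).1
      have e : G T - E * (Complex.I * κ) *
          ((Real.exp (-(μ * pathExponent T)) : ℂ) * deriv pathCurve T) =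
          (saddlePath a T ^ (x - 1) * rotatedSeries d a (saddlePath a T) -
            E * Real.exp (-(μ * pathExponent T))) * (Complex.I * κ) * deriv pathCurve T := by
        rw [hG]
        ring
      rw [e, norm_mul, norm_mul, norm_mul Complex.I, Complex.norm_I, one_mul, Complex.norm_real,
        Real.norm_of_nonneg hκ.le]
      calc _ ≤ (‖E‖ * (2040000 * r * cubicWeight (μ / 12) (pathAbscissa T))) * κ *
            ‖deriv pathCurve T‖ := by
            refine mul_le_mul_of_nonneg_right (mul_le_mul_of_nonneg_right hle hκ.le)
              (norm_nonneg _)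
        _ = 2040000 * (r * (‖E‖ * κ)) *
            (cubicWeight (μ / 12) (pathAbscissa T) * ‖deriv pathCurve T‖) := by ring
        _ ≤ _ := by
            gcongr
            norm_num
    · rw [Set.indicator_of_notMem hmem, zero_sub, norm_neg, norm_mul, hEκ, norm_mul,
        Complex.norm_real, Real.norm_of_nonneg (Real.exp_pos _).le]
      have hle := tail_estimate h0 h1 hτ hT (hout T hT hmem)
      calc _ ≤ ‖E‖ * κ * ((340000000 * r * cubicWeight (μ / 12) (pathAbscissa T)) *
            ‖deriv pathCurve T‖) := by
            refine mul_le_mul_of_nonneg_left (mul_le_mul_of_nonneg_right hle (norm_nonneg _))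
              (by positivity)
        _ = _ := by ring
  rw [e1]
  have hle := MeasureTheory.norm_integral_le_of_norm_le (hw.1.const_mul _)
    ((MeasureTheory.ae_restrict_iff' measurableSet_Ioi).2 (Filter.Eventually.of_forall hbound))
  refine hle.trans ?_
  rw [MeasureTheory.integral_const_mul]
  have hmass := integral_cubicWeight_le hμ
  calc _ ≤ 340000000 * (r * (‖E‖ * κ)) * (3 * (20 * cubicMass (8 * μ))) := by
        refine mul_le_mul_of_nonneg_left (hw.2.trans ?_) (by positivity)
        linarith
    _ = _ := by ring

/-- Existence of the end points of the local range. -/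
theorem exists_local_range {a : ℝ} (h0 : 0 < a) (h1 : a < 1) :
    ∃ T₁ T₂ : ℝ, -1 / 3 < T₁ ∧ T₁ < 0 ∧ 0 < T₂ ∧ saddleScale a * T₂ = 1 / 2000 ∧
      saddleScale a * pathAbscissa T₁ = -(1 / 2000) ∧
      (∀ T ∈ Set.Icc T₁ T₂, saddleScale a * |pathAbscissa T| ≤ 1 / 2000) ∧
      (∀ T, T₂ ≤ T → 1 / 4000 ≤ saddleScale a * |pathAbscissa T|) ∧
      (∀ T, -1 / 3 < T → T ∉ Set.Ioc T₁ T₂ → 1 / 4000 ≤ saddleScale a * |pathAbscissa T|) := by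
  have hκ := saddleScale_pos h0 h1
  set κ : ℝ := saddleScale a with hκd
  -- The left end is fixed by X, since T stays bounded there. The right end is fixed by T, so that
  -- Re z = 1 - κT drops by exactly 1/2000; X remains comparable there because `pathRatio` is at
  -- least 1/2.
  obtain ⟨T₁, hT₁, hX₁⟩ := exists_pathAbscissa_eq_neg (q := 1 / 2000 / κ) (by positivity)
  have hX₁' : κ * pathAbscissa T₁ = -(1 / 2000) := by rw [hX₁]; field_simp
  have hκT₂ : κ * (1 / 2000 / κ) = 1 / 2000 := by field_simp
  have hT₂ : 0 < 1 / 2000 / κ := by positivity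
  set T₂ : ℝ := 1 / 2000 / κ with hT₂d
  have hup : ∀ T, T₂ ≤ T → 1 / 4000 ≤ κ * |pathAbscissa T| := by
    intro T hT
    have hT0 : 0 ≤ T := by linarith
    have hr := one_le_three_mul_pathRatio_sq (T := T) (by linarith)
    have hr0 := pathRatio_pos (T := T) (by linarith)
    have hr1 : 1 / 2 ≤ pathRatio T := by
      by_contra h
      push Not at h
      nlinarith
    rw [pathAbscissa, abs_of_nonneg (by positivity)]
    calc (1 : ℝ) / 4000 = κ * (T₂ * (1 / 2)) := by linarith
      _ ≤ κ * (T * pathRatio T) := by gcongr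
  refine ⟨T₁, T₂, hT₁.1, hT₁.2, hT₂, hκT₂, hX₁', ?_, hup, ?_⟩
  · intro T hT
    have hT' : -1 / 3 < T := hT₁.1.trans_le hT.1
    have hlow := strictMonoOn_pathAbscissa.monotoneOn hT₁.1 hT' hT.1
    have hlow' := mul_le_mul_of_nonneg_left hlow hκ.le
    have hhigh : κ * pathAbscissa T ≤ 1 / 2000 := by
      rw [← hκT₂]
      gcongr
      rcases le_total 0 T with h | h
      · exact (mul_le_of_le_one_right h (pathRatio_le_one h)).trans hT.2
      · exact (mul_nonpos_of_nonpos_of_nonneg h (pathRatio_pos hT').le).trans hT₂.le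
    rw [← abs_of_pos hκ, ← abs_mul, abs_le]
    exact ⟨by linarith, hhigh⟩
  · intro T hT hmem
    rcases le_or_gt T T₁ with h | h
    · have hlow := strictMonoOn_pathAbscissa.monotoneOn hT hT₁.1 h
      have hlow' := mul_le_mul_of_nonneg_left hlow hκ.le
      rw [← abs_of_pos hκ, ← abs_mul]
      have := neg_abs_le (κ * pathAbscissa T)
      linarith
    · refine hup T ?_
      by_contra hlt
      exact hmem ⟨h, (not_le.1 hlt).le⟩

/-- The saddle-point evaluation of the contour integral, uniform up to the coalescence of the
saddle points. -/
theorem exists_norm_rayPrimitive_add_model_le {ε : ℝ} (hε : 0 < ε) :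
    ∃ K : ℝ, 0 ≤ K ∧ ∀ (d : ℕ) (a : ℝ) (x : ℂ), 0 < a → a < 1 → 1 ≤ x.im →
      d * (2 * a) = x.im * (1 + a ^ 2) → ε ≤ x.re → x.re ≤ 1 →
      ‖rayPrimitive (rotatedSeries d a) x (-Complex.I / a) + ehrhartSeries d (-Complex.I * a) *
        (Complex.I * (saddleScale a * modelIntegral (modelParam a x.im)))‖ ≤
      K * (x.im ^ (-(1 / 3) : ℝ) * ‖ehrhartSeries d (-Complex.I * a) *
        (Complex.I * (saddleScale a * modelIntegral (modelParam a x.im)))‖) := by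
  set C : ℝ := 108 * 4000 ^ 3 * Real.exp 10 with hC
  have hC0 : 0 < C := by positivity
  -- The three summands pay for the left end, the right end and the local comparison.
  refine ⟨(60 + 832 / (1 / 2000)) * C + 8 / ε * C + 60 * 340000000, by positivity, ?_⟩
  intro d a x h0 h1 hτ hd hx0 hx1
  have hτ0 : 0 < x.im := by linarith
  have hxp : 0 < x.re := by linarith
  have hκ := saddleScale_pos h0 h1
  have hμ := modelParam_pos h0 h1 hτ0
  obtain ⟨T₁, T₂, hT₁, hT₁0, hT₂, hκT₂, hX₁, hin, hup, hout⟩ := exists_local_range h0 h1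
  have hle : T₁ ≤ T₂ := by linarith
  have hT₂' : -1 / 3 < T₂ := by linarith
  set N : ℝ := x.im ^ (-(1 / 3) : ℝ) * (‖ehrhartSeries d (-Complex.I * a)‖ *
        (saddleScale a * cubicMass (8 * modelParam a x.im))) with hN
  have hv₁ := hin T₁ ⟨le_rfl, hle⟩
  have hv₂ := hin T₂ ⟨hle, le_rfl⟩
  have hend₁ := endpoint_estimate h0 h1 hτ hd hxp.le hx1 hT₁ hv₁
    (hout T₁ hT₁ fun h => lt_irrefl _ h.1)
  have hend₂ := endpoint_estimate h0 h1 hτ hd hxp.le hx1 hT₂' hv₂ (hup T₂ le_rfl)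
  rw [← hN, ← hC] at hend₁ hend₂
  have hmodel := norm_local_integral_sub_model_le h0 h1 hτ0 hd hxp.le hx1 hT₁ hin hout
  rw [← hN] at hmodel
  have hz₁ := abs_sub_one_saddlePath_le h0 h1 hT₁ hv₁
  have hz₂ := abs_sub_one_saddlePath_le h0 h1 hT₂' hv₂
  have hnorm : ∀ z : ℂ, ‖z - 1‖ ≤ 1 / 1000 → ‖z‖ ≤ 2 := by
    intro z hz
    have := norm_add_le (z - 1) 1
    rw [sub_add_cancel, norm_one] at this
    linarith
  have hleft := norm_rayPrimitive_sub_endpoint_le (η := 1 / 2000) (by norm_num) h0 h1 hτ hd hxp hx1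
    (z := saddlePath a T₁) (by rw [saddlePath_re]; nlinarith)
    (by rw [saddlePath_im]; linarith) (hnorm _ hz₁)
  have hr₁ := pathRatio_le_one hT₂.le
  have hr₀ := pathRatio_pos hT₂'
  have him₂ : (saddlePath a T₂).im = 1 / 2000 * pathRatio T₂ := by
    rw [saddlePath_im, pathAbscissa, ← mul_assoc, hκT₂]
  -- At T₂ the real part falls by 1/2000 and the imaginary part is at most 1/2000, so the end lies
  -- in the unit disc and hence |t| ≤ a < 1.
  have hn₂ : ‖saddlePath a T₂‖ ≤ 1 := by
    apply le_of_sq_le_sq _ zero_le_one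
    rw [← Complex.normSq_eq_norm_sq, Complex.normSq_apply, him₂, saddlePath_re, hκT₂]
    nlinarith
  have hne₂ : saddlePath a T₂ ≠ 0 :=
    Complex.slitPlane_ne_zero (saddlePath_mem h0 h1 hT₂' hv₂).1
  have hright := norm_rayPrimitive_le (d := d) (a := a) hxp hne₂
    (by rw [re_rotate, him₂]; positivity)
    (by rw [re_rotate, him₂]; nlinarith)
    (by
      rw [norm_mul, norm_mul, norm_neg, Complex.norm_I, one_mul, Complex.norm_real,
        Real.norm_of_nonneg h0.le]
      exact mul_le_one₀ h1.le (norm_nonneg _) hn₂)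
  have hFTC : ∫ T in Set.Ioc T₁ T₂, saddlePath a T ^ (x - 1) * rotatedSeries d a (saddlePath a T) *
        (Complex.I * (saddleScale a * deriv pathCurve T)) =
      rayPrimitive (rotatedSeries d a) x (saddlePath a T₂) -
        rayPrimitive (rotatedSeries d a) x (saddlePath a T₁) := by
    rw [← intervalIntegral.integral_of_le hle]
    refine intervalIntegral.integral_eq_sub_of_hasDerivAt
      (f := fun T => rayPrimitive (rotatedSeries d a) x (saddlePath a T)) (fun T hT => ?_) ?_
    · rw [Set.uIcc_of_le hle] at hT
      have hT' : -1 / 3 < T := hT₁.trans_le hT.1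
      obtain ⟨m1, m2⟩ := saddlePath_mem h0 h1 hT' (hin T hT)
      exact HasDerivAt.comp_of_eq T (hasDerivAt_rayPrimitive_rotatedSeries hxp m1 m2)
        (hasDerivAt_saddlePath hT') rfl
    · apply ContinuousOn.intervalIntegrable
      rw [Set.uIcc_of_le hle]
      exact continuousOn_saddlePath_integrand d h0 h1 x
        fun T hT => ⟨hT₁.trans_le hT.1, hin T hT⟩
  rw [hFTC] at hmodel
  have hmass : N ≤ x.im ^ (-(1 / 3) : ℝ) * ‖ehrhartSeries d (-Complex.I * a) *
        (Complex.I * (saddleScale a * modelIntegral (modelParam a x.im)))‖ := by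
    rw [hN, norm_mul, norm_mul, norm_mul, Complex.norm_I, one_mul, Complex.norm_real,
      Real.norm_of_nonneg hκ.le]
    have := cubicMass_le_norm_integral hμ
    have := Real.rpow_pos_of_pos hτ0 (-(1 / 3) : ℝ)
    unfold modelIntegral
    gcongr
  have hright' : ‖rayPrimitive (rotatedSeries d a) x (saddlePath a T₂)‖ ≤ 8 / ε * (C * N) := by
    refine hright.trans (mul_le_mul ?_ hend₂ (norm_nonneg _) (by positivity))
    calc 4 * ‖saddlePath a T₂‖ / x.re ≤ 4 * 2 / ε := by
          gcongr
          linarith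
      _ = 8 / ε := by norm_num
  have hleft' := hleft.trans (mul_le_mul_of_nonneg_left hend₁ (by norm_num))
  set H := rayPrimitive (rotatedSeries d a) x
  set A := ehrhartSeries d (-Complex.I * a) *
        (Complex.I * (saddleScale a * modelIntegral (modelParam a x.im)))
  -- The increment from T₁ to T₂ is close to A, the value at T₂ is small, and the value at T₁ is
  -- close to that at t = -1; hence the minus sign of the main term.
  have hdec : H (-Complex.I / a) + A = H (saddlePath a T₂) - (H (saddlePath a T₁) -
      H (-Complex.I / a)) - (H (saddlePath a T₂) - H (saddlePath a T₁) - A) := by ring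
  rw [hdec]
  have t1 := norm_sub_le (H (saddlePath a T₂) - (H (saddlePath a T₁) -
      H (-Complex.I / a))) (H (saddlePath a T₂) - H (saddlePath a T₁) - A)
  have t2 := norm_sub_le (H (saddlePath a T₂)) (H (saddlePath a T₁) - H (-Complex.I / a))
  refine le_trans ?_ (mul_le_mul_of_nonneg_left hmass (by positivity))
  rw [add_mul, add_mul]
  linarith

/-! ### Taylor coefficients of the phase and the final formula. -/

section
variable {d : ℕ} {a τ : ℝ}

theorem iteratedDeriv_phase {t : ℂ} (h1 : 1 + t ∈ Complex.slitPlane)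
    (h2 : 1 - t ∈ Complex.slitPlane) (h3 : t ∈ Complex.slitPlane) :
    iteratedDeriv 2 (phase d τ) t =
        d * (-1 / (1 + t) ^ 2 + 1 / (1 - t) ^ 2) - Complex.I * τ / t ^ 2 ∧
      iteratedDeriv 3 (phase d τ) t =
        d * (2 / (1 + t) ^ 3 + 2 / (1 - t) ^ 3) + 2 * Complex.I * τ / t ^ 3 := by
  set V : Set ℂ := {t | 1 + t ∈ Complex.slitPlane ∧ 1 - t ∈ Complex.slitPlane ∧
    t ∈ Complex.slitPlane} with hV
  have hVo : IsOpen V :=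
    (Complex.isOpen_slitPlane.preimage (by fun_prop)).inter
      ((Complex.isOpen_slitPlane.preimage (by fun_prop)).inter Complex.isOpen_slitPlane)
  have ht : t ∈ V := ⟨h1, h2, h3⟩
  have e1 : Set.EqOn (deriv (phase d τ))
      (fun t => d * (1 / (1 + t) + 1 / (1 - t)) + Complex.I * τ / t) V := by
    rintro t ⟨h1, h2, h3⟩
    have d1 : HasDerivAt (fun t : ℂ => Complex.log (1 + t)) (1 / (1 + t)) t :=
      ((hasDerivAt_id t).const_add 1).clog h1
    have d2 : HasDerivAt (fun t : ℂ => Complex.log (1 - t)) (-1 / (1 - t)) t :=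
      ((hasDerivAt_id t).const_sub 1).clog h2
    have d3 := Complex.hasDerivAt_log h3
    have := ((d1.sub d2).const_mul (d : ℂ)).add (d3.const_mul (Complex.I * τ))
    refine HasDerivAt.deriv (this.congr_deriv ?_)
    ring
  have e2 : Set.EqOn (deriv (fun t : ℂ => d * (1 / (1 + t) + 1 / (1 - t)) + Complex.I * τ / t))
      (fun t => d * (-1 / (1 + t) ^ 2 + 1 / (1 - t) ^ 2) - Complex.I * τ / t ^ 2) V := by
    rintro t ⟨h1, h2, h3⟩
    have n1 := Complex.slitPlane_ne_zero h1
    have n2 := Complex.slitPlane_ne_zero h2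
    have n3 := Complex.slitPlane_ne_zero h3
    have d1 := (hasDerivAt_const t (1 : ℂ)).div ((hasDerivAt_id t).const_add 1) n1
    have d2 := (hasDerivAt_const t (1 : ℂ)).div ((hasDerivAt_id t).const_sub 1) n2
    have d3 := (hasDerivAt_const t (Complex.I * τ)).div (hasDerivAt_id t) n3
    have := ((d1.add d2).const_mul (d : ℂ)).add d3
    refine HasDerivAt.deriv (this.congr_deriv ?_)
    simp only [id]
    ring
  have e3 : Set.EqOn (deriv (fun t : ℂ => d * (-1 / (1 + t) ^ 2 + 1 / (1 - t) ^ 2) -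
      Complex.I * τ / t ^ 2))
      (fun t => d * (2 / (1 + t) ^ 3 + 2 / (1 - t) ^ 3) + 2 * Complex.I * τ / t ^ 3) V := by
    rintro t ⟨h1, h2, h3⟩
    have n1 := Complex.slitPlane_ne_zero h1
    have n2 := Complex.slitPlane_ne_zero h2
    have n3 := Complex.slitPlane_ne_zero h3
    have d1 := (hasDerivAt_const t (-1 : ℂ)).div (((hasDerivAt_id t).const_add 1).pow 2)
      (pow_ne_zero 2 n1)
    have d2 := (hasDerivAt_const t (1 : ℂ)).div (((hasDerivAt_id t).const_sub 1).pow 2)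
      (pow_ne_zero 2 n2)
    have d3 := (hasDerivAt_const t (Complex.I * τ)).div ((hasDerivAt_id t).pow 2)
      (pow_ne_zero 2 n3)
    have := ((d1.add d2).const_mul (d : ℂ)).sub d3
    refine HasDerivAt.deriv (this.congr_deriv ?_)
    simp only [id, Pi.pow_apply]
    push_cast
    field_simp
    ring
  have f2 : Set.EqOn (iteratedDeriv 2 (phase d τ))
      (fun t => d * (-1 / (1 + t) ^ 2 + 1 / (1 - t) ^ 2) - Complex.I * τ / t ^ 2) V := by
    rw [iteratedDeriv_succ, iteratedDeriv_one]
    exact (e1.deriv hVo).trans e2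
  refine ⟨f2 ht, ?_⟩
  rw [iteratedDeriv_succ]
  exact (f2.deriv hVo).trans e3 ht

theorem saddle_mem_slitPlane (h0 : 0 < a) : 1 + -Complex.I * a ∈ Complex.slitPlane ∧
    1 - -Complex.I * a ∈ Complex.slitPlane ∧ -Complex.I * a ∈ Complex.slitPlane := by
  refine ⟨Or.inl (by simp), Or.inl (by simp), Or.inr ?_⟩
  simp [h0.ne']

theorem phase_derivs_at_saddle (h0 : 0 < a) (hd : d * (2 * a) = τ * (1 + a ^ 2)) :
    (2 : ℂ) * (iteratedDeriv 2 (phase d τ) (-Complex.I * a) / 2) =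
        Complex.I * τ * quadCoeff a / a ^ 2 ∧
      (3 : ℂ) * (iteratedDeriv 3 (phase d τ) (-Complex.I * a) / 6) = τ * cubicCoeff a / a ^ 3 := by
  obtain ⟨m1, m2, m3⟩ := saddle_mem_slitPlane h0
  obtain ⟨f2, f3⟩ := iteratedDeriv_phase (d := d) (τ := τ) m1 m2 m3
  have hI : Complex.I ^ 2 = -1 := Complex.I_sq
  have hI3 : Complex.I ^ 3 = -Complex.I := by rw [pow_succ, hI]; ring
  have hac : (a : ℂ) ≠ 0 := by exact_mod_cast h0.ne'
  have hS : (1 + a ^ 2 : ℂ) ≠ 0 := by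
    have : (1 + a ^ 2 : ℝ) ≠ 0 := by positivity
    exact_mod_cast this
  have hdc : (d : ℂ) = τ * (1 + a ^ 2) / (2 * a) := by
    rw [eq_div_iff (by simpa using hac)]
    exact_mod_cast hd
  have p1 : 1 / (1 + -Complex.I * a) = (1 + Complex.I * a) / (1 + a ^ 2) := by
    rw [div_eq_div_iff (Complex.slitPlane_ne_zero m1) hS]
    linear_combination (a : ℂ) ^ 2 * hI
  have p2 : 1 / (1 - -Complex.I * a) = (1 - Complex.I * a) / (1 + a ^ 2) := by
    rw [div_eq_div_iff (Complex.slitPlane_ne_zero m2) hS]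
    linear_combination (a : ℂ) ^ 2 * hI
  have p3 : 1 / (-Complex.I * a) = Complex.I / a := by
    rw [div_eq_div_iff (Complex.slitPlane_ne_zero m3) hac]
    linear_combination (a : ℂ) * hI
  have g2 : ∀ w : ℂ, (-1 : ℂ) / w ^ 2 = -(1 / w) ^ 2 := fun w => by rw [one_div, inv_pow]; ring
  have g2' : ∀ w : ℂ, (1 : ℂ) / w ^ 2 = (1 / w) ^ 2 := fun w => by rw [one_div, one_div, inv_pow]
  have g3 : ∀ w : ℂ, (2 : ℂ) / w ^ 3 = 2 * (1 / w) ^ 3 := fun w => by rw [one_div, inv_pow]; ring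
  have q2 : ∀ s w : ℂ, s / w ^ 2 = s * (1 / w) ^ 2 := fun s w => by rw [one_div, inv_pow]; ring
  have q3 : ∀ s w : ℂ, s / w ^ 3 = s * (1 / w) ^ 3 := fun s w => by rw [one_div, inv_pow]; ring
  constructor
  · rw [f2, g2, g2', q2 (Complex.I * τ), p1, p2, p3, hdc, quadCoeff]
    push_cast
    generalize hs : (1 + a ^ 2 : ℂ) = s at *
    have hs' : s = 1 + (a : ℂ) ^ 2 := hs.symm
    field_simp
    ring_nf
    simp only [hI3]
    rw [hs']
    ring
  · rw [f3, g3, g3, q3 (2 * Complex.I * τ), p1, p2, p3, hdc, cubicCoeff]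
    push_cast
    have hI4 : Complex.I ^ 4 = 1 := Complex.I_pow_four
    generalize hs : (1 + a ^ 2 : ℂ) = s at *
    have hs' : s = 1 + (a : ℂ) ^ 2 := hs.symm
    field_simp
    ring_nf
    simp only [hI, hI4]
    rw [hs']
    ring

end

/-- The rescaled modulus of the saddle point. -/
theorem exists_saddlePoint_eq {d : ℕ} {x : ℂ} (hτ : 0 < x.im) (hd : x.im < d) :
    ∃ a : ℝ, 0 < a ∧ a < 1 ∧ d * (2 * a) = x.im * (1 + a ^ 2) ∧
      saddlePoint d x = -Complex.I * a := by
  set D : ℝ := d / x.im with hD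
  have hD1 : 1 < D := by rwa [hD, one_lt_div hτ]
  have hsq : Real.sqrt (D ^ 2 - 1) ^ 2 = D ^ 2 - 1 := Real.sq_sqrt (by nlinarith)
  have hs0 := Real.sqrt_nonneg (D ^ 2 - 1)
  have hdD : (d : ℝ) = D * x.im := by rw [hD]; field_simp
  have hlt : Real.sqrt (D ^ 2 - 1) < D := by nlinarith
  have hgt : D - 1 < Real.sqrt (D ^ 2 - 1) := by
    by_contra h
    push Not at h
    nlinarith
  -- The smaller root of a² - 2Da + 1 = 0 with D = d/τ > 1; the two roots are reciprocal, so it lies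
  -- in (0,1).
  refine ⟨D - Real.sqrt (D ^ 2 - 1), by linarith, by linarith, ?_, ?_⟩
  · rw [hdD]
    linear_combination (-x.im) * hsq
  · rw [saddlePoint, ← div_pow, ← hD]

section
variable {d : ℕ} {a : ℝ} {x : ℂ}

theorem phaseCoeff_two_three (h0 : 0 < a) (hd : d * (2 * a) = x.im * (1 + a ^ 2))
    (hα : saddlePoint d x = -Complex.I * a) :
    phaseCoeff d x 2 = Complex.I * x.im * quadCoeff a / a ^ 2 ∧
      phaseCoeff d x 3 = x.im * cubicCoeff a / a ^ 3 := by
  obtain ⟨h2, h3⟩ := phase_derivs_at_saddle h0 hd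
  have f3 : ((Nat.factorial 3 : ℕ) : ℂ) = 6 := by norm_num [Nat.factorial]
  have f2 : ((Nat.factorial 2 : ℕ) : ℂ) = 2 := by norm_num [Nat.factorial]
  constructor
  · rw [phaseCoeff, hα, f2, ← h2]
    norm_num
  · rw [phaseCoeff, hα, f3, ← h3]
    norm_num

/-- C₂ is purely imaginary and C₃ is real, and in C₂³/C₃² the powers of a cancel: the quotient is -i
times a positive number. The exponent of the integrand is therefore real and negative off the
saddle. -/
theorem saddleIntegrand_eq (h0 : 0 < a) (h1 : a < 1) (hτ : 0 < x.im)
    (hd : d * (2 * a) = x.im * (1 + a ^ 2)) (hα : saddlePoint d x = -Complex.I * a) (T : ℝ) :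
    saddleIntegrand d x T =
      (Real.exp (-(modelParam a x.im * pathExponent T)) : ℂ) * deriv pathCurve T := by
  obtain ⟨h2, h3⟩ := phaseCoeff_two_three h0 hd hα
  have hac : (a : ℂ) ≠ 0 := by exact_mod_cast h0.ne'
  have hτc : (x.im : ℂ) ≠ 0 := by exact_mod_cast hτ.ne'
  have hγ : (cubicCoeff a : ℂ) ≠ 0 := by
    have := half_le_cubicCoeff h0 h1
    exact_mod_cast (by linarith : (0 : ℝ) < cubicCoeff a).ne'
  have hI4 : Complex.I ^ 4 = 1 := Complex.I_pow_four
  rw [saddleIntegrand, h2, h3, Complex.ofReal_exp, modelParam]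
  congr 2
  push_cast
  field_simp
  linear_combination (-((quadCoeff a : ℂ) ^ 3 * pathExponent T)) * hI4

theorem three_mul_phaseCoeff_div (h0 : 0 < a) (h1 : a < 1) (hτ : 0 < x.im)
    (hd : d * (2 * a) = x.im * (1 + a ^ 2)) (hα : saddlePoint d x = -Complex.I * a) :
    3 * phaseCoeff d x 2 / (2 * phaseCoeff d x 3) = Complex.I * a * saddleScale a := by
  obtain ⟨h2, h3⟩ := phaseCoeff_two_three h0 hd hα
  have hac : (a : ℂ) ≠ 0 := by exact_mod_cast h0.ne'
  have hτc : (x.im : ℂ) ≠ 0 := by exact_mod_cast hτ.ne'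
  have hγ : (cubicCoeff a : ℂ) ≠ 0 := by
    have := half_le_cubicCoeff h0 h1
    exact_mod_cast (by linarith : (0 : ℝ) < cubicCoeff a).ne'
  rw [h2, h3, saddleScale]
  push_cast
  field_simp

/-- The contour representation of `ehrhartHalf`. -/
theorem ehrhartHalf_eq_rayPrimitive (d : ℕ) (h0 : 0 < a) (x : ℂ) :
    ehrhartHalf d x = Complex.I / (2 * Real.pi) * (1 - Complex.exp (2 * Real.pi * Complex.I * x)) *
      (-Complex.I * a) ^ x * rayPrimitive (rotatedSeries d a) x (-Complex.I / a) := by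
  have hac : (a : ℂ) ≠ 0 := by exact_mod_cast h0.ne'
  have hnI : -Complex.I ≠ 0 := neg_ne_zero.2 Complex.I_ne_zero
  have hray : rayPrimitive (rotatedSeries d a) x (-Complex.I / a) =
      (-Complex.I / a) ^ x * halfMellin d x := by
    rw [rayPrimitive, halfMellin]
    congr 1
    refine intervalIntegral.integral_congr fun u _ => ?_
    simp only [rotatedSeries]
    congr 2
    field_simp
    linear_combination (u : ℂ) * Complex.I_sq
  -- Both bases have argument -π/2, so the principal logarithms add up to -iπ: the point t = -1 is
  -- reached from below the cut.
  have hpow : (-Complex.I * a) ^ x * (-Complex.I / a) ^ x =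
      Complex.exp (-(Real.pi * x * Complex.I)) := by
    have hi : -Complex.I / a = ((a⁻¹ : ℝ) : ℂ) * -Complex.I := by
      push_cast
      field_simp
    rw [hi, mul_comm (-Complex.I), Complex.cpow_def_of_ne_zero (mul_ne_zero hac hnI),
      Complex.cpow_def_of_ne_zero (mul_ne_zero (by simpa using hac) hnI),
      Complex.log_ofReal_mul h0 hnI, Complex.log_ofReal_mul (inv_pos.2 h0) hnI,
      Complex.log_neg_I, Real.log_inv, ← Complex.exp_add]
    congr 1
    push_cast
    ring
  have hpi : (Real.pi : ℂ) ≠ 0 := by exact_mod_cast Real.pi_ne_zero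
  have hexp : Complex.exp (-(Real.pi * x * Complex.I)) *
      Complex.exp (2 * Real.pi * Complex.I * x) = Complex.exp (Real.pi * x * Complex.I) := by
    rw [← Complex.exp_add]
    congr 1
    ring
  have e : Complex.I / (2 * Real.pi) * (1 - Complex.exp (2 * Real.pi * Complex.I * x)) *
      (-Complex.I * a) ^ x * ((-Complex.I / a) ^ x * halfMellin d x) =
      Complex.I / (2 * Real.pi) * (Complex.exp (-(Real.pi * x * Complex.I)) -
        Complex.exp (Real.pi * x * Complex.I)) * halfMellin d x := by
    rw [← hexp]
    linear_combination (Complex.I / (2 * Real.pi) *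
      (1 - Complex.exp (2 * Real.pi * Complex.I * x)) * halfMellin d x) * hpow
  rw [hray, e, ehrhartHalf, Complex.sin, neg_mul]
  field_simp

end

/-- The saddle-point asymptotics of `ehrhartHalf`, uniform for `1 ≤ Im x < d`. -/
theorem exists_ehrhartHalf_saddle {ε : ℝ} (hε : 0 < ε) :
    ∃ K : ℝ, ∀ (d : ℕ) (x : ℂ), 1 ≤ x.im → x.im < d → ε ≤ x.re → x.re ≤ 1 →
      MeasureTheory.IntegrableOn (saddleIntegrand d x) (Set.Ioi (-1 / 3 : ℝ)) ∧
      ∃ δ : ℂ, ‖δ‖ ≤ K * x.im ^ (-(1 / 3) : ℝ) ∧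
        ehrhartHalf d x = -(1 / (2 * Real.pi * saddlePoint d x)) *
          (3 * phaseCoeff d x 2 / (2 * phaseCoeff d x 3)) *
          ehrhartSeries d (saddlePoint d x) * saddlePoint d x ^ x *
          saddleIntegral d x * (1 + δ) := by
  obtain ⟨K, hK0, hK⟩ := exists_norm_rayPrimitive_add_model_le hε
  refine ⟨1 + 2 * K, fun d x hτ hd hx0 hx1 => ?_⟩
  have hτ0 : 0 < x.im := by linarith
  obtain ⟨a, h0, h1, hda, hα⟩ := exists_saddlePoint_eq hτ0 hd
  have hint : saddleIntegrand d x = fun T =>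
      (Real.exp (-(modelParam a x.im * pathExponent T)) : ℂ) * deriv pathCurve T :=
    funext fun T => saddleIntegrand_eq h0 h1 hτ0 hda hα T
  have hI : saddleIntegral d x = modelIntegral (modelParam a x.im) := by
    rw [saddleIntegral, hint, modelIntegral]
  refine ⟨hint ▸ integrableOn_model (modelParam_pos h0 h1 hτ0), ?_⟩
  have hbound := hK d a x h0 h1 hτ hda hx0 hx1
  rw [ehrhartHalf_eq_rayPrimitive d h0 x, three_mul_phaseCoeff_div h0 h1 hτ0 hda hα, hα, hI]
  set H := rayPrimitive (rotatedSeries d a) x (-Complex.I / a)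
  set M := modelIntegral (modelParam a x.im)
  set E := ehrhartSeries d (-Complex.I * a)
  set A := E * (Complex.I * (saddleScale a * M)) with hA
  set e := Complex.exp (2 * Real.pi * Complex.I * x) with he
  set r : ℝ := x.im ^ (-(1 / 3) : ℝ) with hr
  have hr0 : 0 < r := Real.rpow_pos_of_pos hτ0 _
  -- If A = 0 the quotient is 0 by convention, and the bound forces H + A = 0, so the identity
  -- survives.
  have hquot : (H + A) / A * A = H + A := by
    by_cases hA0 : A = 0
    · rw [hA0, norm_zero, mul_zero, mul_zero] at hbound
      have := norm_le_zero_iff.1 hbound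
      rw [hA0, this, mul_zero]
    · exact div_mul_cancel₀ _ hA0
  have hquotn : ‖(H + A) / A‖ ≤ K * r := by
    rw [norm_div]
    apply div_le_of_le_mul₀ (norm_nonneg _) (by positivity)
    rw [mul_assoc]
    exact hbound
  have hen : ‖e‖ ≤ r := by
    -- The term e^(2πix), left over from writing the sine with exponentials, has modulus e^(-2πτ)
    -- and goes into δ.
    have h2 : (2 * (Real.pi : ℂ) * Complex.I * x).re = -(2 * Real.pi * x.im) := by
      simp
    rw [he, Complex.norm_exp, h2, Real.exp_neg]
    have h3 : x.im ≤ Real.exp (2 * Real.pi * x.im) := by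
      have := Real.add_one_le_exp (2 * Real.pi * x.im)
      nlinarith [Real.pi_gt_three]
    calc (Real.exp (2 * Real.pi * x.im))⁻¹ ≤ x.im⁻¹ := inv_anti₀ hτ0 h3
      _ = x.im ^ (-1 : ℝ) := (Real.rpow_neg_one _).symm
      _ ≤ r := Real.rpow_le_rpow_of_exponent_le hτ (by norm_num)
  have hr1 : r ≤ 1 := Real.rpow_le_one_of_one_le_of_nonpos hτ (by norm_num)
  -- This δ solves (1+δ)A = -(1-e)H, using H = -A + (H+A).
  refine ⟨-e - (1 - e) * ((H + A) / A), ?_, ?_⟩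
  · have h1e : ‖1 - e‖ ≤ 2 := (norm_sub_le _ _).trans (by rw [norm_one]; linarith)
    refine (norm_sub_le _ _).trans ?_
    rw [norm_neg, norm_mul]
    calc ‖e‖ + ‖1 - e‖ * ‖(H + A) / A‖ ≤ r + 2 * (K * r) := by gcongr
      _ = _ := by ring
  · have hac : (a : ℂ) ≠ 0 := by exact_mod_cast h0.ne'
    have hpi : (Real.pi : ℂ) ≠ 0 := by exact_mod_cast Real.pi_ne_zero
    have hcoef : -(1 / (2 * Real.pi * (-Complex.I * a))) * (Complex.I * a * saddleScale a) * E *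
        (-Complex.I * a) ^ x * M = -(Complex.I / (2 * Real.pi)) * (-Complex.I * a) ^ x * A := by
      rw [hA]
      have : 1 / (2 * Real.pi * (-Complex.I * a)) = Complex.I / (2 * Real.pi * a) := by
        have hI0 := Complex.I_ne_zero
        rw [div_eq_div_iff (by simp [hac, hpi]) (by simp [hac, hpi])]
        linear_combination (2 * Real.pi * a : ℂ) * Complex.I_sq
      rw [this]
      field_simp
    rw [hcoef]
    linear_combination (-(Complex.I / (2 * Real.pi)) * (1 - e) * (-Complex.I * a) ^ x) * hquot

theorem theorem1 (ε : ℝ) (hε : ε ∈ Set.Ioo (0 : ℝ) (1 / 2)) :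
    ∃ F : ℕ → ℂ → ℂ,
      -- the decomposition of `L_d(-x)`, and the reflection that covers `Im x < 0`
      (∃ d₀ : ℕ, ∀ d ≥ d₀, ∀ x ∈ truncatedStrip ε d,
        (ehrhartPolynomial d).eval (-x) =
            F d x + (-1) ^ d * (starRingEnd ℂ) (F d (1 - (starRingEnd ℂ) x)) ∧
          F d ((starRingEnd ℂ) x) = (starRingEnd ℂ) (F d x)) ∧
      -- the range `x = O(√(log d))`
      (∀ A : ℝ, 0 < A → ∃ (K : ℝ) (d₀ : ℕ), ∀ d ≥ d₀, ∀ x ∈ truncatedStrip ε d,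
        ‖x‖ ≤ A * Real.sqrt (Real.log d) →
          ∃ δ : ℂ, ‖δ‖ ≤ K * ‖(2 * d + 1 : ℂ) ^ (-x - 1)‖ ∧
            F d x = Complex.sin (Real.pi * x) / Real.pi *
              ((2 * d + 1 : ℂ) ^ (-x) * Complex.Gamma x + δ)) ∧
      -- the range `√(log d) ≪ |x| ≤ d - d^(1/6)`
      (∀ c : ℝ, 0 < c → ∃ (K : ℝ) (d₀ : ℕ), ∀ d ≥ d₀, ∀ x ∈ truncatedStrip ε d,
        0 < x.im → c * Real.sqrt (Real.log d) ≤ ‖x‖ →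
          MeasureTheory.IntegrableOn (saddleIntegrand d x) (Set.Ioi (-1 / 3 : ℝ)) ∧
          ∃ δ : ℂ, ‖δ‖ ≤ K * x.im ^ (-(1 / 28) : ℝ) ∧
            F d x = -(1 / (2 * Real.pi * saddlePoint d x)) *
              (3 * phaseCoeff d x 2 / (2 * phaseCoeff d x 3)) *
              ehrhartSeries d (saddlePoint d x) * saddlePoint d x ^ x *
              saddleIntegral d x * (1 + δ)) := by
  have hre1 : ∀ {d : ℕ} {x : ℂ}, x ∈ truncatedStrip ε d → 0 < x.re ∧ x.re < 1 := fun hx =>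
    ⟨hε.1.trans_le hx.1.1, by linarith [hx.1.2, hε.1]⟩
  -- The threshold 1 excludes d = 0, where the cross-polytope is empty.
  refine ⟨ehrhartHalf, ⟨1, fun d hd x hx => ⟨?_, ehrhartHalf_conj d x⟩⟩, fun A _ => ?_,
    fun c hc => ?_⟩
  · exact ehrhartPolynomial_eval_neg_eq (hre1 hx).1 (hre1 hx).2 hd
  · obtain ⟨K, hK⟩ := ehrhartHalf_eq_Gamma_add hε.1
    exact ⟨K, 0, fun d _ x hx _ => hK d x hx.1⟩
  · obtain ⟨K, hK⟩ := exists_ehrhartHalf_saddle hε.1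
    -- For such d one has c√(log d) ≥ 2, and |x| ≥ 2 with 0 < Re x < 1 forces Im x ≥ 1.
    refine ⟨|K|, ⌈Real.exp ((2 / c) ^ 2)⌉₊, fun d hd x hx him hlow => ?_⟩
    have hdexp : Real.exp ((2 / c) ^ 2) ≤ d := (Nat.le_ceil _).trans (by exact_mod_cast hd)
    have hd0 : (0 : ℝ) < d := (Real.exp_pos _).trans_le hdexp
    have hsqrt : 2 / c ≤ Real.sqrt (Real.log d) := by
      apply Real.le_sqrt_of_sq_le
      rwa [Real.le_log_iff_exp_le hd0]
    have h2 : 2 ≤ c * Real.sqrt (Real.log d) := by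
      calc (2 : ℝ) = c * (2 / c) := by field_simp
        _ ≤ _ := by gcongr
    have hτ : 1 ≤ x.im := by
      have := Complex.norm_le_abs_re_add_abs_im x
      rw [abs_of_pos (hre1 hx).1, abs_of_pos him] at this
      linarith [(hre1 hx).2]
    have hτd : x.im < d := by
      have h3 := (Complex.im_le_norm x).trans hx.2
      have := Real.rpow_pos_of_pos hd0 (1 / 6 : ℝ)
      linarith
    obtain ⟨hint, δ, hδ, heq⟩ := hK d x hτ hτd hx.1.1 (hre1 hx).2.le
    refine ⟨hint, δ, hδ.trans ?_, heq⟩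
    calc K * x.im ^ (-(1 / 3) : ℝ) ≤ |K| * x.im ^ (-(1 / 3) : ℝ) := by
          gcongr
          exact le_abs_self K
      _ ≤ |K| * x.im ^ (-(1 / 28) : ℝ) := by
          exact mul_le_mul_of_nonneg_left
            (Real.rpow_le_rpow_of_exponent_le hτ (by norm_num)) (abs_nonneg K)
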